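/- Let $S$ be a complex surface (a Hausdorff complex manifold of dimension $2$, not necessarily compact or Kähler), with sheaf of holomorphic functions $\mathcal O_S$ and canonical sheaf $K_S$ of holomorphic $2$-forms. Let $Z\subset S$ be a finite set of points with its reduced structure, $I_Z\subset\mathcal O_S$ the ideal sheaf of holomorphic functions vanishing on $Z$, and $I_Z^2$ its square. Let $L_1,L_2$ be line bundles and $E$ a rank-$2$ holomorphic vector bundle on $S$ (viewed as locally free $\mathcal O_S$-modules), and let $$0\to L_1\xrightarrow{\ i\ }E\xrightarrow{\ q\ }L_2\otimes I_Z\to 0$$ be a short exact sequence of $\mathcal O_S$-modules. Write $\mathcal Hom$ for the sheaf of $\mathcal O_S$-linear homomorphisms, $L^{-1}=\mathcal Hom(L,\mathcal O_S)$ for a line bundle $L$, and $i^*$, $q^*$ for precomposition with $i$, $q$. Then there are short exact sequences of $\mathcal O_S$-modules $$0\to L_2^{-1}\otimes L_1\otimes K_S\xrightarrow{\ q^*\ }\mathcal Hom(E,L_1\otimes K_S)\xrightarrow{\ i^*\ }K_S\otimes I_Z\to 0,$$ $$0\to K_S\xrightarrow{\ q^*\ }\mathcal Hom(E,L_2\otimes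 K_S\otimes I_Z)\xrightarrow{\ i^*\ }L_1^{-1}\otimes L_2\otimes K_S\otimes I_Z^2\to 0.$$ Here the outer terms are identified by the following canonical maps, of which those in (a) are isomorphisms and those in (b) are injective, the image of $i^*$ being the image of the respective map in (b): (a) $L_2^{-1}\otimes L_1\otimes K_S\to\mathcal Hom(L_2\otimes I_Z,L_1\otimes K_S)$, $\varphi\otimes t\mapsto(l\otimes a\mapsto\varphi(l)\,a\,t)$, and $K_S\to\mathcal Hom(L_2\otimes I_Z,L_2\otimes K_S\otimes I_Z)$, $k\mapsto(l\otimes a\mapsto l\otimes k\otimes a)$; (b) $K_S\otimes I_Z\to\mathcal Hom(L_1,L_1\otimes K_S)$, $k\otimes a\mapsto(l\mapsto a\,l\otimes k)$, and $L_1^{-1}\otimes L_2\otimes K_S\otimes I_Z^2\to\mathcal Hom(L_1,L_2\otimes K_S\otimes I_Z)$, $\varphi\otimes t\otimes b\mapsto(l\mapsto\varphi(l)\,t\otimes b)$. -/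

import Mathlib

open CategoryTheory TopologicalSpace Opposite
open scoped Manifold ContDiff

universe u

namespace SheafMod
variable {X : TopCat.{u}}

/-- A sheaf of commutative rings, regarded as a sheaf of rings. -/
abbrev ringSheaf (𝒪 : Sheaf (Opens.grothendieckTopology X) CommRingCat.{u}) :
    Sheaf (Opens.grothendieckTopology X) RingCat.{u} :=
  (sheafCompose _ (forget₂ CommRingCat RingCat.{u})).obj 𝒪

/-- The category of sheaves of `𝒪`-modules. -/
abbrev ModSheaf (𝒪 : Sheaf (Opens.grothendieckTopology X) CommRingCat.{u}) :=
  SheafOfModules.{u} (ringSheaf 𝒪)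

variable {𝒪 : Sheaf (Opens.grothendieckTopology X) CommRingCat.{u}}

/-- The ring `𝒪(U)`. -/
abbrev Fn (𝒪 : Sheaf (Opens.grothendieckTopology X) CommRingCat.{u}) (U : Opens X) : Type u :=
  𝒪.obj.obj (op U)

/-- The restriction map `𝒪(U) → 𝒪(V)`. -/
abbrev resFn {U V : Opens X} (h : V ≤ U) : Fn 𝒪 U →+* Fn 𝒪 V := (𝒪.obj.map (homOfLE h).op).hom

/-- The sections `M(U)` of a sheaf of modules. -/
abbrev Sec (M : ModSheaf 𝒪) (U : Opens X) : Type u := M.val.obj (op U)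

noncomputable instance (M : ModSheaf 𝒪) (U : Opens X) : Module (Fn 𝒪 U) (Sec M U) :=
  (M.val.obj (op U)).isModule

/-- The product `f • m ∈ M(U)` of `f ∈ 𝒪(U)` and `m ∈ M(U)`. -/
noncomputable def smulSec {M : ModSheaf 𝒪} {U : Opens X} (f : Fn 𝒪 U) (m : Sec M U) : Sec M U := f • m

/-- The restriction map `M(U) → M(V)` of a sheaf of modules. -/
noncomputable def res (M : ModSheaf 𝒪) {U V : Opens X} (h : V ≤ U) :
    Sec M U →ₛₗ[resFn (𝒪 := 𝒪) h] Sec M V :=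
  M.val.restrictₛₗ (homOfLE h).op

/-- The map `M(U) → N(U)` induced by a morphism of sheaves of modules. -/
noncomputable def onSec {M N : ModSheaf 𝒪} (f : M ⟶ N) (U : Opens X) : Sec M U →ₗ[Fn 𝒪 U] Sec N U :=
  (f.val.app (op U)).hom

/-- The tensor product `M ⊗ N` of sheaves of modules: the sheaf associated with the presheaf
`U ↦ M(U) ⊗ N(U)`. -/
noncomputable def tensor (M N : ModSheaf 𝒪) : ModSheaf 𝒪 :=
  (PresheafOfModules.sheafification (𝟙 (ringSheaf 𝒪).obj)).obj
    (MonoidalCategory.tensorObj (C := PresheafOfModules.{u} (𝒪.obj ⋙ forget₂ _ _)) M.val N.val)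

/-- The section `m ⊗ n` of `M ⊗ N` over `U` defined by `m ∈ M(U)` and `n ∈ N(U)`. -/
noncomputable def tmul {M N : ModSheaf 𝒪} {U : Opens X} (m : Sec M U) (n : Sec N U) :
    Sec (tensor M N) U :=
  ((PresheafOfModules.sheafificationAdjunction (𝟙 (ringSheaf 𝒪).obj)).unit.app
    (MonoidalCategory.tensorObj (C := PresheafOfModules.{u} (𝒪.obj ⋙ forget₂ _ _)) M.val N.val)).app (op U)
      (TensorProduct.tmul (Fn 𝒪 U) m n)

lemma res_res (M : ModSheaf 𝒪) {U V W : Opens X} (h : V ≤ U) (k : W ≤ V) (m : Sec M U) :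
    res M k (res M h m) = res M (k.trans h) m :=
  (M.val.map_comp_apply (homOfLE h).op (homOfLE k).op m).symm

lemma onSec_res {M N : ModSheaf 𝒪} (f : M ⟶ N) {U V : Opens X} (h : V ≤ U) (m : Sec M U) :
    onSec f V (res M h m) = res N h (onSec f U m) :=
  PresheafOfModules.naturality_apply f.val (homOfLE h).op m

lemma resFn_resFn {U V W : Opens X} (h : V ≤ U) (k : W ≤ V) (f : Fn 𝒪 U) :
    resFn (𝒪 := 𝒪) k (resFn h f) = resFn (k.trans h) f := by
  have := congr($(𝒪.obj.map_comp (homOfLE h).op (homOfLE k).op).hom f)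
  exact this.symm

lemma res_smul (M : ModSheaf 𝒪) {U V : Opens X} (h : V ≤ U) (f : Fn 𝒪 U) (m : Sec M U) :
    res M h (f • m) = resFn (𝒪 := 𝒪) h f • res M h m := (res M h).map_smulₛₗ f m

/-- Two sections that agree locally are equal. -/
lemma sec_ext (M : ModSheaf 𝒪) {ι : Type*} {V : Opens X} (U : ι → Opens X) (hU : ∀ i, U i ≤ V)
    (hV : V ≤ iSup U) (s t : Sec M V) (h : ∀ i, res M (hU i) s = res M (hU i) t) : s = t :=
  TopCat.Sheaf.eq_of_locally_eq' (⟨M.val.presheaf, M.isSheaf⟩ : TopCat.Sheaf Ab X) U V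
    (fun i => homOfLE (hU i)) hV s t h

/-- Compatible local sections glue. -/
lemma sec_glue (M : ModSheaf 𝒪) {ι : Type*} {V : Opens X} (U : ι → Opens X) (hU : ∀ i, U i ≤ V)
    (hV : V ≤ iSup U) (s : ∀ i, Sec M (U i))
    (h : ∀ i j, res M (inf_le_left : U i ⊓ U j ≤ U i) (s i) =
      res M (inf_le_right : U i ⊓ U j ≤ U j) (s j)) :
    ∃ t : Sec M V, ∀ i, res M (hU i) t = s i :=
  let s' : ∀ i, ToType (M.val.presheaf.obj (op (U i))) := s
  (TopCat.Sheaf.existsUnique_gluing' (⟨M.val.presheaf, M.isSheaf⟩ : TopCat.Sheaf Ab X) U V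
    (fun i => homOfLE (hU i)) hV s' h).exists

/-- A presheaf of modules in which compatible local sections glue uniquely is a sheaf. -/
lemma isSheaf_of_glue (P : PresheafOfModules.{u} (ringSheaf 𝒪).obj)
    (h : ∀ ⦃ι : Type u⦄ (U : ι → Opens X) (s : ∀ i, P.obj (op (U i))),
      (∀ i j, P.map (homOfLE (inf_le_left : U i ⊓ U j ≤ U i)).op (s i) =
        P.map (homOfLE (inf_le_right : U i ⊓ U j ≤ U j)).op (s j)) →
      ∃! t : P.obj (op (iSup U)), ∀ i, P.map (homOfLE (le_iSup U i)).op t = s i) :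
    Presheaf.IsSheaf (Opens.grothendieckTopology X) P.presheaf :=
  (TopCat.Presheaf.isSheaf_iff_isSheafUniqueGluing (C := Ab.{u}) P.presheaf).2 h

section Hom
variable (M N : ModSheaf 𝒪)

/-- Homomorphisms `M|_U ⟶ N|_U` of sheaves of `𝒪|_U`-modules: families of `𝒪(V)`-linear maps
`M(V) → N(V)`, for `V ⊆ U` open, that are compatible with restriction. -/
def localHomSubgroup (U : Opens X) :
    AddSubgroup (∀ V : {V : Opens X // V ≤ U}, Sec M V.1 →ₗ[Fn 𝒪 V.1] Sec N V.1) where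
  carrier := {φ | ∀ (V W : {V : Opens X // V ≤ U}) (h : W.1 ≤ V.1) (m : Sec M V.1),
    φ W (res M h m) = res N h (φ V m)}
  add_mem' {a b} ha hb V W h m := by simp [ha V W h, hb V W h]
  zero_mem' V W h m := by simp
  neg_mem' {a} ha V W h m := by simp [ha V W h]

/-- The type of homomorphisms `M|_U ⟶ N|_U` of sheaves of `𝒪|_U`-modules. -/
def LocalHom (U : Opens X) : Type u := localHomSubgroup M N U

noncomputable instance (U : Opens X) : AddCommGroup (LocalHom M N U) :=
  inferInstanceAs (AddCommGroup (localHomSubgroup M N U))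

variable {M N}

/-- The value of a local homomorphism on a section over a smaller open set. -/
def LocalHom.ap {U : Opens X} (φ : LocalHom M N U) {V : Opens X} (h : V ≤ U) :
    Sec M V →ₗ[Fn 𝒪 V] Sec N V := φ.1 ⟨V, h⟩

lemma LocalHom.ap_res {U : Opens X} (φ : LocalHom M N U) {V W : Opens X} (hV : V ≤ U) (h : W ≤ V)
    (m : Sec M V) : φ.ap (h.trans hV) (res M h m) = res N h (φ.ap hV m) :=
  φ.2 ⟨V, hV⟩ ⟨W, h.trans hV⟩ h m

lemma LocalHom.ext' {U : Opens X} {φ ψ : LocalHom M N U}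
    (h : ∀ (V : Opens X) (hV : V ≤ U) (m : Sec M V), φ.ap hV m = ψ.ap hV m) : φ = ψ :=
  Subtype.ext (funext fun V => LinearMap.ext (h V.1 V.2))

/-- Constructor for local homomorphisms. -/
def LocalHom.mk' {U : Opens X} (φ : ∀ V : Opens X, V ≤ U → (Sec M V →ₗ[Fn 𝒪 V] Sec N V))
    (h : ∀ (V W : Opens X) (hV : V ≤ U) (h : W ≤ V) (m : Sec M V),
      φ W (h.trans hV) (res M h m) = res N h (φ V hV m)) : LocalHom M N U :=
  ⟨fun V => φ V.1 V.2, fun V W hh m => h V.1 W.1 V.2 hh m⟩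

noncomputable instance (U : Opens X) : Module (Fn 𝒪 U) (LocalHom M N U) where
  smul f φ := LocalHom.mk' (fun V hV => resFn (𝒪 := 𝒪) hV f • φ.ap hV) (fun V W hV h m => by
    simp only [LinearMap.smul_apply, res_smul, resFn_resFn, φ.ap_res hV h])
  one_smul φ := LocalHom.ext' fun V hV m => by
    change resFn (𝒪 := 𝒪) hV 1 • φ.ap hV m = _
    rw [map_one, one_smul]
  mul_smul f g φ := LocalHom.ext' fun V hV m => by
    change resFn (𝒪 := 𝒪) hV (f * g) • φ.ap hV m =
      resFn (𝒪 := 𝒪) hV f • resFn (𝒪 := 𝒪) hV g • φ.ap hV m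
    rw [map_mul, mul_smul]
  smul_zero f := LocalHom.ext' fun V hV m => smul_zero (A := Sec N V) (resFn (𝒪 := 𝒪) hV f)
  smul_add f φ ψ := LocalHom.ext' fun V hV m =>
    smul_add (A := Sec N V) (resFn (𝒪 := 𝒪) hV f) (φ.ap hV m) (ψ.ap hV m)
  add_smul f g φ := LocalHom.ext' fun V hV m => by
    change resFn (𝒪 := 𝒪) hV (f + g) • φ.ap hV m =
      resFn (𝒪 := 𝒪) hV f • φ.ap hV m + resFn (𝒪 := 𝒪) hV g • φ.ap hV m
    rw [map_add, add_smul]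
  zero_smul φ := LocalHom.ext' fun V hV m => by
    change resFn (𝒪 := 𝒪) hV 0 • φ.ap hV m = 0
    rw [map_zero, zero_smul]

/-- Restriction of local homomorphisms. -/
def LocalHom.restrict {U V : Opens X} (h : V ≤ U) : LocalHom M N U →+ LocalHom M N V where
  toFun φ := LocalHom.mk' (fun _ hW => φ.ap (hW.trans h))
    fun _ _ hV hW m => φ.ap_res (hV.trans h) hW m
  map_zero' := rfl
  map_add' _ _ := rfl

lemma LocalHom.glue {ι : Type*} (U : ι → Opens X) (s : ∀ i, LocalHom M N (U i))
    (hs : ∀ i j, LocalHom.restrict (inf_le_left : U i ⊓ U j ≤ U i) (s i) =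
      LocalHom.restrict (inf_le_right : U i ⊓ U j ≤ U j) (s j)) :
    ∃! t : LocalHom M N (iSup U), ∀ i, LocalHom.restrict (le_iSup U i) t = s i := by
  have hcov : ∀ V : Opens X, V ≤ iSup U → V ≤ ⨆ i, V ⊓ U i := fun V hV => by
    rw [← inf_iSup_eq]; exact le_inf le_rfl hV
  have hs' : ∀ (i j) (W : Opens X) (hi : W ≤ U i) (hj : W ≤ U j) (m : Sec M W),
      (s i).ap hi m = (s j).ap hj m :=
    fun i j W hi hj m => congr($(hs i j).ap (le_inf hi hj) m)
  have key : ∀ (V : Opens X), V ≤ iSup U → ∀ m : Sec M V,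
      ∃ t : Sec N V, ∀ i, res N (inf_le_left : V ⊓ U i ≤ V) t =
        (s i).ap inf_le_right (res M inf_le_left m) := fun V hV m => by
    refine sec_glue N (fun i => V ⊓ U i) (fun i => inf_le_left) (hcov V hV)
      (fun i => (s i).ap inf_le_right (res M inf_le_left m)) fun i j => ?_
    rw [← LocalHom.ap_res, ← LocalHom.ap_res, res_res, res_res]
    exact hs' i j _ _ _ _
  choose t ht using key
  refine ⟨LocalHom.mk' (fun V hV =>
    { toFun := t V hV
      map_add' := fun a b => sec_ext N _ (fun i => inf_le_left) (hcov V hV) _ _ fun i => by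
        simp [ht]
      map_smul' := fun a b => sec_ext N _ (fun i => inf_le_left) (hcov V hV) _ _ fun i => by
        simp [ht] }) ?_, ?_, ?_⟩
  · intro V W hV h m
    refine sec_ext N _ (fun i => inf_le_left) (hcov W (h.trans hV)) _ _ fun i => ?_
    change res N _ (t _ _ _) = res N _ (res N _ (t _ _ _))
    rw [ht, res_res, res_res,
      ← res_res N (inf_le_left : V ⊓ U i ≤ V) (inf_le_inf_right (U i) h) (t V hV m), ht,
      ← LocalHom.ap_res, res_res]
  · intro i
    refine LocalHom.ext' fun V hV m => ?_
    change t V _ m = _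
    refine sec_ext N _ (fun j => inf_le_left) (hcov V (hV.trans (le_iSup U i))) _ _ fun j => ?_
    rw [ht, ← LocalHom.ap_res]
    exact hs' _ _ _ _ _ _
  · intro t' ht'
    refine LocalHom.ext' fun V hV m => ?_
    change _ = t V _ m
    refine sec_ext N _ (fun j => inf_le_left) (hcov V hV) _ _ fun j => ?_
    rw [ht, ← LocalHom.ap_res _ hV inf_le_left, ← ht' j]
    rfl

lemma LocalHom.restrict_smul {U V : Opens X} (h : V ≤ U) (r : Fn 𝒪 U) (φ : LocalHom M N U) :
    LocalHom.restrict h (r • φ) = resFn (𝒪 := 𝒪) h r • LocalHom.restrict h φ :=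
  LocalHom.ext' fun W hW m => by
    change resFn (𝒪 := 𝒪) (hW.trans h) r • φ.ap (hW.trans h) m =
      resFn (𝒪 := 𝒪) hW (resFn (𝒪 := 𝒪) h r) • φ.ap (hW.trans h) m
    rw [resFn_resFn]

variable (M N) in
/-- The presheaf of local homomorphisms. -/
noncomputable def localHomPresheaf : (Opens X)ᵒᵖ ⥤ Ab.{u} where
  obj U := AddCommGrpCat.of (LocalHom M N U.unop)
  map f := AddCommGrpCat.ofHom (LocalHom.restrict f.unop.le)
  map_id _ := rfl
  map_comp _ _ := rfl

noncomputable instance (U : (Opens X)ᵒᵖ) :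
    Module ((ringSheaf 𝒪).obj.obj U) ((localHomPresheaf M N).obj U) :=
  inferInstanceAs (Module (Fn 𝒪 U.unop) (LocalHom M N U.unop))

variable (M N) in
/-- The sheaf `Hom(M, N)` of `𝒪`-module homomorphisms. -/
noncomputable def homSheaf : ModSheaf 𝒪 where
  val := PresheafOfModules.ofPresheaf (localHomPresheaf M N) (by
    intro U V f r φ
    exact LocalHom.restrict_smul f.unop.le r φ)
  isSheaf := isSheaf_of_glue _ fun _ U s hs => LocalHom.glue U s hs

end Hom

/-- The value `φ(m) ∈ N(V)` of `φ ∈ Hom(M, N)(U)` on a section `m ∈ M(V)`, for `V ⊆ U`. -/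
def homEval {M N : ModSheaf 𝒪} {U V : Opens X} (φ : Sec (homSheaf M N) U) (h : V ≤ U) :
    Sec M V →ₗ[Fn 𝒪 V] Sec N V := LocalHom.ap (φ : LocalHom M N U) h

/-- The morphism `f^* : Hom(N, P) ⟶ Hom(M, P)`, `φ ↦ φ ∘ f`. -/
noncomputable def precomp {M N : ModSheaf 𝒪} (f : M ⟶ N) (P : ModSheaf 𝒪) :
    homSheaf N P ⟶ homSheaf M P where
  val := PresheafOfModules.homMk
    { app := fun U => AddCommGrpCat.ofHom (Y := LocalHom M P U.unop)
        { toFun := fun φ : LocalHom N P U.unop => LocalHom.mk' (fun V hV => φ.ap hV ∘ₗ onSec f V)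
            (fun V W hV h m => by simp [onSec_res, ← φ.ap_res hV h])
          map_zero' := rfl
          map_add' := fun _ _ => rfl } }
    (fun U r φ => rfl)

/-- The dual `Hom(M, 𝒪)`; for an invertible sheaf this is its inverse. -/
noncomputable def dual (M : ModSheaf 𝒪) : ModSheaf 𝒪 := homSheaf M (SheafOfModules.unit _)

/-- The function `φ(m) ∈ 𝒪(V)` defined by `φ ∈ Hom(M, 𝒪)(U)` and `m ∈ M(V)`, for `V ⊆ U`. -/
noncomputable def pairing {M : ModSheaf 𝒪} {U V : Opens X} (φ : Sec (dual M) U) (h : V ≤ U)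
    (m : Sec M V) : Fn 𝒪 V :=
  homEval (N := SheafOfModules.unit _) φ h m

/-- The subsheaf of modules of `M` defined by submodules of the `M(U)` that are stable under
restriction, membership in which can be checked locally. -/
noncomputable def subsheaf (M : ModSheaf 𝒪) (N : M.val.Submodule)
    (hN : ∀ (U : Opens X) (s : Sec M U), (∀ x ∈ U, ∃ (V : Opens X) (h : V ≤ U), x ∈ V ∧
      res M h s ∈ N.obj (op V)) → s ∈ N.obj (op U)) : ModSheaf 𝒪 where
  val := N.toPresheafOfModules
  isSheaf := isSheaf_of_glue _ (by
    intro ι U s hs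
    have hs' : ∀ i j, res M (inf_le_left : U i ⊓ U j ≤ U i) (s i).1 =
        res M (inf_le_right : U i ⊓ U j ≤ U j) (s j).1 := fun i j => congr_arg Subtype.val (hs i j)
    obtain ⟨t, ht⟩ := sec_glue M U (le_iSup U) le_rfl (fun i => (s i).1) hs'
    refine ⟨⟨t, hN _ t fun x hx => ?_⟩, fun i => Subtype.ext (ht i), fun t' ht' => Subtype.ext ?_⟩
    · obtain ⟨i, hi⟩ := Opens.mem_iSup.1 hx
      refine ⟨U i, le_iSup U i, hi, ?_⟩
      rw [ht]
      exact (s i).2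
    · refine sec_ext M U (le_iSup U) le_rfl _ _ fun i => ?_
      rw [ht]
      exact congr_arg Subtype.val (ht' i))

section Ideal
variable (I : ∀ U : Opens X, Ideal (Fn 𝒪 U))
  (hI : ∀ (U V : Opens X) (h : V ≤ U), I U ≤ (I V).comap (resFn (𝒪 := 𝒪) h))

/-- The functions on `U` that belong locally to the given ideals. -/
def localIdeal (U : Opens X) : Ideal (Fn 𝒪 U) where
  carrier := {f | ∀ x ∈ U, ∃ (V : Opens X) (h : V ≤ U), x ∈ V ∧ resFn (𝒪 := 𝒪) h f ∈ I V}
  add_mem' := by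
    intro a b ha hb x hx
    obtain ⟨V, hV, hxV, hVa⟩ := ha x hx
    obtain ⟨W, hW, hxW, hWb⟩ := hb x hx
    refine ⟨V ⊓ W, inf_le_left.trans hV, ⟨hxV, hxW⟩, ?_⟩
    have h1 := hI _ _ (inf_le_left : V ⊓ W ≤ V) hVa
    have h2 := hI _ _ (inf_le_right : V ⊓ W ≤ W) hWb
    rw [Ideal.mem_comap, resFn_resFn] at h1 h2
    rw [map_add]
    exact add_mem h1 h2
  zero_mem' := fun x hx => ⟨U, le_rfl, hx, by rw [map_zero]; exact zero_mem _⟩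
  smul_mem' := by
    intro r f hf x hx
    obtain ⟨V, hV, hxV, h⟩ := hf x hx
    refine ⟨V, hV, hxV, ?_⟩
    rw [smul_eq_mul, map_mul]
    exact (I V).mul_mem_left _ h

lemma localIdeal_res {U V : Opens X} (hVU : V ≤ U) (f : Fn 𝒪 U) (hf : f ∈ localIdeal I hI U) :
    resFn (𝒪 := 𝒪) hVU f ∈ localIdeal I hI V := by
  intro x hx
  obtain ⟨W, hW, hxW, h⟩ := hf x (hVU hx)
  refine ⟨W ⊓ V, inf_le_right, ⟨hxW, hx⟩, ?_⟩
  have h1 := hI _ _ (inf_le_left : W ⊓ V ≤ W) h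
  rw [Ideal.mem_comap, resFn_resFn] at h1
  rw [resFn_resFn]
  exact h1

lemma localIdeal_local (U : Opens X) (f : Fn 𝒪 U) (hf : ∀ x ∈ U, ∃ (V : Opens X) (h : V ≤ U),
    x ∈ V ∧ resFn (𝒪 := 𝒪) h f ∈ localIdeal I hI V) : f ∈ localIdeal I hI U := by
  intro x hx
  obtain ⟨V, hV, hxV, h⟩ := hf x hx
  obtain ⟨W, hW, hxW, h'⟩ := h x hxV
  refine ⟨W, hW.trans hV, hxW, ?_⟩
  rw [resFn_resFn] at h'
  exact h'

/-- The ideal sheaf generated by a presheaf of ideals (its sheafification inside `𝒪`), as a sheaf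
of modules. -/
noncomputable def idealSheaf : ModSheaf 𝒪 :=
  subsheaf (SheafOfModules.unit _)
    { obj := fun U => localIdeal I hI U.unop
      map := fun g f hf => localIdeal_res I hI g.unop.le f hf }
    (localIdeal_local I hI)

variable {I hI} in
/-- A section of an ideal sheaf, as a function. -/
noncomputable def toFn {U : Opens X} (f : Sec (idealSheaf I hI) U) : Fn 𝒪 U := f.1

end Ideal

/-- `M` is locally free of rank `n`: every point has an open neighbourhood `U` with sections
`e₁, …, eₙ ∈ M(U)` that form a basis of `M(V)` over `𝒪(V)` for every open `V ⊆ U`, that is, they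
define an isomorphism `𝒪ⁿ|_U ≅ M|_U`. -/
def IsLocallyFreeOfRank (M : ModSheaf 𝒪) (n : ℕ) : Prop :=
  ∀ x : X, ∃ U : Opens X, x ∈ U ∧ ∃ e : Fin n → Sec M U, ∀ (V : Opens X) (h : V ≤ U),
    Function.Bijective (fun c : Fin n → Fn 𝒪 V => ∑ j, c j • res M h (e j))

end SheafMod

namespace CplxSurface
open SheafMod

/-- The model space `ℂ²` of complex surfaces. -/
abbrev C2 := EuclideanSpace ℂ (Fin 2)

section Functions
variable (S : Type u) [TopologicalSpace S] [ChartedSpace C2 S]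

/-- The presheaf of holomorphic functions: its sections over `U` are the functions `U → ℂ` that
are smooth over `ℂ`. -/
noncomputable def holPresheaf : (Opens (TopCat.of S))ᵒᵖ ⥤ CommRingCat.{u} where
  obj U := CommRingCat.of C^∞⟮𝓘(ℂ, C2), (U.unop : Opens S); 𝓘(ℂ), ℂ⟯
  map f := CommRingCat.ofHom (ContMDiffMap.restrictRingHom 𝓘(ℂ, C2) 𝓘(ℂ) ℂ f.unop.le)
  map_id _ := rfl
  map_comp _ _ := rfl

variable {S} in
lemma hol_glue {ι : Type*} (U : ι → Opens S)
    (s : ∀ i, C^∞⟮𝓘(ℂ, C2), U i; 𝓘(ℂ), ℂ⟯)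
    (hs : ∀ i j (x : S) (hi : x ∈ U i) (hj : x ∈ U j), s i ⟨x, hi⟩ = s j ⟨x, hj⟩) :
    ∃ t : C^∞⟮𝓘(ℂ, C2), (iSup U : Opens S); 𝓘(ℂ), ℂ⟯,
      ∀ i (x : U i), t ⟨x.1, le_iSup U i x.2⟩ = s i x := by
  choose k hk using fun x : (iSup U : Opens S) => Opens.mem_iSup.1 x.2
  refine ⟨⟨fun x => s (k x) ⟨x.1, hk x⟩, fun x₀ => ?_⟩, fun i x => hs _ _ _ _ _⟩
  refine ((contDiffWithinAt_localInvariantProp (I := 𝓘(ℂ, C2)) (I' := 𝓘(ℂ))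
    ∞).liftPropAt_iff_comp_inclusion (le_iSup U (k x₀))
    (fun x => s (k x) ⟨x.1, hk x⟩) ⟨x₀.1, hk x₀⟩).2 ?_
  have h : (fun x : (iSup U : Opens S) => s (k x) ⟨x.1, hk x⟩) ∘
      Set.inclusion (le_iSup U (k x₀)) = s (k x₀) := funext fun x => hs _ _ _ _ _
  rw [h]
  exact (s (k x₀)).2 _

/-- The structure sheaf of holomorphic functions. -/
noncomputable def holSheaf : Sheaf (Opens.grothendieckTopology (TopCat.of S)) CommRingCat.{u} where
  obj := holPresheaf S
  property := (TopCat.Presheaf.isSheaf_iff_isSheafUniqueGluing (holPresheaf S)).2 (by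
    intro ι U s hs
    obtain ⟨t, ht⟩ := hol_glue (S := S) U s
      (fun i j x hi hj => congr($(hs i j).1 ⟨x, hi, hj⟩))
    refine ⟨t, fun i => Subtype.ext (funext fun x => ht i x), fun t' ht' =>
      Subtype.ext (funext fun x => ?_)⟩
    obtain ⟨i, hi⟩ := Opens.mem_iSup.1 x.2
    exact congr($(ht' i).1 ⟨x.1, hi⟩).trans (ht i ⟨x.1, hi⟩).symm)

variable {S}

/-- The ideal of the holomorphic functions on `U` that vanish at every point of `Z ∩ U`. -/
def vanishingIdeal (Z : Set S) (U : Opens S) : Ideal (Fn (X := TopCat.of S) (holSheaf S) U) where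
  carrier := {f | ∀ x : U, (x : S) ∈ Z → f.1 x = 0}
  add_mem' {f g} hf hg x hx := by
    change f.1 x + g.1 x = 0
    rw [hf x hx, hg x hx, add_zero]
  zero_mem' _ _ := rfl
  smul_mem' f g hg x hx := by
    change f.1 x * g.1 x = 0
    rw [hg x hx, mul_zero]

lemma vanishingIdeal_res (Z : Set S) (n : ℕ) (U V : Opens (TopCat.of S)) (h : V ≤ U) :
    vanishingIdeal Z U ^ n ≤ (vanishingIdeal Z V ^ n).comap (resFn (𝒪 := holSheaf S) h) := by
  rw [← Ideal.map_le_iff_le_comap, Ideal.map_pow]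
  refine Ideal.pow_right_mono (Ideal.map_le_iff_le_comap.2 ?_) n
  exact fun f hf x hx => hf ⟨x.1, h x.2⟩ hx

/-- The power `I_Z ^ n` of the ideal sheaf `I_Z` of the holomorphic functions vanishing on `Z`:
the ideal sheaf generated by the presheaf `U ↦ I_Z(U) ^ n`. -/
noncomputable def idealPow (Z : Set S) (n : ℕ) : ModSheaf (X := TopCat.of S) (holSheaf S) :=
  idealSheaf (fun U => vanishingIdeal Z U ^ n) (vanishingIdeal_res Z n)

/-- Sections of `I_Z = I_Z ^ 1` are exactly the holomorphic functions that vanish on `Z`. -/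
lemma mem_localIdeal_one_iff (Z : Set S) (U : Opens S)
    (f : Fn (X := TopCat.of S) (holSheaf S) U) :
    f ∈ localIdeal (fun U => vanishingIdeal Z U ^ 1) (vanishingIdeal_res Z 1) U ↔
      ∀ x : U, (x : S) ∈ Z → f.1 x = 0 := by
  refine ⟨fun h x hx => ?_, fun h x hx => ⟨U, le_rfl, hx, ?_⟩⟩
  · obtain ⟨V, hV, hxV, hf⟩ := h x.1 x.2
    replace hf : resFn (𝒪 := holSheaf S) hV f ∈ vanishingIdeal Z V ^ 1 := hf
    rw [pow_one] at hf
    exact hf ⟨x.1, hxV⟩ hx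
  · change resFn (𝒪 := holSheaf S) (le_refl U) f ∈ vanishingIdeal Z U ^ 1
    rw [pow_one]
    exact h

end Functions

section Forms
variable (S : Type u) [TopologicalSpace S] [ChartedSpace C2 S] [IsManifold 𝓘(ℂ, C2) ω S]

/-- The space `Λ² T_x^* S` of alternating 2-forms on the holomorphic tangent space at `x`. -/
abbrev Form2 (x : S) : Type := TangentSpace 𝓘(ℂ, C2) x [⋀^Fin 2]→L[ℂ] Bundle.Trivial S ℂ x

/-- A 2-form on `U` is holomorphic if it is a holomorphic section of the bundle `Λ² T^* S`. -/
def IsHolForm (U : Opens S) (α : ∀ x : U, Form2 S x) : Prop :=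
  ContMDiff 𝓘(ℂ, C2) (𝓘(ℂ, C2).prod 𝓘(ℂ, C2 [⋀^Fin 2]→L[ℂ] ℂ)) ∞
    (fun x : U => Bundle.TotalSpace.mk' (E := Form2 S) (C2 [⋀^Fin 2]→L[ℂ] ℂ) (x : S) (α x))

variable {S}

lemma isHolForm_iff (U : Opens S) (α : ∀ x : U, Form2 S x) : IsHolForm S U α ↔
    ∀ x₀ : U, ContMDiffAt 𝓘(ℂ, C2) 𝓘(ℂ, C2 [⋀^Fin 2]→L[ℂ] ℂ) ∞ (fun x : U =>
      (trivializationAt (C2 [⋀^Fin 2]→L[ℂ] ℂ) (Form2 S) (x₀ : S)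
        ⟨(x : S), α x⟩).2) x₀ := by
  refine forall_congr' fun x₀ => ?_
  rw [Bundle.contMDiffAt_totalSpace, and_iff_right]
  exact contMDiff_subtype_val x₀

lemma triv_add (x₀ x : S) (α β : Form2 S x) :
    (trivializationAt (C2 [⋀^Fin 2]→L[ℂ] ℂ) (Form2 S) x₀ ⟨x, α + β⟩).2 =
    (trivializationAt (C2 [⋀^Fin 2]→L[ℂ] ℂ) (Form2 S) x₀ ⟨x, α⟩).2 +
    (trivializationAt (C2 [⋀^Fin 2]→L[ℂ] ℂ) (Form2 S) x₀ ⟨x, β⟩).2 := by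
  ext v
  simp [FiberBundle.trivializationAt_continuousAlternatingMap_apply,
    ContinuousAlternatingMap.inCoordinates]

lemma triv_smul (x₀ x : S) (c : ℂ) (α : Form2 S x) :
    (trivializationAt (C2 [⋀^Fin 2]→L[ℂ] ℂ) (Form2 S) x₀ ⟨x, c • α⟩).2 =
    c • (trivializationAt (C2 [⋀^Fin 2]→L[ℂ] ℂ) (Form2 S) x₀ ⟨x, α⟩).2 := by
  ext v
  simp [FiberBundle.trivializationAt_continuousAlternatingMap_apply,
    ContinuousAlternatingMap.inCoordinates]

lemma IsHolForm.add {U : Opens S} {α β : ∀ x : U, Form2 S x} (hα : IsHolForm S U α)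
    (hβ : IsHolForm S U β) : IsHolForm S U (α + β) := by
  rw [isHolForm_iff] at *
  intro x₀
  simp only [Pi.add_apply, triv_add]
  exact (hα x₀).add (hβ x₀)

lemma IsHolForm.smul {U : Opens S} {α : ∀ x : U, Form2 S x} {f : U → ℂ}
    (hf : ContMDiff 𝓘(ℂ, C2) 𝓘(ℂ) ∞ f) (hα : IsHolForm S U α) :
    IsHolForm S U (fun x => f x • α x) := by
  rw [isHolForm_iff] at *
  intro x₀
  simp only [triv_smul]
  exact (hf x₀).smul (hα x₀)

lemma IsHolForm.res {U V : Opens S} (h : V ≤ U) {α : ∀ x : U, Form2 S x} (hα : IsHolForm S U α) :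
    IsHolForm S V (fun x => α ⟨x.1, h x.2⟩) :=
  ContMDiff.comp (g := fun x : U => Bundle.TotalSpace.mk' (E := Form2 S)
    (C2 [⋀^Fin 2]→L[ℂ] ℂ) (x : S) (α x)) hα (contMDiff_inclusion h)

lemma IsHolForm.of_locally {U : Opens S} {α : ∀ x : U, Form2 S x} (hα : ∀ x ∈ U, ∃ (V : Opens S)
    (h : V ≤ U), x ∈ V ∧ IsHolForm S V (fun x => α ⟨x.1, h x.2⟩)) : IsHolForm S U α := by
  intro x₀
  obtain ⟨V, hV, hx, h⟩ := hα x₀.1 x₀.2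
  exact ((contDiffWithinAt_localInvariantProp (I := 𝓘(ℂ, C2))
    (I' := 𝓘(ℂ, C2).prod 𝓘(ℂ, C2 [⋀^Fin 2]→L[ℂ] ℂ)) ∞).liftPropAt_iff_comp_inclusion hV
    (fun x : U => Bundle.TotalSpace.mk' (E := Form2 S) (C2 [⋀^Fin 2]→L[ℂ] ℂ) (x : S) (α x))
    ⟨x₀.1, hx⟩).2 (h ⟨x₀.1, hx⟩)

variable (S)

/-- The group of holomorphic 2-forms on `U`. -/
def holForms (U : Opens S) : AddSubgroup (∀ x : U, Form2 S x) where
  carrier := {α | IsHolForm S U α}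
  add_mem' := IsHolForm.add
  zero_mem' := by
    change IsHolForm S U 0
    rw [isHolForm_iff]
    intro x₀
    have h : ∀ x : U, (trivializationAt (C2 [⋀^Fin 2]→L[ℂ] ℂ) (Form2 S) (x₀ : S)
        ⟨(x : S), (0 : ∀ x : U, Form2 S x) x⟩).2 = 0 := fun x => by
      ext v
      simp [FiberBundle.trivializationAt_continuousAlternatingMap_apply,
        ContinuousAlternatingMap.inCoordinates]
    simp only [h]
    exact contMDiffAt_const
  neg_mem' := by
    intro α hα
    have h : (fun x => (-1 : ℂ) • α x) = -α := funext fun x => by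
      ext v
      exact neg_one_mul (α x v)
    exact h ▸ IsHolForm.smul (f := fun _ => -1) contMDiff_const hα

noncomputable instance (U : Opens S) :
    Module (Fn (X := TopCat.of S) (holSheaf S) U) (holForms S U) where
  smul f α := ⟨fun x => f.1 x • α.1 x, IsHolForm.smul f.2 α.2⟩
  one_smul α := Subtype.ext (funext fun x => one_smul ℂ (α.1 x))
  mul_smul f g α := Subtype.ext (funext fun x => mul_smul (f.1 x) (g.1 x) (α.1 x))
  smul_zero f := Subtype.ext (funext fun x => by
    ext v
    exact mul_zero (f.1 x))
  smul_add f α β := Subtype.ext (funext fun x => smul_add (f.1 x) (α.1 x) (β.1 x))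
  add_smul f g α := Subtype.ext (funext fun x => add_smul (f.1 x) (g.1 x) (α.1 x))
  zero_smul α := Subtype.ext (funext fun x => zero_smul ℂ (α.1 x))

/-- Restriction of holomorphic 2-forms. -/
def holFormsRes {U V : Opens S} (h : V ≤ U) : holForms S U →+ holForms S V where
  toFun α := ⟨fun x => α.1 ⟨x.1, h x.2⟩, α.2.res h⟩
  map_zero' := rfl
  map_add' _ _ := rfl

lemma holFormsRes_smul {U V : Opens S} (h : V ≤ U) (f : Fn (X := TopCat.of S) (holSheaf S) U)
    (α : holForms S U) : holFormsRes S h (f • α) =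
      resFn (X := TopCat.of S) (𝒪 := holSheaf S) h f • holFormsRes S h α := rfl

/-- The presheaf of holomorphic 2-forms. -/
noncomputable def holFormsPresheaf : (Opens (TopCat.of S))ᵒᵖ ⥤ Ab.{u} where
  obj U := AddCommGrpCat.of (holForms S U.unop)
  map f := AddCommGrpCat.ofHom (holFormsRes S f.unop.le)
  map_id _ := rfl
  map_comp _ _ := rfl

noncomputable instance (U : (Opens (TopCat.of S))ᵒᵖ) :
    Module ((ringSheaf (holSheaf S)).obj.obj U) ((holFormsPresheaf S).obj U) :=
  inferInstanceAs (Module (Fn (X := TopCat.of S) (holSheaf S) U.unop) (holForms S U.unop))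

lemma holForms_glue {ι : Type*} (U : ι → Opens S) (s : ∀ i, holForms S (U i))
    (hs : ∀ i j, holFormsRes S (inf_le_left : U i ⊓ U j ≤ U i) (s i) =
      holFormsRes S (inf_le_right : U i ⊓ U j ≤ U j) (s j)) :
    ∃! t : holForms S (iSup U), ∀ i, holFormsRes S (le_iSup U i) t = s i := by
  have hs' : ∀ i j (x : S) (hi : x ∈ U i) (hj : x ∈ U j), (s i).1 ⟨x, hi⟩ = (s j).1 ⟨x, hj⟩ :=
    fun i j x hi hj => congr($(congr_arg Subtype.val (hs i j)) ⟨x, hi, hj⟩)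
  choose k hk using fun x : (iSup U : Opens S) => Opens.mem_iSup.1 x.2
  have hres : ∀ i (x : S) (hx : x ∈ U i) (hx' : x ∈ iSup U),
      (s (k ⟨x, hx'⟩)).1 ⟨x, hk ⟨x, hx'⟩⟩ = (s i).1 ⟨x, hx⟩ := fun i x hx hx' => hs' _ _ _ _ _
  refine ⟨⟨fun x => (s (k x)).1 ⟨x.1, hk x⟩, IsHolForm.of_locally fun x hx => ?_⟩, fun i =>
    Subtype.ext (funext fun x => hres i _ _ _), fun t ht => Subtype.ext (funext fun x => ?_)⟩
  · obtain ⟨i, hi⟩ := Opens.mem_iSup.1 hx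
    refine ⟨U i, le_iSup U i, hi, ?_⟩
    convert! (s i).2 using 1
    funext x
    exact hres i _ _ _
  · change _ = (s (k x)).1 ⟨x.1, hk x⟩
    rw [← ht (k x)]
    rfl

/-- The canonical sheaf `K_S` of holomorphic 2-forms on the complex surface `S`. -/
noncomputable def canonicalSheaf : ModSheaf (X := TopCat.of S) (holSheaf S) where
  val := PresheafOfModules.ofPresheaf (holFormsPresheaf S)
    (fun _ _ f r α => holFormsRes_smul S f.unop.le r α)
  isSheaf := isSheaf_of_glue _ fun _ U s hs => holForms_glue S U s hs

end Forms

end CplxSurface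

open SheafMod CplxSurface

/-!
Applying `Hom(-, N)` to the given sequence, with `N = L₁ ⊗ K_S` or `N = L₂ ⊗ K_S ⊗ I_Z`, gives a
left exact sequence, and the assertion is that `α : A ⟶ Hom(L₂ ⊗ I_Z, N)` is an isomorphism, that
`β : B ⟶ Hom(L₁, N)` is injective, and that the image of `i^*` is the image of `β`. All of this is
local. `shortExact_homSheaf` proves it for a sheaf of rings `𝒪` on a space, from local coordinates
(`LocalCoords`) in which `L₁` and `A` are `𝒪`, `E` is `𝒪²`, the sheaves `L₂ ⊗ I_Z`, `N` and `B` are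
ideals `I`, `J` and `K`, and `α` and `β` are multiplication; here `(J, K)` is `(𝒪, I)` or `(I, I²)`.

The input from geometry is that `I_Z` is locally generated by a pair `(x, y)` whose Koszul complex
is exact (`IsRegularPair`, `exists_isRegularPair`): away from `Z` this is the pair `(1, 0)`, and at
a point of `Z` it is a pair of centred coordinates, by Hadamard's lemma with holomorphic dependence
on parameters (`exists_hadamard`). Regularity passes to every other pair of generators
(`IsRegularPair.of_generatedBy`), in particular to the images `(s, t)` in `I` of a frame `e₀, e₁` of
`E`. So the kernel `L₁` of `E ⟶ I` is spanned by `t e₀ - s e₁`. A homomorphism `I ⟶ J` sends `s, t`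
to `a, b` with `a t = b s`, hence it is the multiplication by a function, which is the claim about
`α`. A homomorphism `E ⟶ J` is a pair `(a, b)` of sections of `J`, and restricts on `L₁` to
`t a - s b`. As `s, t` generate `I`, the image of `i^*` is `I J = K`, which is the claim about `β`.

The sheaf `K_S` is invertible since a change of trivialization of `Λ² T^* S` is the multiplication
by a determinant (`formTriv_change`). The sheaf tensor product is handled by its universal property
(`exists_tensorLift`), which gives the maps `α` and `β`, and by the coordinates on `L ⊗ N` defined
by a frame of `L` and coordinates on `N` (`Coord.exists_tensor`).
-/

namespace SheafMod
variable {X : TopCat.{u}} {𝒪 : Sheaf (Opens.grothendieckTopology X) CommRingCat.{u}}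

/-! ### Morphisms of sheaves of modules on sections -/

lemma hom_ext_onSec {M N : ModSheaf 𝒪} {f g : M ⟶ N}
    (h : ∀ (U : Opens X) (m : Sec M U), onSec f U m = onSec g U m) : f = g := by
  ext U m
  exact h U.unop m

lemma onSec_comp {M N P : ModSheaf 𝒪} (f : M ⟶ N) (g : N ⟶ P) (U : Opens X) (m : Sec M U) :
    onSec (f ≫ g) U m = onSec g U (onSec f U m) := rfl

lemma onSec_id {M : ModSheaf 𝒪} (U : Opens X) (m : Sec M U) : onSec (𝟙 M) U m = m := rfl

lemma onSec_zero {M N : ModSheaf 𝒪} (U : Opens X) (m : Sec M U) :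
    onSec (0 : M ⟶ N) U m = 0 := rfl

/-- The morphism of sheaves of modules given by linear maps on sections that commute with
restriction. -/
noncomputable def homOfSec {M N : ModSheaf 𝒪} (φ : ∀ U : Opens X, Sec M U →ₗ[Fn 𝒪 U] Sec N U)
    (h : ∀ (U V : Opens X) (h : V ≤ U) (m : Sec M U), φ V (res M h m) = res N h (φ U m)) :
    M ⟶ N where
  val := PresheafOfModules.homMk
    { app := fun U => AddCommGrpCat.ofHom (φ U.unop).toAddMonoidHom
      naturality := fun U V f => by
        ext m
        exact h U.unop V.unop f.unop.le m }
    (fun U r m => (φ U.unop).map_smul r m)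

lemma res_self (M : ModSheaf 𝒪) {U : Opens X} (m : Sec M U) : res M (le_refl U) m = m :=
  congr($(M.val.presheaf.map_id (op U)) m)

lemma resFn_self {U : Opens X} (f : Fn 𝒪 U) : resFn (𝒪 := 𝒪) (le_refl U) f = f :=
  congr($(𝒪.obj.map_id (op U)) f)

/-- Two sections that agree near every point are equal. -/
lemma sec_ext_of_forall_mem (M : ModSheaf 𝒪) {U : Opens X} (s t : Sec M U)
    (h : ∀ x ∈ U, ∃ (V : Opens X) (hV : V ≤ U), x ∈ V ∧ res M hV s = res M hV t) : s = t := by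
  choose V hV hx h using fun x : U => h x.1 x.2
  exact sec_ext M V hV (fun x hxU => Opens.mem_iSup.2 ⟨⟨x, hxU⟩, hx _⟩) s t h

lemma mono_of_onSec_injective {M N : ModSheaf 𝒪} (f : M ⟶ N)
    (h : ∀ U, Function.Injective (onSec f U)) : Mono f where
  right_cancellation g₁ g₂ hg := hom_ext_onSec fun U m => h U <| by
    rw [← onSec_comp, ← onSec_comp, hg]

/-- A morphism is locally surjective if each section of the target lifts near each point. -/
def IsLocSurj {M N : ModSheaf 𝒪} (f : M ⟶ N) : Prop :=
  ∀ (U : Opens X) (s : Sec N U), ∀ x ∈ U, ∃ (V : Opens X) (hV : V ≤ U), x ∈ V ∧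
    ∃ m : Sec M V, onSec f V m = res N hV s

lemma IsLocSurj.epi {M N : ModSheaf 𝒪} {f : M ⟶ N} (hf : IsLocSurj f) : Epi f where
  left_cancellation g₁ g₂ hg := hom_ext_onSec fun U s =>
    sec_ext_of_forall_mem _ _ _ fun x hx => by
      obtain ⟨V, hV, hxV, m, hm⟩ := hf U s x hx
      refine ⟨V, hV, hxV, ?_⟩
      rw [← onSec_res, ← onSec_res, ← hm, ← onSec_comp, ← onSec_comp, hg]

/-- A morphism `h` factors through a morphism `β` that is injective on sections as soon as it does
so locally. -/
lemma exists_lift {A B C : ModSheaf 𝒪} (β : A ⟶ C) (hβ : ∀ U, Function.Injective (onSec β U))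
    (h : B ⟶ C) (hl : ∀ (U : Opens X) (s : Sec B U), ∀ x ∈ U, ∃ (V : Opens X) (hV : V ≤ U), x ∈ V ∧
      ∃ a : Sec A V, onSec β V a = res C hV (onSec h U s)) :
    ∃ g : B ⟶ A, g ≫ β = h := by
  have key : ∀ (U : Opens X) (s : Sec B U), ∃ a : Sec A U, onSec β U a = onSec h U s := by
    intro U s
    choose V hV hx a ha using fun x : U => hl U s x.1 x.2
    have hcov : U ≤ iSup V := fun x hxU => Opens.mem_iSup.2 ⟨⟨x, hxU⟩, hx _⟩
    obtain ⟨t, ht⟩ := sec_glue A V hV hcov a fun i j => hβ _ <| by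
      rw [onSec_res, onSec_res, ha, ha, res_res, res_res]
    refine ⟨t, sec_ext C V hV hcov _ _ fun i => ?_⟩
    rw [← onSec_res, ht, ha]
  choose g hg using key
  refine ⟨homOfSec (fun U =>
    { toFun := g U
      map_add' := fun s t => hβ U (by simp [hg])
      map_smul' := fun r s => hβ U (by simp [hg]) }) (fun U V hV s => hβ V ?_), ?_⟩
  · change onSec β V (g V _) = onSec β V (res A hV (g U s))
    rw [hg, onSec_res, onSec_res, hg]
  · exact hom_ext_onSec fun U s => hg U s

lemma isIso_of_bijective_locally {M N : ModSheaf 𝒪} (f : M ⟶ N)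
    (hf : ∀ U, Function.Injective (onSec f U)) (hs : IsLocSurj f) : IsIso f := by
  obtain ⟨g, hg⟩ := exists_lift f hf (𝟙 N) (fun U s x hx => hs U s x hx)
  have := mono_of_onSec_injective f hf
  exact ⟨g, by rw [← cancel_mono f, Category.assoc, hg]; simp, hg⟩

/-- The inclusion of a subsheaf. -/
noncomputable def subsheafι (M : ModSheaf 𝒪) (N : M.val.Submodule)
    (hN : ∀ (U : Opens X) (s : Sec M U), (∀ x ∈ U, ∃ (V : Opens X) (h : V ≤ U), x ∈ V ∧
      res M h s ∈ N.obj (op V)) → s ∈ N.obj (op U)) : subsheaf M N hN ⟶ M where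
  val := N.ι

/-- An epimorphism is locally surjective: the inclusion of the subsheaf of sections that lift
locally is both a monomorphism and an epimorphism, hence an isomorphism. -/
lemma isLocSurj_of_epi {M N : ModSheaf 𝒪} (f : M ⟶ N) [Epi f] : IsLocSurj f := by
  let P : N.val.Submodule :=
    { obj := fun U =>
        { carrier := {s : Sec N U.unop | ∀ x ∈ U.unop, ∃ (V : Opens X) (hV : V ≤ U.unop), x ∈ V ∧
            ∃ m : Sec M V, onSec f V m = res N hV s}
          add_mem' := by
            intro a b ha hb x hx
            obtain ⟨V, hV, hxV, m, hm⟩ := ha x hx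
            obtain ⟨W, hW, hxW, n, hn⟩ := hb x hx
            refine ⟨V ⊓ W, inf_le_left.trans hV, ⟨hxV, hxW⟩,
              res M inf_le_left m + res M inf_le_right n, ?_⟩
            rw [map_add, onSec_res, onSec_res, hm, hn, res_res, res_res]
            exact (map_add (res N _) a b).symm
          zero_mem' := fun x hx => ⟨U.unop, le_rfl, hx, 0, by
            rw [map_zero]; exact (map_zero (res N _)).symm⟩
          smul_mem' := by
            intro r a ha x hx
            obtain ⟨V, hV, hxV, m, hm⟩ := ha x hx
            refine ⟨V, hV, hxV, resFn (𝒪 := 𝒪) hV r • m, ?_⟩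
            rw [map_smul, hm]
            exact (res_smul N hV r a).symm }
      map := by
        intro U V g s hs x hx
        obtain ⟨W, hW, hxW, m, hm⟩ := hs x (g.unop.le hx)
        refine ⟨W ⊓ V.unop, inf_le_right, ⟨hxW, hx⟩, res M inf_le_left m, ?_⟩
        rw [onSec_res, hm, res_res]
        exact (res_res N g.unop.le inf_le_right s).symm }
  have hP : ∀ (U : Opens X) (s : Sec N U), (∀ x ∈ U, ∃ (V : Opens X) (h : V ≤ U), x ∈ V ∧
      res N h s ∈ P.obj (op V)) → s ∈ P.obj (op U) := by
    intro U s h x hx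
    obtain ⟨V, hV, hxV, h⟩ := h x hx
    obtain ⟨W, hW, hxW, m, hm⟩ := h x hxV
    exact ⟨W, hW.trans hV, hxW, m, by rw [hm, res_res]⟩
  have h₁ : Mono (subsheafι N P hP) :=
    mono_of_onSec_injective _ fun U s t h => Subtype.ext h
  obtain ⟨g, hg⟩ := exists_lift (subsheafι N P hP) (fun U s t h => Subtype.ext h) f
    (fun U s x hx => ⟨U, le_rfl, hx, ⟨onSec f U s, fun x hx =>
      ⟨U, le_rfl, hx, s, (res_self N _).symm⟩⟩, (res_self N _).symm⟩)
  have h₂ : Epi (subsheafι N P hP) := by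
    have : Epi (g ≫ subsheafι N P hP) := hg ▸ inferInstance
    exact epi_of_epi g _
  have : IsIso (subsheafι N P hP) := isIso_of_mono_of_epi _
  intro U s
  have hs : onSec (subsheafι N P hP) U (onSec (inv (subsheafι N P hP)) U s) = s := by
    rw [← onSec_comp, IsIso.inv_hom_id, onSec_id]
  rw [← hs]
  exact (onSec (inv (subsheafι N P hP)) U s).2

/-- In a left exact sequence, a section killed by the second map comes from the first term. -/
lemma exists_onSec_eq_of_exact {S : ShortComplex (ModSheaf 𝒪)} (hS : S.Exact) [Mono S.f]
    {U : Opens X} (s : Sec S.X₂ U) (hs : onSec S.g U s = 0) :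
    ∃ t : Sec S.X₁ U, onSec S.f U t = s := by
  let P : S.X₂.val.Submodule :=
    { obj := fun U => LinearMap.ker (onSec S.g U.unop)
      map := by
        intro U V g s hs
        change onSec S.g V.unop (res S.X₂ g.unop.le s) = 0
        rw [onSec_res, show onSec S.g U.unop s = 0 from hs, map_zero] }
  have hP : ∀ (U : Opens X) (s : Sec S.X₂ U), (∀ x ∈ U, ∃ (V : Opens X) (h : V ≤ U), x ∈ V ∧
      res S.X₂ h s ∈ P.obj (op V)) → s ∈ P.obj (op U) := by
    intro U s h
    refine sec_ext_of_forall_mem _ _ _ fun x hx => ?_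
    obtain ⟨V, hV, hxV, h⟩ := h x hx
    refine ⟨V, hV, hxV, ?_⟩
    change res S.X₃ hV (onSec S.g U s) = _
    rw [map_zero, ← onSec_res]
    exact h
  have h0 : subsheafι S.X₂ P hP ≫ S.g = 0 := hom_ext_onSec fun U s => s.2
  exact ⟨onSec (hS.lift _ h0) U ⟨s, hs⟩, congr(onSec $(hS.lift_f _ h0) U ⟨s, hs⟩)⟩

/-- A short exact sequence, checked on sections. -/
lemma shortExact_of_onSec {A B C : ModSheaf 𝒪} (f : A ⟶ B) (g : B ⟶ C) (w : f ≫ g = 0)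
    (hf : ∀ U, Function.Injective (onSec f U)) (hg : IsLocSurj g)
    (h : ∀ (U : Opens X) (s : Sec B U), onSec g U s = 0 → ∀ x ∈ U,
      ∃ (V : Opens X) (hV : V ≤ U), x ∈ V ∧ ∃ a : Sec A V, onSec f V a = res B hV s) :
    (ShortComplex.mk f g w).ShortExact := by
  have := mono_of_onSec_injective f hf
  have := hg.epi
  refine { exact := ShortComplex.exact_of_f_is_kernel _ ?_ }
  have hl : ∀ {W : ModSheaf 𝒪} (k : W ⟶ B), k ≫ g = 0 → ∃ l : W ⟶ A, l ≫ f = k := fun k hk =>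
    exists_lift f hf k fun U s x hx => h U _ (by rw [← onSec_comp, hk]; rfl) x hx
  choose l hl using @hl
  exact Limits.KernelFork.IsLimit.ofι' f w fun k hk => ⟨l k hk, hl k hk⟩

/-! ### The universal property of the tensor product -/

/-- The presheaf tensor product. -/
noncomputable abbrev preTensor (M N : ModSheaf 𝒪) :
    PresheafOfModules.{u} (𝒪.obj ⋙ forget₂ CommRingCat RingCat.{u}) :=
  MonoidalCategory.tensorObj (C := PresheafOfModules.{u} (𝒪.obj ⋙ forget₂ _ _)) M.val N.val

/-- The map from the presheaf tensor product to the tensor product. -/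
noncomputable def tensorUnit {M N : ModSheaf 𝒪} (U : Opens X) :
    TensorProduct (Fn 𝒪 U) (Sec M U) (Sec N U) →ₗ[Fn 𝒪 U] Sec (tensor M N) U :=
  (((PresheafOfModules.sheafificationAdjunction (𝟙 (ringSheaf 𝒪).obj)).unit.app
    (MonoidalCategory.tensorObj (C := PresheafOfModules.{u} (𝒪.obj ⋙ forget₂ _ _)) M.val N.val)).app
      (op U)).hom

lemma tensorUnit_tmul {M N : ModSheaf 𝒪} {U : Opens X} (m : Sec M U) (n : Sec N U) :
    tensorUnit U (TensorProduct.tmul (Fn 𝒪 U) m n) = tmul m n := rfl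

/-- Restriction on the presheaf tensor product. -/
noncomputable def tensorRes (M N : ModSheaf 𝒪) {U V : Opens X} (h : V ≤ U) :
    TensorProduct (Fn 𝒪 U) (Sec M U) (Sec N U) →+
      TensorProduct (Fn 𝒪 V) (Sec M V) (Sec N V) :=
  ((preTensor M N).presheaf.map (homOfLE h).op).hom

lemma tensorRes_tmul (M N : ModSheaf 𝒪) {U V : Opens X} (h : V ≤ U) (m : Sec M U) (n : Sec N U) :
    tensorRes M N h (TensorProduct.tmul _ m n) = TensorProduct.tmul _ (res M h m) (res N h n) := rfl

lemma tensorUnit_res (M N : ModSheaf 𝒪) {U V : Opens X} (h : V ≤ U)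
    (t : TensorProduct (Fn 𝒪 U) (Sec M U) (Sec N U)) :
    tensorUnit V (tensorRes M N h t) = res (tensor M N) h (tensorUnit U t) :=
  congr($((CategoryTheory.toSheafify (Opens.grothendieckTopology X)
    (preTensor M N).presheaf).naturality (homOfLE h).op) t)

lemma tensorUnit_locSurj {M N : ModSheaf 𝒪} {U : Opens X} (s : Sec (tensor M N) U) (x : X)
    (hx : x ∈ U) :
    ∃ (V : Opens X) (hV : V ≤ U), x ∈ V ∧ ∃ t, tensorUnit V t = res (tensor M N) hV s := by
  obtain ⟨V, f, ⟨t, ht⟩, hxV⟩ := Presheaf.imageSieve_mem (Opens.grothendieckTopology X)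
    (CategoryTheory.toSheafify (Opens.grothendieckTopology X) (preTensor M N).presheaf)
    (U := op U) s x hx
  exact ⟨V, f.le, hxV, t, ht⟩

lemma tensorUnit_locInj {M N : ModSheaf 𝒪} {U : Opens X}
    (t t' : TensorProduct (Fn 𝒪 U) (Sec M U) (Sec N U))
    (h : tensorUnit U t = tensorUnit U t') (x : X) (hx : x ∈ U) :
    ∃ (V : Opens X) (hV : V ≤ U), x ∈ V ∧ tensorRes M N hV t = tensorRes M N hV t' := by
  obtain ⟨V, f, h, hxV⟩ := Presheaf.equalizerSieve_mem (Opens.grothendieckTopology X)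
    (CategoryTheory.toSheafify (Opens.grothendieckTopology X) (preTensor M N).presheaf)
    (X := op U) t t' h x hx
  exact ⟨V, f.le, hxV, h⟩

/-- Every section of `M ⊗ N` is locally a finite sum of sections `m ⊗ n`; hence two local
homomorphisms out of `M ⊗ N` that agree on the sections `m ⊗ n` are equal. -/
lemma LocalHom.tensor_ext {A B N : ModSheaf 𝒪} {U : Opens X} {φ ψ : LocalHom (tensor A B) N U}
    (h : ∀ (V : Opens X) (hV : V ≤ U) (a : Sec A V) (b : Sec B V),
      φ.ap hV (tmul a b) = ψ.ap hV (tmul a b)) : φ = ψ :=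
  LocalHom.ext' fun V hV s => sec_ext_of_forall_mem _ _ _ fun x hx => by
    obtain ⟨W, hW, hxW, t, ht⟩ := tensorUnit_locSurj s x hx
    refine ⟨W, hW, hxW, ?_⟩
    rw [← LocalHom.ap_res, ← LocalHom.ap_res, ← ht]
    exact congr($(TensorProduct.ext' (g := φ.ap (hW.trans hV) ∘ₗ tensorUnit W)
      (h := ψ.ap (hW.trans hV) ∘ₗ tensorUnit W) fun a b => h W _ a b) t)

/-- The universal property of the tensor product of sheaves of modules, over an open set `U`: a
family of bilinear maps on the open subsets of `U` that commutes with restriction defines a local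
homomorphism on `A ⊗ B`. Its value on a section `s` is glued from the values on local
representatives of `s` in the presheaf tensor product. -/
lemma exists_tensorLift {A B N : ModSheaf 𝒪} {U : Opens X}
    (b : ∀ V : Opens X, V ≤ U → (Sec A V →ₗ[Fn 𝒪 V] Sec B V →ₗ[Fn 𝒪 V] Sec N V))
    (hb : ∀ (V W : Opens X) (hV : V ≤ U) (hW : W ≤ V) (m : Sec A V) (n : Sec B V),
      b W (hW.trans hV) (res A hW m) (res B hW n) = res N hW (b V hV m n)) :
    ∃ φ : LocalHom (tensor A B) N U, ∀ (V : Opens X) (hV : V ≤ U) (m : Sec A V) (n : Sec B V),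
      φ.ap hV (tmul m n) = b V hV m n := by
  have hres : ∀ (V W : Opens X) (hV : V ≤ U) (hW : W ≤ V) t,
      TensorProduct.lift (b W (hW.trans hV)) (tensorRes A B hW t) =
        res N hW (TensorProduct.lift (b V hV) t) := by
    intro V W hV hW t
    induction t using TensorProduct.induction_on with
    | zero => simp
    | tmul m n => rw [tensorRes_tmul, TensorProduct.lift.tmul, hb, TensorProduct.lift.tmul]
    | add s t hs ht => rw [map_add, map_add, hs, ht, map_add, map_add]
  have huniq : ∀ (V : Opens X) (hV : V ≤ U) t t',
      tensorUnit (M := A) (N := B) V t = tensorUnit V t' →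
      TensorProduct.lift (b V hV) t = TensorProduct.lift (b V hV) t' := by
    intro V hV t t' h
    refine sec_ext_of_forall_mem _ _ _ fun x hx => ?_
    obtain ⟨W, hW, hxW, h⟩ := tensorUnit_locInj t t' h x hx
    exact ⟨W, hW, hxW, by rw [← hres, ← hres, h]⟩
  have key : ∀ (V : Opens X) (hV : V ≤ U) (s : Sec (tensor A B) V), ∃ n : Sec N V,
      ∀ (W : Opens X) (hW : W ≤ V) t, tensorUnit W t = res (tensor A B) hW s →
        TensorProduct.lift (b W (hW.trans hV)) t = res N hW n := by
    intro V hV s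
    choose W hW hx t ht using fun x : V => tensorUnit_locSurj s x.1 x.2
    have hcov : V ≤ iSup W := fun x hxV => Opens.mem_iSup.2 ⟨⟨x, hxV⟩, hx _⟩
    obtain ⟨n, hn⟩ := sec_glue N W hW hcov
      (fun i => TensorProduct.lift (b (W i) ((hW i).trans hV)) (t i)) fun i j => by
        rw [← hres, ← hres]
        apply huniq
        rw [tensorUnit_res, tensorUnit_res, ht, ht, res_res, res_res]
    refine ⟨n, fun W' hW' t' ht' => sec_ext_of_forall_mem _ _ _ fun x hx' => ?_⟩
    let i : V := ⟨x, hW' hx'⟩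
    refine ⟨W' ⊓ W i, inf_le_left, ⟨hx', hx i⟩, ?_⟩
    rw [res_res, ← hres, ← res_res N (hW i) inf_le_right n, hn, ← hres]
    apply huniq
    rw [tensorUnit_res, tensorUnit_res, ht', ht, res_res, res_res]
  choose φ hφ using key
  have hφ' : ∀ (V : Opens X) (hV : V ≤ U) (s : Sec (tensor A B) V) (n : Sec N V),
      (∀ x ∈ V, ∃ (W : Opens X) (hW : W ≤ V), x ∈ W ∧ ∃ t, tensorUnit W t = res (tensor A B) hW s ∧
        TensorProduct.lift (b W (hW.trans hV)) t = res N hW n) → φ V hV s = n := by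
    intro V hV s n h
    refine sec_ext_of_forall_mem _ _ _ fun x hx => ?_
    obtain ⟨W, hW, hxW, t, ht, hn⟩ := h x hx
    exact ⟨W, hW, hxW, by rw [← hn, hφ V hV s W hW t ht]⟩
  refine ⟨LocalHom.mk' (fun V hV =>
    { toFun := φ V hV
      map_add' := fun s s' => hφ' _ _ _ _ fun x hx => ?_
      map_smul' := fun r s => hφ' _ _ _ _ fun x hx => ?_ }) fun V W hV hW s => ?_,
    fun V hV m n => ?_⟩
  · obtain ⟨W, hW, hxW, t, ht⟩ := tensorUnit_locSurj s x hx
    obtain ⟨W', hW', hxW', t', ht'⟩ := tensorUnit_locSurj s' x hx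
    refine ⟨W ⊓ W', inf_le_left.trans hW, ⟨hxW, hxW'⟩,
      tensorRes A B inf_le_left t + tensorRes A B inf_le_right t', ?_, ?_⟩
    · rw [map_add, map_add, tensorUnit_res, tensorUnit_res, ht, ht', res_res, res_res]
    · rw [map_add, map_add]
      congr 1
      · apply hφ
        rw [tensorUnit_res, ht, res_res]
      · apply hφ
        rw [tensorUnit_res, ht', res_res]
  · obtain ⟨W, hW, hxW, t, ht⟩ := tensorUnit_locSurj s x hx
    refine ⟨W, hW, hxW, resFn (𝒪 := 𝒪) hW r • t, ?_, ?_⟩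
    · rw [map_smul, ht, res_smul]
    · rw [map_smul, RingHom.id_apply, res_smul, hφ V hV s W hW t ht]
  · change φ W _ _ = res N hW (φ V hV s)
    refine hφ' _ _ _ _ fun x hx => ?_
    obtain ⟨W', hW', hxW', t, ht⟩ := tensorUnit_locSurj (res (tensor A B) hW s) x hx
    exact ⟨W', hW', hxW', t, ht, by
      rw [res_res, ← hφ V hV s W' _ t (by rw [ht, res_res])]⟩
  · change φ V hV _ = _
    refine hφ' _ _ _ _ fun x hx => ⟨V, le_rfl, hx, TensorProduct.tmul _ m n, ?_, ?_⟩
    · rw [tensorUnit_tmul, res_self]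
    · rw [TensorProduct.lift.tmul, res_self]

/-- The global form of the universal property of the tensor product. -/
lemma exists_tensorDesc {A B N : ModSheaf 𝒪}
    (b : ∀ V : Opens X, Sec A V →ₗ[Fn 𝒪 V] Sec B V →ₗ[Fn 𝒪 V] Sec N V)
    (hb : ∀ (V W : Opens X) (hW : W ≤ V) (m : Sec A V) (n : Sec B V),
      b W (res A hW m) (res B hW n) = res N hW (b V m n)) :
    ∃ f : tensor A B ⟶ N, ∀ (V : Opens X) (m : Sec A V) (n : Sec B V),
      onSec f V (tmul m n) = b V m n := by
  obtain ⟨φ, hφ⟩ := exists_tensorLift (U := ⊤) (fun V _ => b V) fun V W _ => hb V W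
  exact ⟨homOfSec (fun V => φ.ap le_top) fun V W hW m => φ.ap_res le_top hW m,
    fun V m n => hφ V le_top m n⟩

lemma res_tmul {M N : ModSheaf 𝒪} {U V : Opens X} (h : V ≤ U) (m : Sec M U) (n : Sec N U) :
    res (tensor M N) h (tmul m n) = tmul (res M h m) (res N h n) := by
  rw [← tensorUnit_tmul, ← tensorUnit_res, tensorRes_tmul, tensorUnit_tmul]

/-- The bilinear map `(m, n) ↦ m ⊗ n` on sections. -/
noncomputable def tmulₗ (M N : ModSheaf 𝒪) (U : Opens X) :
    Sec M U →ₗ[Fn 𝒪 U] Sec N U →ₗ[Fn 𝒪 U] Sec (tensor M N) U :=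
  (TensorProduct.mk (Fn 𝒪 U) (Sec M U) (Sec N U)).compr₂ (tensorUnit U)

lemma tmulₗ_apply {M N : ModSheaf 𝒪} {U : Opens X} (m : Sec M U) (n : Sec N U) :
    tmulₗ M N U m n = tmul m n := rfl

/-! ### Coordinates on sheaves of modules -/

/-- The sections of the unit sheaf of modules are the functions. -/
noncomputable def unitSec (V : Opens X) :
    Sec (𝒪 := 𝒪) (SheafOfModules.unit (ringSheaf 𝒪)) V ≃ₗ[Fn 𝒪 V] Fn 𝒪 V where
  toFun f := f
  invFun f := f
  map_add' _ _ := rfl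
  map_smul' _ _ := rfl

lemma unitSec_res {V W : Opens X} (h : W ≤ V) (f : Sec (𝒪 := 𝒪) (SheafOfModules.unit _) V) :
    unitSec W (res (SheafOfModules.unit (ringSheaf 𝒪)) h f) = resFn h (unitSec V f) := rfl

lemma unitSec_symm_res {V W : Opens X} (h : W ≤ V) (f : Fn 𝒪 V) :
    (unitSec W).symm (resFn h f) =
      res (SheafOfModules.unit (ringSheaf 𝒪)) h ((unitSec V).symm f) := rfl

/-- An isomorphism, over the open set `U`, from the sheaf of modules `M` onto the sheaf of ideals
`J`, recorded as the coordinate `M(V) → 𝒪(V)` of sections over the open sets `V ⊆ U`. For `J = 𝒪`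
this is a trivialization of an invertible sheaf. -/
structure Coord (M : ModSheaf 𝒪) (U : Opens X) (J : ∀ V : Opens X, Ideal (Fn 𝒪 V)) where
  /-- The coordinate of a section. -/
  ap : ∀ {V : Opens X}, V ≤ U → (Sec M V →ₗ[Fn 𝒪 V] Fn 𝒪 V)
  ap_res : ∀ {V W : Opens X} (hV : V ≤ U) (hW : W ≤ V) (m : Sec M V),
    ap (hW.trans hV) (res M hW m) = resFn (𝒪 := 𝒪) hW (ap hV m)
  inj : ∀ {V : Opens X} (hV : V ≤ U), Function.Injective (ap hV)
  range : ∀ {V : Opens X} (hV : V ≤ U), LinearMap.range (ap hV) = J V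

namespace Coord
variable {M N L : ModSheaf 𝒪} {U : Opens X} {J : ∀ V : Opens X, Ideal (Fn 𝒪 V)}

/-- Restriction of a coordinate to a smaller open set. -/
def restrict (c : Coord M U J) {U' : Opens X} (h : U' ≤ U) : Coord M U' J where
  ap hV := c.ap (hV.trans h)
  ap_res hV := c.ap_res (hV.trans h)
  inj hV := c.inj (hV.trans h)
  range hV := c.range (hV.trans h)

lemma mem (c : Coord M U J) {V : Opens X} (hV : V ≤ U) (m : Sec M V) : c.ap hV m ∈ J V :=
  c.range hV ▸ LinearMap.mem_range_self _ m

lemma exists_eq (c : Coord M U J) {V : Opens X} (hV : V ≤ U) {a : Fn 𝒪 V} (ha : a ∈ J V) :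
    ∃ m : Sec M V, c.ap hV m = a :=
  LinearMap.mem_range.1 ((c.range hV).symm ▸ ha)

lemma res_mem (c : Coord M U J) {V W : Opens X} (hV : V ≤ U) (hW : W ≤ V) {a : Fn 𝒪 V}
    (ha : a ∈ J V) : resFn (𝒪 := 𝒪) hW a ∈ J W := by
  obtain ⟨m, rfl⟩ := c.exists_eq hV ha
  rw [← c.ap_res hV hW]
  exact c.mem _ _

/-- A trivialization of `M`, from bijections on sections. -/
lemma nonempty_of_bijective (c : ∀ V : Opens X, V ≤ U → Sec M V → Fn 𝒪 V)
    (hadd : ∀ (V : Opens X) (hV : V ≤ U) (m n : Sec M V), c V hV (m + n) = c V hV m + c V hV n)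
    (hsmul : ∀ (V : Opens X) (hV : V ≤ U) (f : Fn 𝒪 V) (m : Sec M V),
      c V hV (f • m) = f * c V hV m)
    (hres : ∀ (V W : Opens X) (hV : V ≤ U) (hW : W ≤ V) (m : Sec M V),
      c W (hW.trans hV) (res M hW m) = resFn (𝒪 := 𝒪) hW (c V hV m))
    (hbij : ∀ (V : Opens X) (hV : V ≤ U), Function.Bijective (c V hV)) :
    Nonempty (Coord M U fun _ => ⊤) :=
  ⟨{ ap := fun {V} hV => { toFun := c V hV, map_add' := hadd V hV, map_smul' := hsmul V hV }
     ap_res := fun {V W} hV hW m => hres V W hV hW m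
     inj := fun {V} hV => (hbij V hV).1
     range := fun {V} hV => LinearMap.range_eq_top.2 (hbij V hV).2 }⟩

/-- Tensoring with an invertible sheaf does not change the ideal onto which a coordinate maps: with
a frame `e` of `L`, every section of `L ⊗ N` is locally of the form `e ⊗ n`. -/
lemma exists_tensor (c : Coord L U fun _ => ⊤) (d : Coord N U J) :
    ∃ t : Coord (tensor L N) U J, ∀ (V : Opens X) (hV : V ≤ U) (l : Sec L V) (n : Sec N V),
      t.ap hV (tmul l n) = c.ap hV l * d.ap hV n := by
  obtain ⟨φ, hφ⟩ := exists_tensorLift (A := L) (B := N) (N := SheafOfModules.unit (ringSheaf 𝒪))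
    (U := U)
    (fun V hV => ((LinearMap.mul (Fn 𝒪 V) (Fn 𝒪 V)).compl₁₂ (c.ap hV) (d.ap hV)).compr₂
      (unitSec V).symm.toLinearMap) (fun V W hV hW m n => by
        change (unitSec W).symm (c.ap _ _ * d.ap _ _) = res _ hW ((unitSec V).symm
          (c.ap hV m * d.ap hV n))
        rw [← unitSec_symm_res, map_mul (resFn (𝒪 := 𝒪) hW), c.ap_res hV hW, d.ap_res hV hW])
  have hφ' : ∀ (V : Opens X) (hV : V ≤ U) (l : Sec L V) (n : Sec N V),
      unitSec V (φ.ap hV (tmul l n)) = c.ap hV l * d.ap hV n := fun V hV l n => by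
    rw [hφ]; rfl
  have hloc : ∀ (V : Opens X) (hV : V ≤ U) (e : Sec L V), c.ap hV e = 1 →
      ∀ t, ∃ n : Sec N V, tensorUnit V t = tmul e n := by
    intro V hV e he t
    induction t using TensorProduct.induction_on with
    | zero => exact ⟨0, by rw [← tmulₗ_apply]; simp⟩
    | tmul l n =>
      refine ⟨c.ap hV l • n, ?_⟩
      have : l = c.ap hV l • e := c.inj hV (by rw [map_smul, he, smul_eq_mul, mul_one])
      rw [tensorUnit_tmul, ← tmulₗ_apply, ← tmulₗ_apply, map_smul, ← LinearMap.smul_apply,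
        ← map_smul, ← this]
    | add s t hs ht =>
      obtain ⟨n, hn⟩ := hs
      obtain ⟨m, hm⟩ := ht
      refine ⟨n + m, ?_⟩
      rw [map_add, hn, hm, ← tmulₗ_apply, ← tmulₗ_apply, ← tmulₗ_apply, map_add]
  have hloc' : ∀ (V : Opens X) (hV : V ≤ U) (s : Sec (tensor L N) V), ∀ x ∈ V,
      ∃ (W : Opens X) (hW : W ≤ V) (l : Sec L W) (n : Sec N W), x ∈ W ∧ c.ap (hW.trans hV) l = 1 ∧
        res _ hW s = tmul l n := by
    intro V hV s x hx
    obtain ⟨W, hW, hxW, t, ht⟩ := tensorUnit_locSurj s x hx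
    obtain ⟨e, he⟩ := c.exists_eq (hW.trans hV) (a := 1) trivial
    obtain ⟨n, hn⟩ := hloc W (hW.trans hV) e he t
    exact ⟨W, hW, e, n, hxW, he, by rw [← ht, hn]⟩
  have hinj : ∀ (V : Opens X) (hV : V ≤ U) (s : Sec (tensor L N) V),
      unitSec V (φ.ap hV s) = 0 → s = 0 := by
    intro V hV s hs
    refine sec_ext_of_forall_mem _ _ _ fun x hx => ?_
    obtain ⟨W, hW, l, n, hxW, hl, h⟩ := hloc' V hV s x hx
    refine ⟨W, hW, hxW, ?_⟩
    have h0 : unitSec W (φ.ap (hW.trans hV) (res _ hW s)) = 0 := by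
      rw [φ.ap_res hV hW, unitSec_res, hs, map_zero]
    rw [h, hφ', hl, one_mul] at h0
    have hn : n = 0 := d.inj (hW.trans hV) (by rw [h0, map_zero])
    rw [h, hn, map_zero, ← tmulₗ_apply, map_zero]
  have hJ : ∀ (V : Opens X) (hV : V ≤ U) (s : Sec (tensor L N) V),
      ∃ n : Sec N V, d.ap hV n = unitSec V (φ.ap hV s) := by
    intro V hV s
    obtain ⟨e, he⟩ := c.exists_eq hV (a := 1) trivial
    choose W hW l n hx hl h using fun x : V => hloc' V hV s x.1 x.2
    have hcov : V ≤ iSup W := fun x hxV => Opens.mem_iSup.2 ⟨⟨x, hxV⟩, hx _⟩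
    have hd : ∀ x, d.ap ((hW x).trans hV) (n x) =
        resFn (𝒪 := 𝒪) (hW x) (unitSec V (φ.ap hV s)) := by
      intro x
      rw [← unitSec_res, ← φ.ap_res hV (hW x), h x, hφ', hl, one_mul]
    obtain ⟨n', hn'⟩ := sec_glue N W hW hcov n fun i j =>
      d.inj (inf_le_left.trans ((hW i).trans hV)) (by
      rw [d.ap_res ((hW i).trans hV) inf_le_left, hd, d.ap_res ((hW j).trans hV) inf_le_right, hd,
        resFn_resFn, resFn_resFn])
    refine ⟨n', (unitSec V).symm.injective
      (sec_ext (SheafOfModules.unit (ringSheaf 𝒪)) W hW hcov _ _ fun i => ?_)⟩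
    rw [← unitSec_symm_res, ← unitSec_symm_res, ← hd, ← hn', d.ap_res hV (hW i)]
  refine ⟨
    { ap := fun {V} hV => (unitSec V).toLinearMap ∘ₗ φ.ap hV
      ap_res := fun {V W} hV hW m => congr_arg (unitSec W) (φ.ap_res hV hW m)
      inj := fun {V} hV => (injective_iff_map_eq_zero _).2 fun s hs => hinj V hV s hs
      range := fun {V} hV => ?_ }, hφ'⟩
  ext a
  refine ⟨?_, fun ha => ?_⟩
  · rintro ⟨s, rfl⟩
    obtain ⟨n, hn⟩ := hJ V hV s
    exact hn ▸ d.mem hV n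
  · obtain ⟨e, he⟩ := c.exists_eq hV (a := 1) trivial
    obtain ⟨n, hn⟩ := d.exists_eq hV ha
    exact ⟨tmul e n, (hφ' V hV e n).trans (by rw [he, hn, one_mul])⟩

/-- The dual frame. -/
lemma exists_dual (c : Coord L U fun _ => ⊤) :
    ∃ d : Coord (dual L) U fun _ => ⊤, ∀ (V W : Opens X) (hV : V ≤ U) (hW : W ≤ V)
      (φ : Sec (dual L) V) (l : Sec L W),
      pairing φ hW l = resFn (𝒪 := 𝒪) hW (d.ap hV φ) * c.ap (hW.trans hV) l := by
  obtain ⟨e, he⟩ := c.exists_eq le_rfl (a := 1) trivial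
  have he' : ∀ {V : Opens X} (hV : V ≤ U), c.ap hV (res L hV e) = 1 := fun hV => by
    rw [c.ap_res le_rfl hV, he, map_one]
  have hp : ∀ (V W : Opens X) (hV : V ≤ U) (hW : W ≤ V) (φ : Sec (dual L) V) (l : Sec L W),
      pairing φ hW l = resFn (𝒪 := 𝒪) hW (pairing φ le_rfl (res L hV e)) *
        c.ap (hW.trans hV) l := by
    intro V W hV hW φ l
    have hl : l = c.ap (hW.trans hV) l • res L hW (res L hV e) :=
      c.inj (hW.trans hV) (by rw [map_smul, res_res, he', smul_eq_mul, mul_one])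
    have h1 : pairing φ hW (res L hW (res L hV e)) =
        resFn (𝒪 := 𝒪) hW (pairing φ le_rfl (res L hV e)) :=
      LocalHom.ap_res (φ : LocalHom L (SheafOfModules.unit (ringSheaf 𝒪)) V) le_rfl hW (res L hV e)
    conv_lhs => rw [hl]
    change LocalHom.ap (φ : LocalHom L (SheafOfModules.unit (ringSheaf 𝒪)) V) hW _ = _
    rw [map_smul, mul_comm]
    exact congr_arg (c.ap (hW.trans hV) l * ·) h1
  refine ⟨
    { ap := fun {V} hV =>
        { toFun := fun φ => pairing φ le_rfl (res L hV e)
          map_add' := fun φ ψ => rfl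
          map_smul' := fun r φ => by
            change resFn (𝒪 := 𝒪) le_rfl r * _ = r * _
            rw [resFn_self]
            rfl }
      ap_res := fun {V W} hV hW φ => ?_
      inj := fun {V} hV φ ψ h => ?_
      range := fun {V} hV => ?_ }, hp⟩
  · change pairing φ hW (res L (hW.trans hV) e) = resFn (𝒪 := 𝒪) hW (pairing φ le_rfl (res L hV e))
    rw [hp V W hV hW, he', mul_one]
  · refine LocalHom.ext' fun W hW l => ?_
    change pairing φ hW l = pairing ψ hW l
    rw [hp V W hV hW φ, hp V W hV hW ψ]
    congr 2
  · refine eq_top_iff.2 fun a _ => ⟨LocalHom.mk' (N := SheafOfModules.unit (ringSheaf 𝒪))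
      (fun W hW => (unitSec W).symm.toLinearMap ∘ₗ
        (LinearMap.mulLeft (Fn 𝒪 W) (resFn (𝒪 := 𝒪) hW a) ∘ₗ c.ap (hW.trans hV)))
      fun W W' hW hW' l => ?_, ?_⟩
    · change (unitSec W').symm (resFn (𝒪 := 𝒪) (hW'.trans hW) a * _) =
        res _ hW' ((unitSec W).symm (resFn (𝒪 := 𝒪) hW a * _))
      rw [← unitSec_symm_res, map_mul (resFn (𝒪 := 𝒪) hW'), resFn_resFn, c.ap_res]
    · change resFn (𝒪 := 𝒪) le_rfl a * c.ap hV (res L hV e) = a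
      rw [he', mul_one, resFn_self]

/-- The tautological coordinate on an ideal sheaf. -/
noncomputable def ofIdeal (I : ∀ U : Opens X, Ideal (Fn 𝒪 U))
    (hI : ∀ (U V : Opens X) (h : V ≤ U), I U ≤ (I V).comap (resFn (𝒪 := 𝒪) h)) (U : Opens X) :
    Coord (idealSheaf I hI) U (localIdeal I hI) where
  ap _ :=
    { toFun := toFn
      map_add' := fun _ _ => rfl
      map_smul' := fun _ _ => rfl }
  ap_res _ _ _ := rfl
  inj _ := Subtype.val_injective
  range _ := by
    ext a
    exact ⟨fun ⟨m, hm⟩ => hm ▸ m.2, fun ha => ⟨⟨a, ha⟩, rfl⟩⟩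

lemma ofIdeal_ap (I : ∀ U : Opens X, Ideal (Fn 𝒪 U))
    (hI : ∀ (U V : Opens X) (h : V ≤ U), I U ≤ (I V).comap (resFn (𝒪 := 𝒪) h)) {U V : Opens X}
    (hV : V ≤ U) (a : Sec (idealSheaf I hI) V) : (ofIdeal I hI U).ap hV a = toFn a := rfl

/-- A frame of an invertible sheaf. -/
lemma exists_of_rank_one (hL : IsLocallyFreeOfRank L 1) (x : X) :
    ∃ U : Opens X, x ∈ U ∧ Nonempty (Coord L U fun _ => ⊤) := by
  obtain ⟨U, hx, e, he⟩ := hL x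
  have hb : ∀ {V : Opens X} (h : V ≤ U),
      Function.Bijective (LinearMap.toSpanSingleton (Fn 𝒪 V) (Sec L V) (res L h (e 0))) := by
    intro V h
    have h2 : ⇑(LinearMap.toSpanSingleton (Fn 𝒪 V) (Sec L V) (res L h (e 0))) =
        (fun c : Fin 1 → Fn 𝒪 V => ∑ j, c j • res L h (e j)) ∘
          (Equiv.funUnique (Fin 1) _).symm := by
      ext a; simp
    rw [h2]
    exact (he V h).comp (Equiv.bijective _)
  let f {V : Opens X} (h : V ≤ U) := LinearEquiv.ofBijective _ (hb h)
  refine ⟨U, hx, ⟨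
    { ap := fun h => (f h).symm.toLinearMap
      ap_res := fun {V W} hV hW m => ?_
      inj := fun h => (f h).symm.injective
      range := fun h => LinearEquiv.range _ }⟩⟩
  obtain ⟨a, rfl⟩ := (f hV).surjective m
  change (f _).symm _ = resFn (𝒪 := 𝒪) hW ((f hV).symm _)
  rw [LinearEquiv.symm_apply_apply, LinearEquiv.symm_apply_eq]
  change res L hW (a • res L hV (e 0)) = resFn (𝒪 := 𝒪) hW a • res L _ (e 0)
  rw [res_smul, res_res]

end Coord

/-- The sections `e₁, …, eₙ` of `M` over `U` are a frame: over every open `V ⊆ U` they form a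
basis. -/
def IsFrame {M : ModSheaf 𝒪} {U : Opens X} {n : ℕ} (e : Fin n → Sec M U) : Prop :=
  ∀ (V : Opens X) (h : V ≤ U),
    Function.Bijective (fun c : Fin n → Fn 𝒪 V => ∑ j, c j • res M h (e j))

lemma IsFrame.restrict {M : ModSheaf 𝒪} {U U' : Opens X} {n : ℕ} {e : Fin n → Sec M U}
    (he : IsFrame e) (h : U' ≤ U) : IsFrame (fun j => res M h (e j)) := by
  intro V hV
  simpa only [res_res] using he V (hV.trans h)

lemma IsFrame.hom_ext {M N : ModSheaf 𝒪} {U : Opens X} {n : ℕ} {e : Fin n → Sec M U}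
    (he : IsFrame e) {φ ψ : Sec (homSheaf M N) U}
    (h : ∀ j, homEval φ le_rfl (e j) = homEval ψ le_rfl (e j)) : φ = ψ :=
  LocalHom.ext' fun V hV m => by
    obtain ⟨c, rfl⟩ := (he V hV).2 m
    rw [map_sum, map_sum]
    refine Finset.sum_congr rfl fun j _ => ?_
    rw [map_smul, map_smul]
    congr 1
    exact (LocalHom.ap_res φ le_rfl hV (e j)).trans
      ((congr_arg (res N hV) (h j)).trans (LocalHom.ap_res ψ le_rfl hV (e j)).symm)

lemma IsFrame.exists_hom {M N : ModSheaf 𝒪} {U : Opens X} {n : ℕ} {e : Fin n → Sec M U}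
    (he : IsFrame e) (s : Fin n → Sec N U) :
    ∃ φ : Sec (homSheaf M N) U, ∀ j, homEval φ le_rfl (e j) = s j := by
  have hb : ∀ {V : Opens X} (h : V ≤ U), Function.Bijective
      (Fintype.linearCombination (Fn 𝒪 V) fun j => res M h (e j)) := fun {V} h => he V h
  let f {V : Opens X} (h : V ≤ U) := LinearEquiv.ofBijective _ (hb h)
  have hf : ∀ {V : Opens X} (h : V ≤ U) c, f h c = ∑ j, c j • res M h (e j) := fun _ _ => rfl
  refine ⟨LocalHom.mk' (fun V hV =>
    (Fintype.linearCombination (Fn 𝒪 V) fun j => res N hV (s j)) ∘ₗ (f hV).symm.toLinearMap) ?_, ?_⟩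
  · intro V W hV hW m
    obtain ⟨c, rfl⟩ := (f hV).surjective m
    have h1 : res M hW (f hV c) = f (hW.trans hV) (fun j => resFn (𝒪 := 𝒪) hW (c j)) := by
      rw [hf, hf, map_sum]
      exact Finset.sum_congr rfl fun j _ => by rw [res_smul, res_res]
    rw [h1, LinearMap.comp_apply, LinearMap.comp_apply, LinearEquiv.coe_coe, LinearEquiv.coe_coe,
      LinearEquiv.symm_apply_apply, LinearEquiv.symm_apply_apply, Fintype.linearCombination_apply,
      Fintype.linearCombination_apply, map_sum]
    exact Finset.sum_congr rfl fun j _ => by rw [res_smul, res_res]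
  · intro j
    have h1 : e j = f le_rfl (Pi.single j 1) := by
      rw [hf, Finset.sum_eq_single j (fun k _ hk => by simp [hk]) (by simp)]
      rw [Pi.single_eq_same, one_smul, res_self]
    change (Fintype.linearCombination (Fn 𝒪 U) fun j => res N le_rfl (s j)) ((f le_rfl).symm (e j))
      = s j
    conv_lhs => rw [h1]
    rw [LinearEquiv.symm_apply_apply, Fintype.linearCombination_apply_single, one_smul, res_self]

/-! ### Regular pairs of generators of an ideal sheaf -/

lemma fn_ext_of_forall_mem {U : Opens X} (s t : Fn 𝒪 U)
    (h : ∀ x ∈ U, ∃ (V : Opens X) (hV : V ≤ U), x ∈ V ∧ resFn (𝒪 := 𝒪) hV s = resFn hV t) :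
    s = t :=
  (unitSec U).symm.injective (sec_ext_of_forall_mem (SheafOfModules.unit (ringSheaf 𝒪)) _ _ h)

section RegularPair
variable (I : ∀ V : Opens X, Ideal (Fn 𝒪 V)) {U : Opens X} (x y : Fn 𝒪 U)

/-- Over `U`, every function in `I` is locally a linear combination of `x` and `y`. That `x` and `y`
belong to `I` is not part of the definition. -/
def GeneratedBy : Prop :=
  ∀ (V : Opens X) (hV : V ≤ U) (a : Fn 𝒪 V), a ∈ I V → ∀ p ∈ V, ∃ (W : Opens X) (hW : W ≤ V),
    p ∈ W ∧ ∃ b c : Fn 𝒪 W, resFn (𝒪 := 𝒪) hW a =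
      b * resFn (𝒪 := 𝒪) (hW.trans hV) x + c * resFn (𝒪 := 𝒪) (hW.trans hV) y

/-- Over `U`, the functions `x` and `y` generate the ideal sheaf `I` (`GeneratedBy`), only `0`
annihilates both of them, and locally their only syzygies are the multiples of the trivial one
(exactness of the Koszul complex in its middle term). Both the unit ideal and the ideal of a point
of a surface have such generators. -/
structure IsRegularPair : Prop where
  gen : GeneratedBy I x y
  koszul : ∀ (V : Opens X) (hV : V ≤ U) (a b : Fn 𝒪 V),
    a * resFn (𝒪 := 𝒪) hV y = b * resFn (𝒪 := 𝒪) hV x → ∀ p ∈ V, ∃ (W : Opens X) (hW : W ≤ V),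
      p ∈ W ∧ ∃ c : Fn 𝒪 W, resFn (𝒪 := 𝒪) hW a = c * resFn (𝒪 := 𝒪) (hW.trans hV) x ∧
        resFn (𝒪 := 𝒪) hW b = c * resFn (𝒪 := 𝒪) (hW.trans hV) y
  reg : ∀ (V : Opens X) (hV : V ≤ U) (c : Fn 𝒪 V), c * resFn (𝒪 := 𝒪) hV x = 0 →
    c * resFn (𝒪 := 𝒪) hV y = 0 → c = 0

variable {I x y}

lemma GeneratedBy.restrict (h : GeneratedBy I x y) {U' : Opens X} (hU : U' ≤ U) :
    GeneratedBy I (resFn (𝒪 := 𝒪) hU x) (resFn (𝒪 := 𝒪) hU y) := by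
  intro V hV
  simp only [resFn_resFn]
  exact h V (hV.trans hU)

lemma IsRegularPair.restrict (h : IsRegularPair I x y) {U' : Opens X} (hU : U' ≤ U) :
    IsRegularPair I (resFn (𝒪 := 𝒪) hU x) (resFn (𝒪 := 𝒪) hU y) where
  gen := h.gen.restrict hU
  koszul V hV := by
    simp only [resFn_resFn]
    exact h.koszul V (hV.trans hU)
  reg V hV := by
    simp only [resFn_resFn]
    exact h.reg V (hV.trans hU)

/-- Any two functions in `I` that generate it form a regular pair as soon as one regular pair of
generators exists: a syzygy `a * t = b * s` defines a homomorphism `I → 𝒪` with `s ↦ a` and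
`t ↦ b`, and by the Koszul property of `(x, y)` every such homomorphism is a multiplication. -/
lemma IsRegularPair.of_generatedBy (h : IsRegularPair I x y) (hx : x ∈ I U) (hy : y ∈ I U)
    (hI : ∀ (V : Opens X) (hV : V ≤ U) (a : Fn 𝒪 U), a ∈ I U → resFn (𝒪 := 𝒪) hV a ∈ I V)
    {s t : Fn 𝒪 U} (hst : GeneratedBy I s t) : IsRegularPair I s t := by
  have hgen : ∀ (z : Fn 𝒪 U), z ∈ I U → ∀ (V : Opens X) (hV : V ≤ U), ∀ p ∈ V,
      ∃ (W : Opens X) (hW : W ≤ V), p ∈ W ∧ ∃ b c : Fn 𝒪 W, resFn (𝒪 := 𝒪) (hW.trans hV) z =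
        b * resFn (𝒪 := 𝒪) (hW.trans hV) s + c * resFn (𝒪 := 𝒪) (hW.trans hV) t := by
    intro z hz V hV p hp
    obtain ⟨W, hW, hpW, b, c, hbc⟩ := hst V hV _ (hI V hV z hz) p hp
    exact ⟨W, hW, hpW, b, c, by rw [← hbc, resFn_resFn]⟩
  -- A function killed by `s` and `t` is killed by every element of `I`.
  have hkill : ∀ (z : Fn 𝒪 U), z ∈ I U → ∀ (V : Opens X) (hV : V ≤ U) (c : Fn 𝒪 V),
      c * resFn (𝒪 := 𝒪) hV s = 0 → c * resFn (𝒪 := 𝒪) hV t = 0 →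
        c * resFn (𝒪 := 𝒪) hV z = 0 := by
    intro z hz V hV c hs ht
    refine fn_ext_of_forall_mem _ _ fun p hp => ?_
    obtain ⟨W, hW, hpW, b, d, hbd⟩ := hgen z hz V hV p hp
    refine ⟨W, hW, hpW, ?_⟩
    have hs' := congr_arg (resFn (𝒪 := 𝒪) hW) hs
    have ht' := congr_arg (resFn (𝒪 := 𝒪) hW) ht
    rw [map_mul, resFn_resFn, map_zero] at hs' ht' ⊢
    rw [hbd]
    linear_combination b * hs' + d * ht'
  have hreg : ∀ (V : Opens X) (hV : V ≤ U) (c : Fn 𝒪 V), c * resFn (𝒪 := 𝒪) hV s = 0 →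
      c * resFn (𝒪 := 𝒪) hV t = 0 → c = 0 := fun V hV c hs ht =>
    h.reg V hV c (hkill x hx V hV c hs ht) (hkill y hy V hV c hs ht)
  refine ⟨hst, fun V hV a b hab p hp => ?_, hreg⟩
  obtain ⟨W₁, hW₁, hp₁, x₁, x₂, hx₁⟩ := hgen x hx V hV p hp
  obtain ⟨W₂, hW₂, hp₂, y₁, y₂, hy₁⟩ := hgen y hy W₁ (hW₁.trans hV) p hp₁
  have hab₂ := congr_arg (resFn (𝒪 := 𝒪) (hW₂.trans hW₁)) hab
  have hx₂ := congr_arg (resFn (𝒪 := 𝒪) hW₂) hx₁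
  rw [map_mul, map_mul, resFn_resFn, resFn_resFn] at hab₂
  rw [map_add, map_mul, map_mul, resFn_resFn, resFn_resFn, resFn_resFn] at hx₂
  set a₂ := resFn (𝒪 := 𝒪) (hW₂.trans hW₁) a
  set b₂ := resFn (𝒪 := 𝒪) (hW₂.trans hW₁) b
  set x₁' := resFn (𝒪 := 𝒪) hW₂ x₁
  set x₂' := resFn (𝒪 := 𝒪) hW₂ x₂
  -- The would-be values of the homomorphism `s ↦ a`, `t ↦ b` on `x` and `y`.
  obtain ⟨W, hW, hpW, c, hcx, hcy⟩ := h.koszul W₂ (hW₂.trans (hW₁.trans hV))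
    (x₁' * a₂ + x₂' * b₂) (y₁ * a₂ + y₂ * b₂) (by
      rw [← sub_eq_zero]
      refine hreg W₂ (hW₂.trans (hW₁.trans hV)) _ ?_ ?_
      · rw [hx₂, hy₁]
        linear_combination (x₁' * y₂ - x₂' * y₁) *
          resFn (𝒪 := 𝒪) (hW₂.trans (hW₁.trans hV)) s * hab₂
      · rw [hx₂, hy₁]
        linear_combination (x₁' * y₂ - x₂' * y₁) *
          resFn (𝒪 := 𝒪) (hW₂.trans (hW₁.trans hV)) t * hab₂)
    p hp₂
  have hab₃ := congr_arg (resFn (𝒪 := 𝒪) hW) hab₂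
  have hx₃ := congr_arg (resFn (𝒪 := 𝒪) hW) hx₂
  have hy₃ := congr_arg (resFn (𝒪 := 𝒪) hW) hy₁
  simp only [map_add, map_mul, resFn_resFn] at hab₃ hx₃ hy₃ hcx hcy
  refine ⟨W, hW.trans (hW₂.trans hW₁), hpW, c, ?_, ?_⟩
  · have h1 : resFn (𝒪 := 𝒪) (hW.trans (hW₂.trans hW₁)) a = resFn (𝒪 := 𝒪) hW a₂ :=
      (resFn_resFn _ _ _).symm
    rw [h1, ← sub_eq_zero]
    refine h.reg W (hW.trans (hW₂.trans (hW₁.trans hV))) _ ?_ ?_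
    · linear_combination resFn (𝒪 := 𝒪) hW a₂ * hx₃ +
        resFn (𝒪 := 𝒪) (hW.trans (hW₂.trans (hW₁.trans hV))) s * hcx + resFn (𝒪 := 𝒪) hW x₂' * hab₃
    · linear_combination resFn (𝒪 := 𝒪) hW a₂ * hy₃ +
        resFn (𝒪 := 𝒪) (hW.trans (hW₂.trans (hW₁.trans hV))) s * hcy + resFn (𝒪 := 𝒪) hW y₂ * hab₃
  · have h1 : resFn (𝒪 := 𝒪) (hW.trans (hW₂.trans hW₁)) b = resFn (𝒪 := 𝒪) hW b₂ :=
      (resFn_resFn _ _ _).symm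
    rw [h1, ← sub_eq_zero]
    refine h.reg W (hW.trans (hW₂.trans (hW₁.trans hV))) _ ?_ ?_
    · linear_combination resFn (𝒪 := 𝒪) hW b₂ * hx₃ +
        resFn (𝒪 := 𝒪) (hW.trans (hW₂.trans (hW₁.trans hV))) t * hcx - resFn (𝒪 := 𝒪) hW x₁' * hab₃
    · linear_combination resFn (𝒪 := 𝒪) hW b₂ * hy₃ +
        resFn (𝒪 := 𝒪) (hW.trans (hW₂.trans (hW₁.trans hV))) t * hcy - resFn (𝒪 := 𝒪) hW y₁ * hab₃

end RegularPair

/-! ### The dual of an extension, in coordinates -/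

lemma homEval_res {M N : ModSheaf 𝒪} {U V W : Opens X} (φ : Sec (homSheaf M N) U) (hV : V ≤ U)
    (hW : W ≤ V) (m : Sec M W) :
    homEval (res (homSheaf M N) hV φ) hW m = homEval φ (hW.trans hV) m := rfl

lemma res_homEval {M N : ModSheaf 𝒪} {U V W : Opens X} (φ : Sec (homSheaf M N) U) (hV : V ≤ U)
    (hW : W ≤ V) (m : Sec M V) :
    res N hW (homEval φ hV m) = homEval φ (hW.trans hV) (res M hW m) :=
  (LocalHom.ap_res φ hV hW m).symm

lemma homEval_precomp {M N P : ModSheaf 𝒪} (f : M ⟶ N) {U V : Opens X} (φ : Sec (homSheaf N P) U)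
    (hV : V ≤ U) (m : Sec M V) :
    homEval (onSec (precomp f P) U φ) hV m = homEval φ hV (onSec f V m) := rfl

lemma homSheaf_ext {M N : ModSheaf 𝒪} {U : Opens X} {φ ψ : Sec (homSheaf M N) U}
    (h : ∀ (V : Opens X) (hV : V ≤ U) (m : Sec M V), homEval φ hV m = homEval ψ hV m) : φ = ψ :=
  LocalHom.ext' h

lemma homEval_zero {M N : ModSheaf 𝒪} {U V : Opens X} (hV : V ≤ U) (m : Sec M V) :
    homEval (0 : Sec (homSheaf M N) U) hV m = 0 := rfl

/-- Precomposition with a locally surjective morphism is injective. -/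
lemma IsLocSurj.precomp_injective {M N : ModSheaf 𝒪} {f : M ⟶ N} (hf : IsLocSurj f)
    (P : ModSheaf 𝒪) (U : Opens X) : Function.Injective (onSec (precomp f P) U) := by
  intro φ ψ h
  refine homSheaf_ext fun V hV n => sec_ext_of_forall_mem _ _ _ fun x hx => ?_
  obtain ⟨W, hW, hxW, m, hm⟩ := hf V n x hx
  refine ⟨W, hW, hxW, ?_⟩
  rw [res_homEval, res_homEval, ← hm, ← homEval_precomp, h, homEval_precomp]

lemma Coord.hom_ext {L N : ModSheaf 𝒪} {U : Opens X} (c : Coord L U fun _ => ⊤)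
    {φ ψ : Sec (homSheaf L N) U} {l : Sec L U} (hl : c.ap le_rfl l = 1)
    (h : homEval φ le_rfl l = homEval ψ le_rfl l) : φ = ψ := by
  refine homSheaf_ext fun V hV m => ?_
  have hm : m = c.ap hV m • res L hV l :=
    c.inj hV (by rw [map_smul, c.ap_res le_rfl hV, hl, map_one, smul_eq_mul, mul_one])
  rw [hm, map_smul, map_smul, ← res_homEval φ le_rfl hV, ← res_homEval ψ le_rfl hV, h]

section Local
variable {L E Q N A B : ModSheaf 𝒪}

/-- Coordinates over `U` for the sheaves in `0 → L → E → Q → 0` and for the target `N` of the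
homomorphisms: `L` and `A` are trivialized, `E` has a frame of two sections, and `Q`, `N` and `B`
are identified with the sheaves of ideals `I`, `J` and `K`. In these coordinates
`α : A ⟶ Hom(Q, N)` and `β : B ⟶ Hom(L, N)` are multiplication. -/
structure LocalCoords (E : ModSheaf 𝒪) (α : A ⟶ homSheaf Q N) (β : B ⟶ homSheaf L N)
    (I J K : ∀ V : Opens X, Ideal (Fn 𝒪 V)) (U : Opens X) where
  cL : Coord L U fun _ => ⊤
  cQ : Coord Q U I
  cN : Coord N U J
  cA : Coord A U fun _ => ⊤
  cB : Coord B U K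
  ap_α : ∀ (V W : Opens X) (hV : V ≤ U) (hW : W ≤ V) (a : Sec A V) (w : Sec Q W),
    cN.ap (hW.trans hV) (homEval (onSec α V a) hW w) =
      resFn (𝒪 := 𝒪) hW (cA.ap hV a) * cQ.ap (hW.trans hV) w
  ap_β : ∀ (V W : Opens X) (hV : V ≤ U) (hW : W ≤ V) (b : Sec B V) (l : Sec L W),
    cN.ap (hW.trans hV) (homEval (onSec β V b) hW l) =
      resFn (𝒪 := 𝒪) hW (cB.ap hV b) * cL.ap (hW.trans hV) l
  /-- The frame of `E`. -/
  frame : Fin 2 → Sec E U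
  isFrame : IsFrame frame

variable {α : A ⟶ homSheaf Q N} {β : B ⟶ homSheaf L N} {I J K : ∀ V : Opens X, Ideal (Fn 𝒪 V)}
  {U : Opens X}

/-- Restriction of local coordinates to a smaller open set. -/
noncomputable def LocalCoords.restrict (c : LocalCoords E α β I J K U) {U' : Opens X} (h : U' ≤ U) :
    LocalCoords E α β I J K U' where
  cL := c.cL.restrict h
  cQ := c.cQ.restrict h
  cN := c.cN.restrict h
  cA := c.cA.restrict h
  cB := c.cB.restrict h
  ap_α V W hV := c.ap_α V W (hV.trans h)
  ap_β V W hV := c.ap_β V W (hV.trans h)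
  frame j := res E h (c.frame j)
  isFrame := c.isFrame.restrict h

/-- Local coordinates adapted to `0 → L → E → Q → 0`: with `s` and `t` the coordinates of the images
of the frame `e₀, e₁` of `E` in `Q ≅ I`, the pair `(s, t)` is regular and generates `I`, and the
inclusion `L → E` is `1 ↦ u * (t • e₀ - s • e₁)` with a unit `u`, whose inverse is `v`. -/
structure AdaptedCoords (i : L ⟶ E) (q : E ⟶ Q) (α : A ⟶ homSheaf Q N) (β : B ⟶ homSheaf L N)
    (I J K : ∀ V : Opens X, Ideal (Fn 𝒪 V)) (U : Opens X) extends LocalCoords E α β I J K U where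
  /-- The frame of `L`. -/
  l : Sec L U
  ap_l : cL.ap le_rfl l = 1
  s : Fn 𝒪 U
  t : Fn 𝒪 U
  ap_s : cQ.ap le_rfl (onSec q U (frame 0)) = s
  ap_t : cQ.ap le_rfl (onSec q U (frame 1)) = t
  pair : IsRegularPair I s t
  u : Fn 𝒪 U
  v : Fn 𝒪 U
  unit : u * v = 1
  incl : onSec i U l = (u * t) • frame 0 - (u * s) • frame 1

/-- Adapted coordinates exist near every point: the kernel of `(s, t) : 𝒪² → I` is generated by the
image of `L`, and by the Koszul property also by the trivial syzygy; two generators of a free module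
of rank one differ by a unit. -/
lemma LocalCoords.exists_adapted (c : LocalCoords E α β I J K U) {x y : Fn 𝒪 U} (hx : x ∈ I U)
    (hy : y ∈ I U) (h : IsRegularPair I x y) {i : L ⟶ E} {q : E ⟶ Q} {hiq : i ≫ q = 0}
    (hex : (ShortComplex.mk i q hiq).ShortExact) {p : X} (hp : p ∈ U) :
    ∃ (W : Opens X) (_ : W ≤ U), p ∈ W ∧ Nonempty (AdaptedCoords i q α β I J K W) := by
  have : Mono i := hex.mono_f
  have : Epi q := hex.epi_g
  have hq : IsLocSurj q := isLocSurj_of_epi q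
  obtain ⟨l, hl⟩ := c.cL.exists_eq le_rfl (a := 1) trivial
  set s := c.cQ.ap le_rfl (onSec q U (c.frame 0)) with hs
  set t := c.cQ.ap le_rfl (onSec q U (c.frame 1)) with ht
  have hqf : ∀ (V : Opens X) (hV : V ≤ U) (a : Fin 2 → Fn 𝒪 V),
      c.cQ.ap hV (onSec q V (∑ j, a j • res E hV (c.frame j))) =
        a 0 * resFn (𝒪 := 𝒪) hV s + a 1 * resFn (𝒪 := 𝒪) hV t := by
    intro V hV a
    rw [Fin.sum_univ_two, map_add, map_add, map_smul, map_smul, map_smul, map_smul, onSec_res,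
      onSec_res, c.cQ.ap_res le_rfl hV, c.cQ.ap_res le_rfl hV, smul_eq_mul, smul_eq_mul]
  have hst : GeneratedBy I s t := by
    intro V hV a ha p hp
    obtain ⟨w, rfl⟩ := c.cQ.exists_eq hV ha
    obtain ⟨W, hW, hpW, m, hm⟩ := hq V w p hp
    obtain ⟨a, rfl⟩ := (c.isFrame W (hW.trans hV)).2 m
    refine ⟨W, hW, hpW, a 0, a 1, ?_⟩
    rw [← hqf W (hW.trans hV), ← c.cQ.ap_res hV hW, ← hm]
  have hpair := h.of_generatedBy hx hy (fun V hV a ha => c.cQ.res_mem le_rfl hV ha) hst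
  obtain ⟨fg, hfg⟩ := (c.isFrame U le_rfl).2 (onSec i U l)
  dsimp only at hfg
  have h0 : fg 0 * resFn (𝒪 := 𝒪) le_rfl s + fg 1 * resFn (𝒪 := 𝒪) le_rfl t = 0 := by
    rw [← hqf U le_rfl, hfg, ← onSec_comp, hiq, onSec_zero, map_zero]
  obtain ⟨W, hW, hpW, d, hd₁, hd₀⟩ := hpair.koszul U le_rfl (-fg 1) (fg 0)
    (by linear_combination -h0) p hp
  set s' := resFn (𝒪 := 𝒪) hW s
  set t' := resFn (𝒪 := 𝒪) hW t
  obtain ⟨l', hl'⟩ := exists_onSec_eq_of_exact hex.exact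
    (∑ j, (![t', -s'] : Fin 2 → Fn 𝒪 W) j • res E hW (c.frame j)) (c.cQ.inj hW (by
      rw [map_zero]
      refine (hqf W hW _).trans ?_
      simp only [Matrix.cons_val_zero, Matrix.cons_val_one]
      change t' * s' + -s' * t' = 0
      ring))
  replace hl' : onSec i W l' = _ := hl'
  have hl'' : l' = c.cL.ap hW l' • res L hW l :=
    c.cL.inj hW (by rw [map_smul, c.cL.ap_res le_rfl hW, hl, map_one, smul_eq_mul, mul_one])
  set k := c.cL.ap hW l'
  have hil : onSec i W (res L hW l) =
      ∑ j, (fun j => resFn (𝒪 := 𝒪) hW (fg j)) j • res E hW (c.frame j) := by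
    rw [onSec_res, ← hfg, map_sum]
    exact Finset.sum_congr rfl fun j _ => by rw [res_smul, res_res]
  have hk : (fun j => k * resFn (𝒪 := 𝒪) hW (fg j)) = (![t', -s'] : Fin 2 → Fn 𝒪 W) := by
    refine (c.isFrame W hW).1 ?_
    dsimp only
    rw [← hl', hl'', map_smul, hil, Finset.smul_sum]
    exact Finset.sum_congr rfl fun j _ => by rw [mul_smul]
  have hk0 : k * resFn (𝒪 := 𝒪) hW (fg 0) = t' := congr_fun hk 0
  have hk1 : k * resFn (𝒪 := 𝒪) hW (fg 1) = -s' := congr_fun hk 1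
  rw [map_neg] at hd₁
  refine ⟨W, hW, hpW, ⟨
    { c.restrict hW with
      l := res L hW l
      ap_l := by
        change c.cL.ap hW _ = 1
        rw [c.cL.ap_res le_rfl hW, hl, map_one]
      s := s'
      t := t'
      ap_s := by
        change c.cQ.ap hW (onSec q W (res E hW (c.frame 0))) = s'
        rw [onSec_res, c.cQ.ap_res le_rfl hW]
      ap_t := by
        change c.cQ.ap hW (onSec q W (res E hW (c.frame 1))) = t'
        rw [onSec_res, c.cQ.ap_res le_rfl hW]
      pair := hpair.restrict hW
      u := d
      v := k
      unit := ?_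
      incl := ?_ }⟩⟩
  · rw [← sub_eq_zero]
    refine hpair.reg W hW _ ?_ ?_
    · linear_combination -k * hd₁ - hk1
    · linear_combination -k * hd₀ + hk0
  · have : resFn (𝒪 := 𝒪) hW (fg 1) = -(d * s') := by rw [← hd₁, neg_neg]
    rw [hil, Fin.sum_univ_two]
    dsimp only
    rw [hd₀, this, neg_smul, sub_eq_add_neg]
    rfl

namespace AdaptedCoords
variable {i : L ⟶ E} {q : E ⟶ Q} (c : AdaptedCoords i q α β I J K U)
include c

lemma α_injective {a : Sec A U} (ha : onSec α U a = 0) : a = 0 := by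
  have h : ∀ w : Sec Q U, c.cA.ap le_rfl a * c.cQ.ap le_rfl w = 0 := fun w => by
    have := c.ap_α U U le_rfl le_rfl a w
    rw [ha, homEval_zero, map_zero, resFn_self] at this
    exact this.symm
  refine c.cA.inj le_rfl ?_
  rw [map_zero]
  refine c.pair.reg U le_rfl _ ?_ ?_
  · rw [resFn_self, ← c.ap_s, h]
  · rw [resFn_self, ← c.ap_t, h]

lemma β_injective {b : Sec B U} (hb : onSec β U b = 0) : b = 0 := by
  have h := c.ap_β U U le_rfl le_rfl b c.l
  rw [hb, homEval_zero, map_zero, resFn_self, c.ap_l, mul_one] at h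
  exact c.cB.inj le_rfl (by rw [map_zero, ← h])

/-- A homomorphism `I → J` is locally a multiplication. -/
lemma α_locSurj (φ : Sec (homSheaf Q N) U) {p : X} (hp : p ∈ U) :
    ∃ (W : Opens X) (hW : W ≤ U), p ∈ W ∧ ∃ a : Sec A W, onSec α W a = res _ hW φ := by
  set w₀ := onSec q U (c.frame 0)
  set w₁ := onSec q U (c.frame 1)
  have hw : c.t • w₀ = c.s • w₁ := c.cQ.inj le_rfl (by
    rw [map_smul, map_smul, c.ap_s, c.ap_t, smul_eq_mul, smul_eq_mul, mul_comm])
  have hφ := congr_arg (fun w => c.cN.ap le_rfl (homEval φ le_rfl w)) hw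
  simp only [map_smul, smul_eq_mul] at hφ
  obtain ⟨W, hW, hpW, d, h₀, h₁⟩ := c.pair.koszul U le_rfl
    (c.cN.ap le_rfl (homEval φ le_rfl w₀)) (c.cN.ap le_rfl (homEval φ le_rfl w₁))
    (by rw [resFn_self, resFn_self]; linear_combination hφ) p hp
  obtain ⟨a, ha⟩ := c.cA.exists_eq hW (a := d) trivial
  refine ⟨W, hW, hpW, a, homSheaf_ext fun V hV w => c.cN.inj (hV.trans hW) ?_⟩
  rw [c.ap_α W V hW hV, ha, homEval_res]
  refine fn_ext_of_forall_mem _ _ fun r hr => ?_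
  obtain ⟨V', hV', hrV', b₀, b₁, hb⟩ := c.pair.gen V (hV.trans hW) _ (c.cQ.mem _ w) r hr
  refine ⟨V', hV', hrV', ?_⟩
  have hVU : V' ≤ U := hV'.trans (hV.trans hW)
  have hw' : res Q hV' w = b₀ • res Q hVU w₀ + b₁ • res Q hVU w₁ := c.cQ.inj hVU (by
    rw [c.cQ.ap_res (hV.trans hW) hV', hb, map_add, map_smul, map_smul, c.cQ.ap_res le_rfl hVU,
      c.cQ.ap_res le_rfl hVU, c.ap_s, c.ap_t, smul_eq_mul, smul_eq_mul])
  have h₀' := congr_arg (resFn (𝒪 := 𝒪) (hV'.trans hV)) h₀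
  have h₁' := congr_arg (resFn (𝒪 := 𝒪) (hV'.trans hV)) h₁
  rw [map_mul, resFn_resFn, resFn_resFn, ← c.cN.ap_res le_rfl hVU, res_homEval] at h₀' h₁'
  rw [map_mul, hb, ← c.cN.ap_res (hV.trans hW) hV', res_homEval, hw', map_add, map_add, map_smul,
    map_smul, map_smul, map_smul, smul_eq_mul, smul_eq_mul, h₀', h₁', resFn_resFn]
  ring

lemma ap_homEval_incl (φ : Sec (homSheaf E N) U) :
    c.cN.ap le_rfl (homEval (onSec (precomp i N) U φ) le_rfl c.l) =
      c.u * c.t * c.cN.ap le_rfl (homEval φ le_rfl (c.frame 0)) -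
        c.u * c.s * c.cN.ap le_rfl (homEval φ le_rfl (c.frame 1)) := by
  rw [homEval_precomp, c.incl, map_sub, map_sub, map_smul, map_smul, map_smul, map_smul,
    smul_eq_mul, smul_eq_mul]

/-- The image of `i^*` is contained in the image of `β`, because the matrix entries of `i` lie in
the ideal `I`. -/
lemma exists_β_eq (hK : ∀ a ∈ I U, ∀ b ∈ J U, a * b ∈ K U) (φ : Sec (homSheaf E N) U) :
    ∃ b : Sec B U, onSec β U b = onSec (precomp i N) U φ := by
  have hs : c.s ∈ I U := c.ap_s ▸ c.cQ.mem _ _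
  have ht : c.t ∈ I U := c.ap_t ▸ c.cQ.mem _ _
  obtain ⟨b, hb⟩ := c.cB.exists_eq le_rfl (sub_mem
    (hK _ ((I U).mul_mem_left c.u ht) _ (c.cN.mem le_rfl (homEval φ le_rfl (c.frame 0))))
    (hK _ ((I U).mul_mem_left c.u hs) _ (c.cN.mem le_rfl (homEval φ le_rfl (c.frame 1)))))
  refine ⟨b, c.cL.hom_ext c.ap_l (c.cN.inj le_rfl ?_)⟩
  rw [c.ap_homEval_incl, c.ap_β U U le_rfl le_rfl, c.ap_l, mul_one, resFn_self, hb]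

/-- The image of `β` is locally contained in the image of `i^*`, because the matrix entries of `i`
generate the ideal `I`. -/
lemma exists_precomp_eq (hK : ∀ (V : Opens X), ∀ b ∈ K V, ∀ p ∈ V, ∃ (W : Opens X) (hW : W ≤ V),
      p ∈ W ∧ resFn (𝒪 := 𝒪) hW b ∈ I W * J W) (b : Sec B U) {p : X} (hp : p ∈ U) :
    ∃ (W : Opens X) (hW : W ≤ U), p ∈ W ∧ ∃ φ : Sec (homSheaf E N) W,
      onSec (precomp i N) W φ = onSec β W (res B hW b) := by
  obtain ⟨W₁, hW₁, hp₁, hb₁⟩ := hK U _ (c.cB.mem le_rfl b) p hp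
  have key : ∀ z ∈ I W₁ * J W₁, ∃ (W : Opens X) (hW : W ≤ W₁), p ∈ W ∧ ∃ h ∈ J W, ∃ k ∈ J W,
      resFn (𝒪 := 𝒪) hW z = h * resFn (𝒪 := 𝒪) (hW.trans hW₁) c.s +
        k * resFn (𝒪 := 𝒪) (hW.trans hW₁) c.t := by
    intro z hz
    induction hz using Submodule.mul_induction_on' with
    | mem_mul_mem a ha b hb =>
      obtain ⟨W, hW, hpW, h, k, hhk⟩ := c.pair.gen W₁ hW₁ a ha p hp₁
      have hbW := c.cN.res_mem hW₁ hW hb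
      refine ⟨W, hW, hpW, _, (J W).mul_mem_left h hbW, _, (J W).mul_mem_left k hbW, ?_⟩
      rw [map_mul, hhk]
      ring
    | add a ha b hb iha ihb =>
      obtain ⟨W, hW, hpW, h, hh, k, hk, e⟩ := iha
      obtain ⟨W', hW', hpW', h', hh', k', hk', e'⟩ := ihb
      refine ⟨W ⊓ W', inf_le_left.trans hW, ⟨hpW, hpW'⟩, _,
        add_mem (c.cN.res_mem (hW.trans hW₁) inf_le_left hh)
          (c.cN.res_mem (hW'.trans hW₁) inf_le_right hh'), _,
        add_mem (c.cN.res_mem (hW.trans hW₁) inf_le_left hk)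
          (c.cN.res_mem (hW'.trans hW₁) inf_le_right hk'), ?_⟩
      have e₁ := congr_arg (resFn (𝒪 := 𝒪) (inf_le_left : W ⊓ W' ≤ W)) e
      have e₂ := congr_arg (resFn (𝒪 := 𝒪) (inf_le_right : W ⊓ W' ≤ W')) e'
      simp only [map_add, map_mul, resFn_resFn] at e₁ e₂ ⊢
      rw [e₁, e₂]
      ring
  obtain ⟨W, hW, hpW, h, hh, k, hk, e⟩ := key _ hb₁
  have hWU := hW.trans hW₁
  rw [resFn_resFn] at e
  set v := resFn (𝒪 := 𝒪) hWU c.v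
  have huv : resFn (𝒪 := 𝒪) hWU c.u * v = 1 := by rw [← map_mul, c.unit, map_one]
  obtain ⟨n₀, hn₀⟩ := c.cN.exists_eq hWU ((J W).mul_mem_left v hk)
  obtain ⟨n₁, hn₁⟩ := c.cN.exists_eq hWU ((J W).mul_mem_left (-v) hh)
  obtain ⟨φ, hφ⟩ := (c.isFrame.restrict hWU).exists_hom ![n₀, n₁]
  have hφ₀ : homEval φ le_rfl (res E hWU (c.frame 0)) = n₀ := hφ 0
  have hφ₁ : homEval φ le_rfl (res E hWU (c.frame 1)) = n₁ := hφ 1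
  have hl : (c.cL.restrict hWU).ap le_rfl (res L hWU c.l) = 1 := by
    change c.cL.ap hWU _ = 1
    rw [c.cL.ap_res le_rfl hWU, c.ap_l, map_one]
  refine ⟨W, hWU, hpW, φ, (c.cL.restrict hWU).hom_ext hl (c.cN.inj hWU ?_)⟩
  rw [c.ap_β W W hWU le_rfl, c.cB.ap_res le_rfl hWU, e, c.cL.ap_res le_rfl hWU, c.ap_l, map_one,
    homEval_precomp, onSec_res, c.incl, map_sub, res_smul, res_smul, map_sub, map_sub, map_smul,
    map_smul, map_smul, map_smul, hφ₀, hφ₁, hn₀, hn₁, map_mul, map_mul, smul_eq_mul, smul_eq_mul,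
    map_add, map_mul, map_mul, resFn_self, resFn_self, resFn_self, resFn_self]
  linear_combination (h * resFn (𝒪 := 𝒪) hWU c.s + k * resFn (𝒪 := 𝒪) hWU c.t) * huv

/-- A homomorphism `E → N` that vanishes on `L` comes locally from `A`, by the Koszul property of
the entries of `q`. -/
lemma exists_α_precomp_eq (φ : Sec (homSheaf E N) U) (hφ : onSec (precomp i N) U φ = 0) {p : X}
    (hp : p ∈ U) : ∃ (W : Opens X) (hW : W ≤ U), p ∈ W ∧ ∃ a : Sec A W,
      onSec (precomp q N) W (onSec α W a) = res _ hW φ := by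
  have h := c.ap_homEval_incl φ
  rw [hφ, homEval_zero, map_zero] at h
  obtain ⟨W, hW, hpW, d, h₀, h₁⟩ := c.pair.koszul U le_rfl
    (c.cN.ap le_rfl (homEval φ le_rfl (c.frame 0))) (c.cN.ap le_rfl (homEval φ le_rfl (c.frame 1)))
    (by
      rw [resFn_self, resFn_self]
      linear_combination -c.v * h - (c.cN.ap le_rfl (homEval φ le_rfl (c.frame 0)) * c.t -
        c.cN.ap le_rfl (homEval φ le_rfl (c.frame 1)) * c.s) * c.unit) p hp
  obtain ⟨a, ha⟩ := c.cA.exists_eq hW (a := d) trivial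
  rw [← c.cN.ap_res le_rfl hW, res_homEval] at h₀ h₁
  refine ⟨W, hW, hpW, a, (c.isFrame.restrict hW).hom_ext fun j => c.cN.inj hW ?_⟩
  rw [homEval_precomp, homEval_res, c.ap_α W W hW le_rfl, ha, resFn_self, onSec_res,
    c.cQ.ap_res le_rfl hW]
  fin_cases j
  · change d * resFn (𝒪 := 𝒪) hW (c.cQ.ap le_rfl (onSec q U (c.frame 0))) = _
    rw [c.ap_s]
    exact h₀.symm
  · change d * resFn (𝒪 := 𝒪) hW (c.cQ.ap le_rfl (onSec q U (c.frame 1))) = _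
    rw [c.ap_t]
    exact h₁.symm

end AdaptedCoords

/-- The sequence `0 → A → Hom(E, N) → B → 0` obtained from an extension `0 → L → E → Q → 0`, where
`A ≅ Hom(Q, N)` and `B` is a subsheaf of `Hom(L, N)`: everything can be checked in local
coordinates. -/
theorem shortExact_homSheaf (α : A ⟶ homSheaf Q N) (β : B ⟶ homSheaf L N)
    {i : L ⟶ E} {q : E ⟶ Q} {hiq : i ≫ q = 0} (hex : (ShortComplex.mk i q hiq).ShortExact)
    (hK : ∀ (V : Opens X), ∀ a ∈ I V, ∀ b ∈ J V, a * b ∈ K V)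
    (hK' : ∀ (V : Opens X), ∀ b ∈ K V, ∀ p ∈ V, ∃ (W : Opens X) (hW : W ≤ V),
      p ∈ W ∧ resFn (𝒪 := 𝒪) hW b ∈ I W * J W)
    (hloc : ∀ p : X, ∃ U : Opens X, p ∈ U ∧ Nonempty (LocalCoords E α β I J K U) ∧
      ∃ x ∈ I U, ∃ y ∈ I U, IsRegularPair I x y) :
    IsIso α ∧ Mono β ∧ ∃ (g : homSheaf E N ⟶ B) (w : (α ≫ precomp q N) ≫ g = 0),
      g ≫ β = precomp i N ∧ (ShortComplex.mk (α ≫ precomp q N) g w).ShortExact := by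
  have : Mono i := hex.mono_f
  have : Epi q := hex.epi_g
  have hq : IsLocSurj q := isLocSurj_of_epi q
  have hloc' : ∀ (V : Opens X), ∀ p ∈ V, ∃ (W : Opens X) (_ : W ≤ V), p ∈ W ∧
      Nonempty (AdaptedCoords i q α β I J K W) := by
    intro V p hp
    obtain ⟨U, hpU, ⟨c⟩, x, hx, y, hy, h⟩ := hloc p
    obtain ⟨W, hW, hpW, hc⟩ := (c.restrict (inf_le_left : U ⊓ V ≤ U)).exists_adapted
      (c.cQ.res_mem le_rfl inf_le_left hx) (c.cQ.res_mem le_rfl inf_le_left hy)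
      (h.restrict inf_le_left) hex (p := p) ⟨hpU, hp⟩
    exact ⟨W, hW.trans inf_le_right, hpW, hc⟩
  have hα : ∀ U, Function.Injective (onSec α U) := fun U =>
    (injective_iff_map_eq_zero _).2 fun a ha => sec_ext_of_forall_mem _ _ _ fun p hp => by
      obtain ⟨W, hW, hpW, ⟨c⟩⟩ := hloc' U p hp
      exact ⟨W, hW, hpW, by rw [map_zero]; exact c.α_injective (by rw [onSec_res, ha, map_zero])⟩
  have hβ : ∀ U, Function.Injective (onSec β U) := fun U =>
    (injective_iff_map_eq_zero _).2 fun a ha => sec_ext_of_forall_mem _ _ _ fun p hp => by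
      obtain ⟨W, hW, hpW, ⟨c⟩⟩ := hloc' U p hp
      exact ⟨W, hW, hpW, by rw [map_zero]; exact c.β_injective (by rw [onSec_res, ha, map_zero])⟩
  have hα' : IsLocSurj α := fun U φ p hp => by
    obtain ⟨W, hW, hpW, ⟨c⟩⟩ := hloc' U p hp
    obtain ⟨W', hW', hpW', a, ha⟩ := c.α_locSurj (res _ hW φ) hpW
    exact ⟨W', hW'.trans hW, hpW', a, by rw [ha, res_res]⟩
  have hβm := mono_of_onSec_injective β hβ
  obtain ⟨g, hg⟩ := exists_lift β hβ (precomp i N) fun U φ p hp => by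
    obtain ⟨W, hW, hpW, ⟨c⟩⟩ := hloc' U p hp
    obtain ⟨b, hb⟩ := c.exists_β_eq (hK W) (res _ hW φ)
    exact ⟨W, hW, hpW, b, by rw [hb, onSec_res]⟩
  have hg' : ∀ (U : Opens X) (φ : Sec (homSheaf E N) U),
      onSec β U (onSec g U φ) = onSec (precomp i N) U φ := fun U φ => by rw [← onSec_comp, hg]
  have w : (α ≫ precomp q N) ≫ g = 0 := by
    rw [← cancel_mono β, Category.assoc, hg, Limits.zero_comp]
    refine hom_ext_onSec fun U a => homSheaf_ext fun V hV l => ?_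
    change homEval (onSec α U a) hV (onSec (i ≫ q) V l) = 0
    rw [hiq, onSec_zero, map_zero]
  refine ⟨isIso_of_bijective_locally α hα hα', hβm, g, w, hg, shortExact_of_onSec _ _ _ ?_ ?_ ?_⟩
  · exact fun U => (hq.precomp_injective N U).comp (hα U)
  · intro U b p hp
    obtain ⟨W, hW, hpW, ⟨c⟩⟩ := hloc' U p hp
    obtain ⟨W', hW', hpW', φ, hφ⟩ := c.exists_precomp_eq hK' (res _ hW b) hpW
    exact ⟨W', hW'.trans hW, hpW', φ, hβ _ (by rw [hg', hφ, res_res])⟩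
  · intro U φ hφ p hp
    obtain ⟨W, hW, hpW, ⟨c⟩⟩ := hloc' U p hp
    obtain ⟨W', hW', hpW', a, ha⟩ := c.exists_α_precomp_eq (res _ hW φ)
      (by rw [onSec_res, ← hg', hφ, map_zero, map_zero]) hpW
    exact ⟨W', hW'.trans hW, hpW', a, by rw [onSec_comp, ha, res_res]⟩

end Local
end SheafMod

namespace CplxSurface

/-! ### Division of holomorphic functions -/

section Hadamard
variable {E : Type} [NormedAddCommGroup E] [NormedSpace ℂ E] [FiniteDimensional ℂ E]

/-- Differentiation under the integral sign, for an integrand that is smooth in the parameter and in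
a complex neighbourhood of the interval of integration. -/
lemma hasFDerivAt_intervalIntegral_of_contDiffOn {F : Type} [NormedAddCommGroup F] [NormedSpace ℂ F]
    [CompleteSpace F] {s : Set E} {T : Set ℂ} (hs : IsOpen s) (hT : IsOpen T)
    (hIT : ∀ t ∈ Set.Icc (0 : ℝ) 1, (t : ℂ) ∈ T) {H : E × ℂ → F}
    (hH : ContDiffOn ℂ ∞ H (s ×ˢ T)) {x₀ : E} (hx₀ : x₀ ∈ s) :
    HasFDerivAt (fun x => ∫ t in (0 : ℝ)..1, H (x, (t : ℂ)))
      (∫ t in (0 : ℝ)..1, (fderiv ℂ H (x₀, (t : ℂ))).comp (ContinuousLinearMap.inl ℂ E ℂ)) x₀ := by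
  have hO : IsOpen (s ×ˢ T) := hs.prod hT
  have hcont : ∀ {G : Type} [NormedAddCommGroup G] {K : E × ℂ → G}, ContinuousOn K (s ×ˢ T) →
      ∀ x ∈ s, ContinuousOn (fun t : ℝ => K (x, (t : ℂ))) (Set.uIcc 0 1) := by
    intro G _ K hK x hx
    refine hK.comp (Continuous.continuousOn (by fun_prop)) fun t ht => ⟨hx, hIT t ?_⟩
    rwa [Set.uIcc_of_le zero_le_one] at ht
  have hmeas : ∀ {G : Type} [NormedAddCommGroup G] {K : E × ℂ → G}, ContinuousOn K (s ×ˢ T) →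
      ∀ x ∈ s, MeasureTheory.AEStronglyMeasurable (fun t : ℝ => K (x, (t : ℂ)))
        (MeasureTheory.volume.restrict (Set.uIoc 0 1)) := by
    intro G _ K hK x hx
    exact (((hcont hK x hx).intervalIntegrable).def').aestronglyMeasurable
  have hd : ContinuousOn (fun z => (fderiv ℂ H z).comp (ContinuousLinearMap.inl ℂ E ℂ))
      (s ×ˢ T) := by
    have := hH.continuousOn_fderiv_of_isOpen hO (by simp)
    fun_prop
  have : ProperSpace E := FiniteDimensional.proper ℂ E
  obtain ⟨ε, hε, hεs⟩ := Metric.nhds_basis_closedBall.mem_iff.1 (hs.mem_nhds hx₀)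
  have hK : IsCompact (Metric.closedBall x₀ ε ×ˢ ((↑) '' Set.Icc (0 : ℝ) 1 : Set ℂ)) :=
    (isCompact_closedBall x₀ ε).prod (isCompact_Icc.image Complex.continuous_ofReal)
  obtain ⟨C, hC⟩ := hK.exists_bound_of_continuousOn (hd.mono (Set.prod_mono hεs (by
    rintro _ ⟨t, ht, rfl⟩; exact hIT t ht)))
  refine intervalIntegral.hasFDerivAt_integral_of_dominated_of_fderiv_le
    (F' := fun x t => (fderiv ℂ H (x, (t : ℂ))).comp (ContinuousLinearMap.inl ℂ E ℂ))
    (bound := fun _ => C) (Metric.closedBall_mem_nhds x₀ hε) ?_ ?_ ?_ ?_ ?_ ?_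
  · filter_upwards [hs.mem_nhds hx₀] with x hx
    exact hmeas hH.continuousOn x hx
  · exact (hcont hH.continuousOn x₀ hx₀).intervalIntegrable
  · exact hmeas hd x₀ hx₀
  · refine Filter.Eventually.of_forall fun t ht x hx => hC (x, (t : ℂ)) ⟨hx, t, ?_, rfl⟩
    rw [Set.uIoc_of_le zero_le_one] at ht
    exact ⟨ht.1.le, ht.2⟩
  · exact intervalIntegrable_const
  · refine Filter.Eventually.of_forall fun t ht x hx => ?_
    rw [Set.uIoc_of_le zero_le_one] at ht
    have hmem : (x, (t : ℂ)) ∈ s ×ˢ T := ⟨hεs hx, hIT t ⟨ht.1.le, ht.2⟩⟩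
    have h1 : HasFDerivAt H (fderiv ℂ H (x, (t : ℂ))) (x, (t : ℂ)) :=
      ((hH.contDiffAt (hO.mem_nhds hmem)).differentiableAt (by simp)).hasFDerivAt
    exact h1.comp x (hasFDerivAt_prodMk_left x (t : ℂ))

lemma contDiffOn_intervalIntegral {F : Type} [NormedAddCommGroup F] [NormedSpace ℂ F]
    [CompleteSpace F] {s : Set E} {T : Set ℂ} (hs : IsOpen s) (hT : IsOpen T)
    (hIT : ∀ t ∈ Set.Icc (0 : ℝ) 1, (t : ℂ) ∈ T) {H : E × ℂ → F}
    (hH : ContDiffOn ℂ ∞ H (s ×ˢ T)) :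
    ContDiffOn ℂ ∞ (fun x => ∫ t in (0 : ℝ)..1, H (x, (t : ℂ))) s := by
  refine contDiffOn_infty.2 fun n => ?_
  induction n generalizing F with
  | zero =>
    refine contDiffOn_zero.2 fun x hx => ?_
    exact (hasFDerivAt_intervalIntegral_of_contDiffOn hs hT hIT hH
      hx).continuousAt.continuousWithinAt
  | succ n ih =>
    have hd : ContDiffOn ℂ ∞ (fun z => (fderiv ℂ H z).comp (ContinuousLinearMap.inl ℂ E ℂ))
        (s ×ˢ T) :=
      ((contDiffOn_infty_iff_fderiv_of_isOpen (hs.prod hT)).1 hH).2.clm_comp contDiffOn_const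
    rw [Nat.cast_succ, contDiffOn_succ_iff_fderiv_of_isOpen hs]
    refine ⟨fun x hx => (hasFDerivAt_intervalIntegral_of_contDiffOn hs hT hIT hH
      hx).differentiableAt.differentiableWithinAt, by simp, (ih hd).congr fun x hx =>
      (hasFDerivAt_intervalIntegral_of_contDiffOn hs hT hIT hH hx).fderiv⟩

/-- Hadamard's lemma: the difference of the values of a holomorphic function at `z` and at its
linear projection `P z` is a linear form in `z - P z` with holomorphic coefficients. -/
lemma exists_hadamard {f : E → ℂ} {V : Set E} (hV : IsOpen V) (h0 : (0 : E) ∈ V)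
    (hf : ContDiffOn ℂ ∞ f V) (P : E →L[ℂ] E) :
    ∃ W : Set E, IsOpen W ∧ (0 : E) ∈ W ∧ W ⊆ V ∧ (∀ z ∈ W, P z ∈ V) ∧ ∃ Γ : E → (E →L[ℂ] ℂ),
      ContDiffOn ℂ ∞ Γ W ∧ ∀ z ∈ W, f z = f (P z) + Γ z (z - P z) := by
  obtain ⟨r, hr, hrV⟩ := Metric.isOpen_iff.1 hV 0 h0
  set M := 3 * ‖P‖ + 3
  have hM : 0 < M := by positivity
  have hb : ∀ z ∈ Metric.ball (0 : E) (r / M), ∀ t ∈ Metric.ball (0 : ℂ) 2,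
      P z + t • (z - P z) ∈ V := by
    intro z hz t ht
    apply hrV
    rw [mem_ball_zero_iff] at hz ht ⊢
    rw [lt_div_iff₀ hM] at hz
    have h1 : ‖P z‖ ≤ ‖P‖ * ‖z‖ := P.le_opNorm z
    have h2 : ‖t • (z - P z)‖ ≤ 2 * (‖z‖ + ‖P z‖) := by
      rw [norm_smul]
      exact mul_le_mul ht.le (norm_sub_le _ _) (norm_nonneg _) zero_le_two
    have h3 := norm_add_le (P z) (t • (z - P z))
    have h4 : ‖z‖ * M = 3 * (‖P‖ * ‖z‖) + 3 * ‖z‖ := by ring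
    linarith [norm_nonneg z]
  have hfd : ContDiffOn ℂ ∞ (fderiv ℂ f) V := ((contDiffOn_infty_iff_fderiv_of_isOpen hV).1 hf).2
  have hH : ContDiffOn ℂ ∞ (fun w : E × ℂ => fderiv ℂ f (P w.1 + w.2 • (w.1 - P w.1)))
      (Metric.ball (0 : E) (r / M) ×ˢ Metric.ball (0 : ℂ) 2) :=
    hfd.comp (ContDiff.contDiffOn (by fun_prop)) fun w hw => hb w.1 hw.1 w.2 hw.2
  have hIT : ∀ t ∈ Set.Icc (0 : ℝ) 1, (t : ℂ) ∈ Metric.ball (0 : ℂ) 2 := by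
    intro t ht
    rw [mem_ball_zero_iff, Complex.norm_real, Real.norm_of_nonneg ht.1]
    linarith [ht.2]
  refine ⟨Metric.ball 0 (r / M), Metric.isOpen_ball, Metric.mem_ball_self (by positivity), ?_, ?_,
    _, contDiffOn_intervalIntegral Metric.isOpen_ball Metric.isOpen_ball hIT hH, ?_⟩
  · intro z hz
    simpa using hb z hz 1 (by simp)
  · intro z hz
    simpa using hb z hz 0 (by simp)
  · intro z hz
    have hmem : ∀ t ∈ Set.uIcc (0 : ℝ) 1, P z + (t : ℂ) • (z - P z) ∈ V := fun t ht =>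
      hb z hz t (hIT t (by rwa [Set.uIcc_of_le zero_le_one] at ht))
    have hc : ContinuousOn (fun t : ℝ => fderiv ℂ f (P z + (t : ℂ) • (z - P z)))
        (Set.uIcc 0 1) :=
      hfd.continuousOn.comp (Continuous.continuousOn (by fun_prop)) hmem
    have hderiv : ∀ t ∈ Set.uIcc (0 : ℝ) 1, HasDerivAt (fun t : ℝ => f (P z + (t : ℂ) • (z - P z)))
        (fderiv ℂ f (P z + (t : ℂ) • (z - P z)) (z - P z)) t := by
      intro t ht
      have h1 : HasFDerivAt f (fderiv ℂ f (P z + (t : ℂ) • (z - P z)))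
          (P z + (t : ℂ) • (z - P z)) :=
        ((hf.contDiffAt (hV.mem_nhds (hmem t ht))).differentiableAt (by simp)).hasFDerivAt
      have h2 : HasDerivAt (fun s : ℂ => P z + s • (z - P z)) (z - P z) (t : ℂ) := by
        simpa using ((hasDerivAt_id (t : ℂ)).smul_const (z - P z)).const_add (P z)
      exact (h1.comp_hasDerivAt (t : ℂ) h2).comp_ofReal
    have hint := intervalIntegral.integral_eq_sub_of_hasDerivAt hderiv
      (hc.clm_apply continuousOn_const).intervalIntegrable
    rw [← ContinuousLinearMap.intervalIntegral_apply hc.intervalIntegrable] at hint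
    rw [hint]
    simp

end Hadamard

/-! ### Generators of the ideal of a finite set of points -/

section Points
variable {S : Type u} [TopologicalSpace S] [ChartedSpace C2 S]

/-- The section defined by a function that is holomorphic on an open set. -/
def secOf {U : Opens S} (g : S → ℂ) (hg : ContMDiffOn 𝓘(ℂ, C2) 𝓘(ℂ) ∞ g U) :
    Fn (X := TopCat.of S) (holSheaf S) U :=
  ⟨fun x => g x, fun x => contMDiffAt_subtype_iff.2
    (hg.contMDiffAt (U.isOpen.mem_nhds x.2))⟩

lemma exists_secOf_eq {U : Opens S} (f : Fn (X := TopCat.of S) (holSheaf S) U) :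
    ∃ (g : S → ℂ) (hg : ContMDiffOn 𝓘(ℂ, C2) 𝓘(ℂ) ∞ g U), secOf g hg = f := by
  classical
  let g : S → ℂ := fun x => if h : x ∈ U then f.1 ⟨x, h⟩ else 0
  have hgf : (fun x : U => g x) = f.1 := funext fun x => dif_pos x.2
  refine ⟨g, fun x hx => ?_, Subtype.ext hgf⟩
  refine (contMDiffAt_subtype_iff (x := ⟨x, hx⟩).1 ?_).contMDiffWithinAt
  rw [hgf]
  exact f.2 _

lemma secOf_congr {U : Opens S} {g g' : S → ℂ} {hg : ContMDiffOn 𝓘(ℂ, C2) 𝓘(ℂ) ∞ g U}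
    {hg' : ContMDiffOn 𝓘(ℂ, C2) 𝓘(ℂ) ∞ g' U} :
    secOf g hg = secOf g' hg' ↔ ∀ z ∈ U, g z = g' z :=
  ⟨fun h z hz => congr($(congr_arg Subtype.val h) ⟨z, hz⟩), fun h =>
    Subtype.ext (funext fun z => h z.1 z.2)⟩

lemma secOf_mul {U : Opens S} {g g' : S → ℂ} (hg : ContMDiffOn 𝓘(ℂ, C2) 𝓘(ℂ) ∞ g U)
    (hg' : ContMDiffOn 𝓘(ℂ, C2) 𝓘(ℂ) ∞ g' U) :
    secOf g hg * secOf g' hg' = secOf (fun z => g z * g' z) (hg.mul hg') := rfl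

lemma secOf_add {U : Opens S} {g g' : S → ℂ} (hg : ContMDiffOn 𝓘(ℂ, C2) 𝓘(ℂ) ∞ g U)
    (hg' : ContMDiffOn 𝓘(ℂ, C2) 𝓘(ℂ) ∞ g' U) :
    secOf g hg + secOf g' hg' = secOf (fun z => g z + g' z) (hg.add hg') := rfl

lemma secOf_zero {U : Opens S} :
    (0 : Fn (X := TopCat.of S) (holSheaf S) U) = secOf (fun _ => 0) contMDiffOn_const := rfl

lemma resFn_secOf {U V : Opens S} (h : V ≤ U) {g : S → ℂ}
    (hg : ContMDiffOn 𝓘(ℂ, C2) 𝓘(ℂ) ∞ g U) :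
    resFn (X := TopCat.of S) (𝒪 := holSheaf S) h (secOf g hg) = secOf g (hg.mono h) := rfl

/-- The sections over `U` of the power `I_Z ^ n` of the ideal sheaf of the holomorphic functions
vanishing on `Z`, as an ideal. -/
noncomputable abbrev ptIdeal (Z : Set S) (n : ℕ) (U : Opens (TopCat.of S)) :
    Ideal (Fn (X := TopCat.of S) (holSheaf S) U) :=
  localIdeal (fun U => vanishingIdeal Z U ^ n) (vanishingIdeal_res Z n) U

lemma secOf_mem_iff (Z : Set S) {U : Opens S} {g : S → ℂ}
    (hg : ContMDiffOn 𝓘(ℂ, C2) 𝓘(ℂ) ∞ g U) :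
    secOf g hg ∈ ptIdeal Z 1 U ↔ ∀ z ∈ U, z ∈ Z → g z = 0 := by
  refine (mem_localIdeal_one_iff Z U _).trans ?_
  exact ⟨fun h z hz hZ => h ⟨z, hz⟩ hZ, fun h z hZ => h z z.2 hZ⟩

/-- The pair `(1, 0)` is regular. It consists of sections of `I_Z` away from `Z`, where `I_Z` is the
unit ideal. -/
lemma isRegularPair_one_zero (Z : Set S) (U : Opens (TopCat.of S)) :
    IsRegularPair (𝒪 := holSheaf S) (U := U) (ptIdeal Z 1) 1 0 where
  gen V hV a _ p hp := ⟨V, le_rfl, hp, a, 0, by rw [resFn_self]; simp⟩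
  koszul V hV a b h p hp := ⟨V, le_rfl, hp, a, by rw [resFn_self]; simp, by
    rw [map_zero, mul_zero, map_one, mul_one] at h
    rw [← h, map_zero, map_zero, mul_zero]⟩
  reg V hV c h _ := by rwa [map_one, mul_one] at h

/-- The chart at `p`, centred at `p`. -/
noncomputable def centredChart (p z : S) : C2 := chartAt C2 p z - chartAt C2 p p

lemma centredChart_self (p : S) : centredChart p p = 0 := sub_self _

lemma centredChart_add (p z : S) : centredChart p z + chartAt C2 p p = chartAt C2 p z :=
  sub_add_cancel _ _

lemma centredChart_eq_zero {p z : S} (hz : z ∈ (chartAt C2 p).source)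
    (h : centredChart p z = 0) : z = p :=
  (chartAt C2 p).injOn hz (mem_chart_source C2 p) (sub_eq_zero.1 h)

/-- The coordinates on the surface are not zero divisors: their zero sets have empty interior. -/
lemma eq_zero_of_centredChart_mul (p : S) (j : Fin 2) {W : Set S} (hW : IsOpen W)
    (hWs : W ⊆ (chartAt C2 p).source) {h : S → ℂ} (hc : ContinuousOn h W)
    (h0 : ∀ z ∈ W, centredChart p z j * h z = 0) : ∀ z ∈ W, h z = 0 := by
  intro z hz
  by_contra hne
  let N := W ∩ h ⁻¹' {0}ᶜ
  have hN : IsOpen N := hc.isOpen_inter_preimage hW isOpen_compl_singleton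
  have hNφ : IsOpen (chartAt C2 p '' N) :=
    (chartAt C2 p).isOpen_image_of_subset_source hN (Set.inter_subset_left.trans hWs)
  have hγ : Filter.Tendsto (fun t : ℂ => chartAt C2 p z + t • EuclideanSpace.single j (1 : ℂ))
      (nhds 0) (nhds (chartAt C2 p z)) := by
    have : Continuous (fun t : ℂ => chartAt C2 p z + t • EuclideanSpace.single j (1 : ℂ)) := by
      fun_prop
    simpa using this.tendsto 0
  have hev : ∀ᶠ t : ℂ in nhds 0, centredChart p z j + t = 0 := by
    filter_upwards [hγ (hNφ.mem_nhds ⟨z, ⟨hz, hne⟩, rfl⟩)] with t ht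
    obtain ⟨z', hz', e⟩ := ht
    have h1 := (mul_eq_zero.1 (h0 z' hz'.1)).resolve_right hz'.2
    rw [centredChart, e] at h1
    simp only [centredChart, PiLp.sub_apply, PiLp.add_apply, PiLp.smul_apply, smul_eq_mul,
      PiLp.single_apply, if_true, mul_one] at h1 ⊢
    linear_combination h1
  have hz0 := hev.self_of_nhds
  obtain ⟨t, ht, ht0⟩ := ((hev.filter_mono nhdsWithin_le_nhds).and
    (self_mem_nhdsWithin : {(0 : ℂ)}ᶜ ∈ nhdsWithin 0 {0}ᶜ)).exists
  exact ht0 (Set.mem_singleton_iff.2 (by linear_combination ht - hz0))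

variable [IsManifold 𝓘(ℂ, C2) ω S]

lemma contMDiffOn_centredChart (p : S) :
    ContMDiffOn 𝓘(ℂ, C2) 𝓘(ℂ, C2) ∞ (centredChart p) (chartAt C2 p).source :=
  contMDiffOn_chart.sub contMDiffOn_const

lemma contMDiffOn_centredChart_apply (p : S) (j : Fin 2) :
    ContMDiffOn 𝓘(ℂ, C2) 𝓘(ℂ) ∞ (fun z => centredChart p z j) (chartAt C2 p).source :=
  (EuclideanSpace.proj (𝕜 := ℂ) j : C2 →L[ℂ] ℂ).contMDiff.comp_contMDiffOn
    (contMDiffOn_centredChart p)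

/-- Hadamard's lemma on a surface, in the chart centred at `p`. -/
lemma exists_hadamard_chart (p : S) {f : S → ℂ} {V : Set S} (hV : IsOpen V) (hp : p ∈ V)
    (hf : ContMDiffOn 𝓘(ℂ, C2) 𝓘(ℂ) ∞ f V) (P : C2 →L[ℂ] C2) :
    ∃ W : Opens S, p ∈ W ∧ (W : Set S) ⊆ V ∧ (W : Set S) ⊆ (chartAt C2 p).source ∧
      ∃ a b : S → ℂ, ContMDiffOn 𝓘(ℂ, C2) 𝓘(ℂ) ∞ a W ∧ ContMDiffOn 𝓘(ℂ, C2) 𝓘(ℂ) ∞ b W ∧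
        ∀ z ∈ W, ∃ z' ∈ V, z' ∈ (chartAt C2 p).source ∧
          centredChart p z' = P (centredChart p z) ∧
          f z = f z' + a z * (centredChart p z - P (centredChart p z)) 0 +
            b z * (centredChart p z - P (centredChart p z)) 1 := by
  set φ := chartAt C2 p
  have hshift : Continuous fun w : C2 => w + φ p := by fun_prop
  set V' : Set C2 := (fun w => w + φ p) ⁻¹' (φ.target ∩ φ.symm ⁻¹' V)
  have hV' : IsOpen V' := (φ.isOpen_inter_preimage_symm hV).preimage hshift
  have h0 : (0 : C2) ∈ V' := by
    have : φ.symm (φ p) = p := φ.left_inv (mem_chart_source C2 p)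
    simp only [V', Set.mem_preimage, zero_add, Set.mem_inter_iff, this]
    exact ⟨mem_chart_target C2 p, hp⟩
  have hF : ContDiffOn ℂ ∞ (fun w => f (φ.symm (w + φ p))) V' := by
    rw [← contMDiffOn_iff_contDiffOn]
    refine hf.comp (t := V) ?_ fun w hw => hw.2
    refine (contMDiffOn_chart_symm (x := p)).comp (t := φ.target) ?_ fun w hw => hw.1
    exact (contMDiff_id.add contMDiff_const).contMDiffOn
  obtain ⟨W', hW', h0W, hWV, hPW, Γ, hΓ, h⟩ := exists_hadamard hV' h0 hF P
  have hc : ContinuousOn (centredChart p) φ.source := φ.continuousOn.sub continuousOn_const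
  refine ⟨⟨φ.source ∩ centredChart p ⁻¹' W', hc.isOpen_inter_preimage φ.open_source hW'⟩,
    ⟨mem_chart_source C2 p, ?_⟩, ?_, Set.inter_subset_left,
    fun z => Γ (centredChart p z) (EuclideanSpace.single 0 1),
    fun z => Γ (centredChart p z) (EuclideanSpace.single 1 1), ?_, ?_, ?_⟩
  · simpa [centredChart_self] using h0W
  · intro z hz
    have : φ.symm (centredChart p z + φ p) ∈ V := (hWV hz.2).2
    rwa [centredChart_add, φ.left_inv hz.1] at this
  · exact (hΓ.clm_apply contDiffOn_const).contMDiffOn.comp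
      ((contMDiffOn_centredChart p).mono Set.inter_subset_left) fun z hz => hz.2
  · exact (hΓ.clm_apply contDiffOn_const).contMDiffOn.comp
      ((contMDiffOn_centredChart p).mono Set.inter_subset_left) fun z hz => hz.2
  · intro z hz
    have hP := hPW _ hz.2
    refine ⟨φ.symm (P (centredChart p z) + φ p), hP.2, φ.map_target hP.1, ?_, ?_⟩
    · change φ (φ.symm _) - φ p = _
      rw [φ.right_inv hP.1, add_sub_cancel_right]
    · have := h _ hz.2
      have hz' : φ.symm (centredChart p z + φ p) = z := by
        rw [centredChart_add, φ.left_inv hz.1]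
      rw [hz'] at this
      have hw : ∀ w : C2, w = w 0 • EuclideanSpace.single 0 (1 : ℂ) +
          w 1 • EuclideanSpace.single 1 (1 : ℂ) := by
        intro w
        ext k
        fin_cases k <;> simp
      rw [this]
      conv_lhs => rw [hw (centredChart p z - P (centredChart p z))]
      rw [map_add, map_smul, map_smul, smul_eq_mul, smul_eq_mul]
      ring

/-- Near a point `p` of `Z`, the coordinates centred at `p` form a regular pair of generators of
`I_Z`: they are sections of it where `p` is the only point of `Z`. At `p` the proof is Hadamard's
lemma, applied to the projections onto the origin and onto the line where the first coordinate is
zero; at any other point one of the coordinates is invertible. -/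
lemma isRegularPair_centredChart (Z : Set S) {p : S} (hpZ : p ∈ Z) {U : Opens S}
    (hU : (U : Set S) ⊆ (chartAt C2 p).source) :
    IsRegularPair (X := TopCat.of S) (𝒪 := holSheaf S) (U := U) (ptIdeal Z 1)
      (secOf (U := U) _ ((contMDiffOn_centredChart_apply p 0).mono hU))
      (secOf (U := U) _ ((contMDiffOn_centredChart_apply p 1).mono hU)) := by
  have hinv : ∀ (V : Opens S), V ≤ U → ∀ q ∈ V, q ≠ p → ∃ j, ∃ (W : Opens S), W ≤ V ∧ q ∈ W ∧
      (∀ z ∈ W, centredChart p z j ≠ 0) ∧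
        ContMDiffOn 𝓘(ℂ, C2) 𝓘(ℂ) ∞ (fun z => (centredChart p z j)⁻¹) W := by
    intro V hV q hq hqp
    obtain ⟨j, hj⟩ : ∃ j, centredChart p q j ≠ 0 := by
      by_contra! h
      exact hqp (centredChart_eq_zero (hU (hV hq)) (PiLp.ext h))
    have hc := (contMDiffOn_centredChart_apply (S := S) p j).mono
      ((SetLike.coe_subset_coe.2 hV).trans hU)
    refine ⟨j, ⟨V ∩ (fun z => centredChart p z j) ⁻¹' {0}ᶜ,
      hc.continuousOn.isOpen_inter_preimage V.isOpen isOpen_compl_singleton⟩,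
      Set.inter_subset_left, ⟨hq, hj⟩, fun z hz => hz.2, ?_⟩
    exact (hc.mono Set.inter_subset_left).inv₀ fun z hz => hz.2
  have hnzd : ∀ (j : Fin 2) (V : Opens S), V ≤ U → ∀ g : S → ℂ,
      ContMDiffOn 𝓘(ℂ, C2) 𝓘(ℂ) ∞ g V → (∀ z ∈ V, centredChart p z j * g z = 0) →
        ∀ z ∈ V, g z = 0 := fun j V hV g hg h =>
    eq_zero_of_centredChart_mul p j V.isOpen ((SetLike.coe_subset_coe.2 hV).trans hU)
      hg.continuousOn h
  constructor
  · intro V hV a ha q hq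
    obtain ⟨f, hf, rfl⟩ := exists_secOf_eq (S := S) (U := V) a
    rw [secOf_mem_iff] at ha
    by_cases hqp : q = p
    · subst hqp
      obtain ⟨W, hqW, hWV, hWs, b, c, hb, hc, h⟩ := exists_hadamard_chart q V.isOpen hq hf 0
      have hWV' : W ≤ V := hWV
      refine ⟨W, hWV', hqW, secOf (U := W) b hb, secOf (U := W) c hc, ?_⟩
      rw [resFn_secOf, resFn_secOf, resFn_secOf, secOf_mul, secOf_mul, secOf_add, secOf_congr]
      intro z hz
      obtain ⟨z', hz'V, hz's, hz'0, e⟩ := h z hz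
      rw [zero_apply] at hz'0 e
      rw [centredChart_eq_zero hz's hz'0, ha q hq hpZ, sub_zero, zero_add] at e
      exact e
    · obtain ⟨j, W, hW, hqW, hne, hi⟩ := hinv V hV q hq hqp
      have hfi := (hf.mono hW).mul hi
      fin_cases j
      · refine ⟨W, hW, hqW, secOf (U := W) _ hfi, 0, ?_⟩
        rw [zero_mul, add_zero, resFn_secOf, resFn_secOf, secOf_mul, secOf_congr]
        exact fun z hz => (inv_mul_cancel_right₀ (hne z hz) (f z)).symm
      · refine ⟨W, hW, hqW, 0, secOf (U := W) _ hfi, ?_⟩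
        rw [zero_mul, zero_add, resFn_secOf, resFn_secOf, secOf_mul, secOf_congr]
        exact fun z hz => (inv_mul_cancel_right₀ (hne z hz) (f z)).symm
  · intro V hV a b hab q hq
    obtain ⟨f, hf, rfl⟩ := exists_secOf_eq (S := S) (U := V) a
    obtain ⟨g, hg, rfl⟩ := exists_secOf_eq (S := S) (U := V) b
    rw [resFn_secOf, resFn_secOf, secOf_mul, secOf_mul, secOf_congr] at hab
    have hcoord : ∀ (j : Fin 2) (W : Opens S), W ≤ V →
        ContMDiffOn 𝓘(ℂ, C2) 𝓘(ℂ) ∞ (fun z => centredChart p z j) W := fun j W hW =>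
      (contMDiffOn_centredChart_apply p j).mono ((SetLike.coe_subset_coe.2 (hW.trans hV)).trans hU)
    suffices h : ∃ (W : Opens S), W ≤ V ∧ q ∈ W ∧ ∃ c : S → ℂ,
        ContMDiffOn 𝓘(ℂ, C2) 𝓘(ℂ) ∞ c W ∧ (∀ z ∈ W, f z = c z * centredChart p z 0) ∧
          ∀ z ∈ W, g z = c z * centredChart p z 1 by
      obtain ⟨W, hW, hqW, c, hc, h₀, h₁⟩ := h
      refine ⟨W, hW, hqW, secOf (U := W) c hc, ?_, ?_⟩
      · rwa [resFn_secOf, resFn_secOf, secOf_mul, secOf_congr]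
      · rwa [resFn_secOf, resFn_secOf, secOf_mul, secOf_congr]
    by_cases hqp : q = p
    · subst hqp
      -- `f` vanishes on the line where the first coordinate is zero, so it is divisible by it.
      obtain ⟨W, hqW, hWV, hWs, c, d, hc, hd, h⟩ := exists_hadamard_chart q V.isOpen hq hf
        (ContinuousLinearMap.id ℂ C2 - (EuclideanSpace.proj (𝕜 := ℂ) 0 : C2 →L[ℂ] ℂ).smulRight
          (EuclideanSpace.single 0 1))
      have h₀ : ∀ z ∈ W, f z = c z * centredChart q z 0 := by
        refine fun z hz => sub_eq_zero.1 (hnzd 1 W (hWV.trans hV) _ ((hf.mono hWV).sub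
          (hc.mul (hcoord 0 W hWV))) (fun z hz => ?_) z hz)
        obtain ⟨z', hz'V, hz's, hz'0, e⟩ := h z hz
        have h0 : centredChart q z' 0 = 0 := by rw [hz'0]; simp
        have h1 : centredChart q z' 1 = centredChart q z 1 := by rw [hz'0]; simp
        have h2 := hab z' hz'V
        rw [h0, h1, mul_zero] at h2
        simp at e
        change centredChart q z 1 * (f z - c z * centredChart q z 0) = 0
        rw [e]
        linear_combination h2
      refine ⟨W, hWV, hqW, c, hc, h₀, fun z hz => sub_eq_zero.1 (hnzd 0 W (hWV.trans hV) _
        ((hg.mono hWV).sub (hc.mul (hcoord 1 W hWV))) (fun z hz => ?_) z hz)⟩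
      change centredChart q z 0 * (g z - c z * centredChart q z 1) = 0
      linear_combination centredChart q z 1 * h₀ z hz - hab z (hWV hz)
    · obtain ⟨j, W, hW, hqW, hne, hi⟩ := hinv V hV q hq hqp
      fin_cases j
      · refine ⟨W, hW, hqW, _, (hf.mono hW).mul hi, fun z hz =>
          (inv_mul_cancel_right₀ (hne z hz) (f z)).symm,
          fun z hz => mul_right_cancel₀ (hne z hz) ?_⟩
        have := inv_mul_cancel₀ (hne z hz)
        simp only [Pi.mul_apply, Fin.zero_eta] at this ⊢
        linear_combination -hab z (hW hz) - f z * centredChart p z 1 * this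
      · refine ⟨W, hW, hqW, _, (hg.mono hW).mul hi, fun z hz => mul_right_cancel₀ (hne z hz) ?_,
          fun z hz => (inv_mul_cancel_right₀ (hne z hz) (g z)).symm⟩
        have := inv_mul_cancel₀ (hne z hz)
        simp only [Pi.mul_apply, Fin.mk_one] at this ⊢
        linear_combination hab z (hW hz) - g z * centredChart p z 0 * this
  · intro V hV c hc _
    obtain ⟨f, hf, rfl⟩ := exists_secOf_eq (S := S) (U := V) c
    rw [resFn_secOf, secOf_mul, secOf_zero, secOf_congr] at hc
    rw [secOf_zero, secOf_congr]
    exact hnzd 0 V hV f hf fun z hz => by rw [mul_comm]; exact hc z hz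

/-- Near every point, the ideal sheaf of a finite set of points has a regular pair of generators. -/
lemma exists_isRegularPair [T2Space S] {Z : Set S} (hZ : Z.Finite) (p : S) :
    ∃ U : Opens (TopCat.of S), p ∈ U ∧ ∃ x ∈ ptIdeal Z 1 U, ∃ y ∈ ptIdeal Z 1 U,
      IsRegularPair (𝒪 := holSheaf S) (ptIdeal Z 1) x y := by
  by_cases hp : p ∈ Z
  · let U : Opens S := ⟨(chartAt C2 p).source ∩ (Z \ {p})ᶜ,
      (chartAt C2 p).open_source.inter (hZ.subset Set.sdiff_subset).isClosed.isOpen_compl⟩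
    have hU : (U : Set S) ⊆ (chartAt C2 p).source := Set.inter_subset_left
    have hUp : ∀ z ∈ U, z ∈ Z → z = p := fun z hz hzZ => by
      by_contra h
      exact hz.2 ⟨hzZ, h⟩
    refine ⟨U, ⟨mem_chart_source C2 p, fun h => h.2 rfl⟩, _, ?_, _, ?_,
      isRegularPair_centredChart Z hp hU⟩
    all_goals
      rw [secOf_mem_iff]
      intro z hz hzZ
      rw [hUp z hz hzZ, centredChart_self]
      rfl
  · refine ⟨(⟨Zᶜ, hZ.isClosed.isOpen_compl⟩ : Opens S), hp, 1, ?_, 0, zero_mem _,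
      isRegularPair_one_zero Z _⟩
    exact (mem_localIdeal_one_iff Z _ _).2 fun z hz => (z.2 hz).elim

end Points

/-! ### The canonical sheaf is invertible -/

section Canonical
variable {S : Type u} [TopologicalSpace S] [ChartedSpace C2 S] [IsManifold 𝓘(ℂ, C2) ω S]

/-- The standard basis of `ℂ²`. -/
noncomputable abbrev stdBasis : Module.Basis (Fin 2) ℂ C2 :=
  (EuclideanSpace.basisFun (Fin 2) ℂ).toBasis

/-- The determinant, as a continuous alternating form on `ℂ²`. -/
noncomputable def detForm : C2 [⋀^Fin 2]→L[ℂ] ℂ where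
  __ := stdBasis.det
  cont := by
    have : ∀ v : Fin 2 → C2, stdBasis.det v = v 0 0 * v 1 1 - v 1 0 * v 0 1 := fun v => by
      rw [Module.Basis.det_apply, Matrix.det_fin_two]
      simp [Module.Basis.toMatrix_apply]
    change Continuous fun v => stdBasis.det v
    simp only [this]
    fun_prop

lemma detForm_stdBasis : detForm stdBasis = 1 := stdBasis.det_self

lemma eq_smul_detForm (f : C2 [⋀^Fin 2]→L[ℂ] ℂ) : f = f stdBasis • detForm :=
  ContinuousAlternatingMap.toAlternatingMap_injective
    (f.toAlternatingMap.eq_smul_basis_det stdBasis)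

lemma detForm_apply (v : Fin 2 → C2) : detForm v = v 0 0 * v 1 1 - v 1 0 * v 0 1 := by
  change stdBasis.det v = _
  rw [Module.Basis.det_apply, Matrix.det_fin_two]
  simp [Module.Basis.toMatrix_apply]

/-- The trivialization of the bundle of 2-forms at `p`. -/
noncomputable abbrev formTriv (p : S) :
    Bundle.Trivialization (C2 [⋀^Fin 2]→L[ℂ] ℂ)
      (Bundle.TotalSpace.proj (F := C2 [⋀^Fin 2]→L[ℂ] ℂ) (E := Form2 S)) :=
  trivializationAt (C2 [⋀^Fin 2]→L[ℂ] ℂ) (Form2 S) p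

/-- The trivialization of the tangent bundle at `p`. -/
noncomputable abbrev tangentTriv (p : S) :
    Bundle.Trivialization C2
      (Bundle.TotalSpace.proj (F := C2) (E := (TangentSpace 𝓘(ℂ, C2) : S → Type _))) :=
  trivializationAt C2 (TangentSpace 𝓘(ℂ, C2)) p

lemma formTriv_baseSet (p : S) : (formTriv p).baseSet = (tangentTriv p).baseSet :=
  Set.inter_univ _

/-- The change of trivialization of a 2-form is the pullback by the change of trivialization of the
tangent bundle, hence the multiplication by its determinant. -/
lemma formTriv_change (p p' : S) {x : S} (hx : x ∈ (formTriv p).baseSet)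
    (hx' : x ∈ (formTriv p').baseSet) (β : Form2 S x) :
    (formTriv p ⟨x, β⟩).2 stdBasis =
      detForm (fun j => (tangentTriv p).coordChangeL ℂ (tangentTriv p') x (stdBasis j)) *
        (formTriv p' ⟨x, β⟩).2 stdBasis := by
  rw [formTriv_baseSet] at hx hx'
  have happ : ∀ (p : S) (v : Fin 2 → C2),
      (formTriv p ⟨x, β⟩).2 v = β fun j => (tangentTriv p).symmL ℂ x (v j) := by
    intro p v
    simp [FiberBundle.trivializationAt_continuousAlternatingMap_apply,
      ContinuousAlternatingMap.inCoordinates, Function.comp_def]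
  have h : (formTriv p ⟨x, β⟩).2 stdBasis = (formTriv p' ⟨x, β⟩).2
      (fun j => (tangentTriv p).coordChangeL ℂ (tangentTriv p') x (stdBasis j)) := by
    rw [happ, happ]
    congr 1
    funext j
    rw [(tangentTriv p).coordChangeL_apply (tangentTriv p') ⟨hx, hx'⟩]
    rw [Bundle.Trivialization.symmL_apply _ hx _, Bundle.Trivialization.symmL_apply _ hx' _]
    exact ((tangentTriv p').symm_apply_apply_mk hx' _).symm
  rw [h]
  conv_lhs => rw [eq_smul_detForm (formTriv p' ⟨x, β⟩).2]
  exact mul_comm _ _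

lemma contDiff_detForm_apply :
    ContDiff ℂ ∞ fun A : C2 →L[ℂ] C2 => detForm (fun j => A (stdBasis j)) := by
  simp only [detForm_apply]
  have h : ∀ j k : Fin 2, ContDiff ℂ ∞ fun A : C2 →L[ℂ] C2 => A (stdBasis j) k := fun j k =>
    (EuclideanSpace.proj (𝕜 := ℂ) k : C2 →L[ℂ] ℂ).contDiff.comp
      (ContinuousLinearMap.apply ℂ C2 (stdBasis j)).contDiff
  exact ((h 0 0).mul (h 1 1)).sub ((h 1 0).mul (h 0 1))

lemma contMDiffAt_detForm_coordChangeL (p p' : S) {x : S} (hx : x ∈ (formTriv p).baseSet)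
    (hx' : x ∈ (formTriv p').baseSet) :
    ContMDiffAt 𝓘(ℂ, C2) 𝓘(ℂ) ∞ (fun y : S =>
      detForm (fun j => (tangentTriv p).coordChangeL ℂ (tangentTriv p') y (stdBasis j))) x := by
  rw [formTriv_baseSet] at hx hx'
  have h : ContMDiffAt 𝓘(ℂ, C2) 𝓘(ℂ, C2 →L[ℂ] C2) ∞
      (fun y : S => ((tangentTriv p).coordChangeL ℂ (tangentTriv p') y : C2 →L[ℂ] C2)) x := by
    have : IsManifold 𝓘(ℂ, C2) (∞ + 1) S := IsManifold.of_le (n := ω) le_top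
    have : ContMDiffVectorBundle ∞ C2 (TangentSpace 𝓘(ℂ, C2) : S → Type _) 𝓘(ℂ, C2) :=
      TangentBundle.contMDiffVectorBundle
    exact contMDiffAt_coordChangeL (n := ∞) (IB := 𝓘(ℂ, C2)) (e := tangentTriv p)
      (e' := tangentTriv p') hx hx'
  have hd := contDiff_detForm_apply.contMDiff.contMDiffAt.comp x h
  exact hd

/-- A 2-form on an open set of a trivialization is holomorphic if and only if its coordinate is. -/
lemma isHolForm_iff_formTriv (p : S) (V : Opens S) (hV : ∀ x ∈ V, x ∈ (formTriv p).baseSet)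
    (α : ∀ x : V, Form2 S x) : IsHolForm S V α ↔
      ContMDiff 𝓘(ℂ, C2) 𝓘(ℂ) ∞ (fun x : V => (formTriv p ⟨(x : S), α x⟩).2 stdBasis) := by
  have hev : ∀ (x₀ : V) (f : V → C2 [⋀^Fin 2]→L[ℂ] ℂ),
      ContMDiffAt 𝓘(ℂ, C2) 𝓘(ℂ, C2 [⋀^Fin 2]→L[ℂ] ℂ) ∞ f x₀ ↔
        ContMDiffAt 𝓘(ℂ, C2) 𝓘(ℂ) ∞ (fun x => f x stdBasis) x₀ := by
    intro x₀ f
    refine ⟨fun h => (ContinuousAlternatingMap.apply ℂ C2 ℂ stdBasis).contMDiff.contMDiffAt.comp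
      x₀ h, fun h => ?_⟩
    have hf : f = fun x => f x stdBasis • detForm := funext fun x => eq_smul_detForm _
    rw [hf]
    exact h.smul contMDiffAt_const
  have hchange : ∀ (p p' : S) (x₀ : V), (x₀ : S) ∈ (formTriv p).baseSet →
      (x₀ : S) ∈ (formTriv p').baseSet →
      ContMDiffAt 𝓘(ℂ, C2) 𝓘(ℂ) ∞ (fun x : V => (formTriv p ⟨(x : S), α x⟩).2 stdBasis) x₀ →
      ContMDiffAt 𝓘(ℂ, C2) 𝓘(ℂ) ∞ (fun x : V => (formTriv p' ⟨(x : S), α x⟩).2 stdBasis) x₀ := by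
    intro p p' x₀ hp hp' h
    refine (((contMDiffAt_detForm_coordChangeL p' p hp' hp).comp x₀
      (contMDiff_subtype_val x₀)).mul h).congr_of_eventuallyEq ?_
    have hc : Continuous ((↑) : V → S) := continuous_subtype_val
    filter_upwards [hc.continuousAt.preimage_mem_nhds ((formTriv p).open_baseSet.mem_nhds hp),
      hc.continuousAt.preimage_mem_nhds ((formTriv p').open_baseSet.mem_nhds hp')] with x hx hx'
    exact formTriv_change p' p hx' hx (α x)
  rw [isHolForm_iff]
  refine forall_congr' fun x₀ => (hev x₀ _).trans ?_
  have h₀ : (x₀ : S) ∈ (formTriv (x₀ : S)).baseSet := FiberBundle.mem_baseSet_trivializationAt' _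
  exact ⟨hchange _ _ x₀ h₀ (hV _ x₀.2), hchange _ _ x₀ (hV _ x₀.2) h₀⟩

/-- Near every point, the holomorphic 2-forms are identified with the holomorphic functions through
the local trivialization of `Λ² T^* S`. -/
lemma exists_coord_canonicalSheaf (p : S) : ∃ U : Opens (TopCat.of S), p ∈ U ∧
    Nonempty (Coord (canonicalSheaf S) U fun _ => ⊤) := by
  let e := formTriv p
  let U : Opens (TopCat.of S) := (⟨e.baseSet, e.open_baseSet⟩ : Opens S)
  let c (V : Opens (TopCat.of S)) (hV : V ≤ U) (α : Sec (canonicalSheaf S) V) :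
      Fn (holSheaf S) V :=
    ⟨fun x => (e ⟨(x : S), (α : holForms S V).1 x⟩).2 stdBasis,
      (isHolForm_iff_formTriv p V hV (α : holForms S V).1).1 (α : holForms S V).2⟩
  have hinj : ∀ (V : Opens (TopCat.of S)) (hV : V ≤ U), Function.Injective (c V hV) := by
    intro V hV α α' h
    refine Subtype.ext (funext fun x => ?_)
    have h1 : (e ⟨(x : S), (α : holForms S V).1 x⟩).2 stdBasis =
        (e ⟨(x : S), (α' : holForms S V).1 x⟩).2 stdBasis :=
      congr($(congr_arg Subtype.val h) x)
    rw [← e.symm_apply_apply_mk (hV x.2) ((α : holForms S V).1 x),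
      ← e.symm_apply_apply_mk (hV x.2) ((α' : holForms S V).1 x),
      eq_smul_detForm (e ⟨(x : S), (α : holForms S V).1 x⟩).2,
      eq_smul_detForm (e ⟨(x : S), (α' : holForms S V).1 x⟩).2, h1]
  have hsurj : ∀ (V : Opens (TopCat.of S)) (hV : V ≤ U), Function.Surjective (c V hV) := by
    intro V hV f
    have he : ∀ x : (V : Opens S),
        (e ⟨(x : S), e.symm x (f.1 x • detForm)⟩).2 stdBasis = f.1 x := fun x => by
      rw [e.apply_mk_symm (hV x.2)]
      change f.1 x * detForm stdBasis = f.1 x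
      rw [detForm_stdBasis, mul_one]
    have hf : ContMDiff 𝓘(ℂ, C2) 𝓘(ℂ) ∞ fun x : (V : Opens S) =>
        (e ⟨(x : S), e.symm x (f.1 x • detForm)⟩).2 stdBasis := (funext he).symm ▸ f.2
    exact ⟨(⟨fun x => e.symm x (f.1 x • detForm), (isHolForm_iff_formTriv p V hV _).2 hf⟩ :
      holForms S V), Subtype.ext (funext fun x => he x)⟩
  exact ⟨U, show p ∈ e.baseSet from FiberBundle.mem_baseSet_trivializationAt' p,
    Coord.nonempty_of_bijective c
    (fun V hV α β => Subtype.ext (funext fun x =>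
      congr($(triv_add p x.1 ((α : holForms S V).1 x) ((β : holForms S V).1 x)) stdBasis)))
    (fun V hV f α => Subtype.ext (funext fun x =>
      congr($(triv_smul p x.1 (f.1 x) ((α : holForms S V).1 x)) stdBasis)))
    (fun _ _ _ _ _ => rfl) fun V hV => ⟨hinj V hV, hsurj V hV⟩⟩

end Canonical
end CplxSurface

namespace SheafMod
variable {X : TopCat.{u}} {𝒪 : Sheaf (Opens.grothendieckTopology X) CommRingCat.{u}}

/-! ### Homomorphisms between tensor products -/

section Maps
variable {A B Q Q' N L : ModSheaf 𝒪}

/-- A trilinear map on sections that commutes with restriction defines a morphism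
`A ⊗ B ⟶ Hom(Q, N)`. -/
lemma exists_tensor_homSheaf
    (τ : ∀ V : Opens X, Sec A V →ₗ[Fn 𝒪 V] Sec B V →ₗ[Fn 𝒪 V] Sec Q V →ₗ[Fn 𝒪 V] Sec N V)
    (hτ : ∀ (V W : Opens X) (hW : W ≤ V) (a : Sec A V) (b : Sec B V) (q : Sec Q V),
      τ W (res A hW a) (res B hW b) (res Q hW q) = res N hW (τ V a b q)) :
    ∃ f : tensor A B ⟶ homSheaf Q N, ∀ (U V : Opens X) (h : V ≤ U) (a : Sec A U) (b : Sec B U)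
      (q : Sec Q V), homEval (onSec f U (tmul a b)) h q = τ V (res A h a) (res B h b) q := by
  let t (U : Opens X) (a : Sec A U) (b : Sec B U) : Sec (homSheaf Q N) U :=
    LocalHom.mk' (M := Q) (N := N) (fun V hV => τ V (res A hV a) (res B hV b))
      (fun V W hV hW q => by rw [← hτ, res_res, res_res])
  have ht (U V : Opens X) (hV : V ≤ U) (a : Sec A U) (b : Sec B U) (q : Sec Q V) :
      homEval (t U a b) hV q = τ V (res A hV a) (res B hV b) q := rfl
  obtain ⟨f, hf⟩ := exists_tensorDesc (A := A) (B := B) (N := homSheaf Q N)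
    (fun U => LinearMap.mk₂ (Fn 𝒪 U) (t U)
      (fun a a' b => homSheaf_ext fun V hV q => by
        change τ V (res A hV (a + a')) (res B hV b) q = τ V _ _ q + τ V _ _ q
        rw [map_add, map_add]; rfl)
      (fun r a b => homSheaf_ext fun V hV q => by
        change τ V (res A hV (r • a)) (res B hV b) q = resFn (𝒪 := 𝒪) hV r • τ V _ _ q
        rw [res_smul, map_smul]; rfl)
      (fun a b b' => homSheaf_ext fun V hV q => by
        change τ V (res A hV a) (res B hV (b + b')) q = τ V _ _ q + τ V _ _ q
        rw [map_add, map_add]; rfl)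
      (fun r a b => homSheaf_ext fun V hV q => by
        change τ V (res A hV a) (res B hV (r • b)) q = resFn (𝒪 := 𝒪) hV r • τ V _ _ q
        rw [res_smul, map_smul]; rfl))
    (fun U V hV a b => homSheaf_ext fun W hW q => by
      rw [LinearMap.mk₂_apply, LinearMap.mk₂_apply, homEval_res, ht, ht, res_res, res_res])
  exact ⟨f, fun U V h a b q => by rw [hf]; rfl⟩

/-- A trilinear map on sections that commutes with restriction defines a morphism
`A ⟶ Hom(Q ⊗ Q', N)`. -/
lemma exists_homSheaf_tensor
    (τ : ∀ V : Opens X, Sec A V →ₗ[Fn 𝒪 V] Sec Q V →ₗ[Fn 𝒪 V] Sec Q' V →ₗ[Fn 𝒪 V] Sec N V)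
    (hτ : ∀ (V W : Opens X) (hW : W ≤ V) (a : Sec A V) (q : Sec Q V) (q' : Sec Q' V),
      τ W (res A hW a) (res Q hW q) (res Q' hW q') = res N hW (τ V a q q')) :
    ∃ f : A ⟶ homSheaf (tensor Q Q') N, ∀ (U V : Opens X) (h : V ≤ U) (a : Sec A U) (q : Sec Q V)
      (q' : Sec Q' V), homEval (onSec f U a) h (tmul q q') = τ V (res A h a) q q' := by
  have key (U : Opens X) (a : Sec A U) := exists_tensorLift (A := Q) (B := Q') (N := N) (U := U)
    (fun V hV => τ V (res A hV a)) (fun V W hV hW q q' => by rw [← hτ, res_res])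
  choose t ht using key
  refine ⟨homOfSec (N := homSheaf (tensor Q Q') N) (fun U =>
    { toFun := t U
      map_add' := fun a a' => LocalHom.tensor_ext fun V hV q q' => ?_
      map_smul' := fun r a => LocalHom.tensor_ext fun V hV q q' => ?_ }) fun U V hV a =>
      LocalHom.tensor_ext fun W hW q q' => ?_, fun U V h a q q' => ht U a V h q q'⟩
  · change _ = (t U a).ap hV (tmul q q') + (t U a').ap hV (tmul q q')
    rw [ht, ht, ht, map_add, map_add]; rfl
  · change _ = resFn (𝒪 := 𝒪) hV r • (t U a).ap hV (tmul q q')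
    rw [ht, ht, res_smul, map_smul]; rfl
  · change (t V _).ap hW (tmul q q') = (t U a).ap (hW.trans hV) (tmul q q')
    rw [ht, ht, res_res]

/-- The pairing between an invertible sheaf and its inverse, as a bilinear map. -/
noncomputable def pairingₗ (L : ModSheaf 𝒪) (V : Opens X) :
    Sec (dual L) V →ₗ[Fn 𝒪 V] Sec L V →ₗ[Fn 𝒪 V] Fn 𝒪 V :=
  LinearMap.mk₂ (Fn 𝒪 V) (fun φ l => pairing φ le_rfl l)
    (fun _ _ _ => rfl)
    (fun r φ l => by
      change resFn (𝒪 := 𝒪) le_rfl r * pairing φ le_rfl l = _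
      rw [resFn_self]; rfl)
    (fun φ => (LocalHom.ap (φ : LocalHom L (SheafOfModules.unit (ringSheaf 𝒪)) V) le_rfl).map_add)
    (fun r φ =>
      (LocalHom.ap (φ : LocalHom L (SheafOfModules.unit (ringSheaf 𝒪)) V) le_rfl).map_smul r)

lemma res_pairingₗ {U V : Opens X} (h : V ≤ U) (φ : Sec (dual L) U) (l : Sec L U) :
    pairingₗ L V (res (dual L) h φ) (res L h l) = resFn (𝒪 := 𝒪) h (pairingₗ L U φ l) :=
  LocalHom.ap_res (φ : LocalHom L (SheafOfModules.unit (ringSheaf 𝒪)) U) le_rfl h l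

variable (L) in
/-- A morphism `j : B ⟶ N` defines the morphism `L⁻¹ ⊗ B ⟶ Hom(L, N)`, `φ ⊗ s ↦ (l ↦ φ(l) j(s))`. -/
lemma exists_dual_tensor_homSheaf (j : B ⟶ N) : ∃ f : tensor (dual L) B ⟶ homSheaf L N,
    ∀ (U V : Opens X) (h : V ≤ U) (φ : Sec (dual L) U) (s : Sec B U) (l : Sec L V),
      homEval (onSec f U (tmul φ s)) h l = pairing φ h l • res N h (onSec j U s) := by
  obtain ⟨f, hf⟩ := exists_tensor_homSheaf (A := dual L) (B := B) (Q := L) (N := N)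
    (fun V => LinearMap.mk₂ (Fn 𝒪 V)
      (fun φ s => (pairingₗ L V φ).smulRight (onSec j V s))
      (fun φ ψ s => by ext l; simp [add_smul])
      (fun r φ s => by ext l; simp [mul_smul])
      (fun φ s s' => by ext l; simp)
      (fun r φ s => by ext l; rw [map_smul]; exact smul_comm _ _ _))
    (fun V W hW φ s l => by
      change pairingₗ L W _ _ • onSec j W _ = res _ hW (pairingₗ L V φ l • onSec j V s)
      rw [res_smul, res_pairingₗ, onSec_res])
  exact ⟨f, fun U V h φ s l => by rw [hf, ← onSec_res]; rfl⟩

end Maps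

/-! ### Coordinates of homomorphisms on tensor products -/

section CoordExt
variable {A A' Q Q' N L : ModSheaf 𝒪} {U : Opens X}

/-- Families of functions that depend linearly on a section of `A ⊗ A'` agree if they agree on the
sections `a ⊗ a'`. -/
lemma tensor_fn_ext {f g : ∀ V : Opens X, V ≤ U → (Sec (tensor A A') V →ₗ[Fn 𝒪 V] Fn 𝒪 V)}
    (hf : ∀ (V W : Opens X) (hV : V ≤ U) (hW : W ≤ V) (m : Sec (tensor A A') V),
      f W (hW.trans hV) (res _ hW m) = resFn (𝒪 := 𝒪) hW (f V hV m))
    (hg : ∀ (V W : Opens X) (hV : V ≤ U) (hW : W ≤ V) (m : Sec (tensor A A') V),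
      g W (hW.trans hV) (res _ hW m) = resFn (𝒪 := 𝒪) hW (g V hV m))
    (h : ∀ (V : Opens X) (hV : V ≤ U) (a : Sec A V) (a' : Sec A' V),
      f V hV (tmul a a') = g V hV (tmul a a'))
    (V : Opens X) (hV : V ≤ U) (m : Sec (tensor A A') V) : f V hV m = g V hV m :=
  congr(LocalHom.ap $(LocalHom.tensor_ext (U := U) (N := SheafOfModules.unit (ringSheaf 𝒪))
    (φ := LocalHom.mk' (fun V hV => (unitSec V).symm.toLinearMap ∘ₗ f V hV) hf)
    (ψ := LocalHom.mk' (fun V hV => (unitSec V).symm.toLinearMap ∘ₗ g V hV) hg) h) hV m)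

/-- A formula for the coordinates of the values of a homomorphism on `Q ⊗ Q'` may be checked on the
sections `q ⊗ q'`. -/
lemma Coord.ap_homEval_tensor {J J' : ∀ V : Opens X, Ideal (Fn 𝒪 V)} (cN : Coord N U J)
    (cQ : Coord (tensor Q Q') U J') (φ : Sec (homSheaf (tensor Q Q') N) U) (a : Fn 𝒪 U)
    (h : ∀ (V : Opens X) (hV : V ≤ U) (q : Sec Q V) (q' : Sec Q' V),
      cN.ap hV (homEval φ hV (tmul q q')) = resFn (𝒪 := 𝒪) hV a * cQ.ap hV (tmul q q'))
    (V : Opens X) (hV : V ≤ U) (w : Sec (tensor Q Q') V) :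
    cN.ap hV (homEval φ hV w) = resFn (𝒪 := 𝒪) hV a * cQ.ap hV w :=
  tensor_fn_ext (f := fun V hV => cN.ap hV ∘ₗ homEval φ hV)
    (g := fun V hV => LinearMap.mulLeft (Fn 𝒪 V) (resFn (𝒪 := 𝒪) hV a) ∘ₗ cQ.ap hV)
    (fun V W hV hW m => by
      rw [LinearMap.comp_apply, LinearMap.comp_apply, ← cN.ap_res hV hW, res_homEval])
    (fun V W hV hW m => by
      change _ * _ = resFn (𝒪 := 𝒪) hW (_ * _)
      rw [cQ.ap_res hV hW, map_mul (resFn (𝒪 := 𝒪) hW), resFn_resFn]) h V hV w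

/-- A formula for the coordinates of the values of the homomorphisms defined by the sections of
`A ⊗ A'` may be checked on the sections `a ⊗ a'`. -/
lemma Coord.ap_homEval_of_tensor {J J' J'' : ∀ V : Opens X, Ideal (Fn 𝒪 V)} (cN : Coord N U J)
    (cQ : Coord Q U J') (cA : Coord (tensor A A') U J'') (f : tensor A A' ⟶ homSheaf Q N)
    (h : ∀ (V W : Opens X) (hV : V ≤ U) (hW : W ≤ V) (a : Sec A V) (a' : Sec A' V) (q : Sec Q W),
      cN.ap (hW.trans hV) (homEval (onSec f V (tmul a a')) hW q) =
        resFn (𝒪 := 𝒪) hW (cA.ap hV (tmul a a')) * cQ.ap (hW.trans hV) q)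
    (V W : Opens X) (hV : V ≤ U) (hW : W ≤ V) (m : Sec (tensor A A') V) (q : Sec Q W) :
    cN.ap (hW.trans hV) (homEval (onSec f V m) hW q) =
      resFn (𝒪 := 𝒪) hW (cA.ap hV m) * cQ.ap (hW.trans hV) q := by
  have key := tensor_fn_ext (A := A) (A' := A') (U := W)
    (f := fun W' hW' => cN.ap (hW'.trans (hW.trans hV)) ∘ₗ
      ({ toFun := fun m => homEval (onSec f W' m) le_rfl (res Q hW' q)
         map_add' := fun m m' => by rw [map_add]; rfl
         map_smul' := fun r m => by
          rw [map_smul]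
          change (resFn (𝒪 := 𝒪) le_rfl r • homEval (onSec f W' m) le_rfl (res Q hW' q) :
            Sec N W') = _
          rw [resFn_self]
          rfl } : Sec (tensor A A') W' →ₗ[Fn 𝒪 W'] Sec N W'))
    (g := fun W' hW' => LinearMap.mulRight (Fn 𝒪 W')
      (resFn (𝒪 := 𝒪) hW' (cQ.ap (hW.trans hV) q)) ∘ₗ cA.ap (hW'.trans (hW.trans hV)))
    (fun V₁ W₁ hV₁ hW₁ m => by
      change cN.ap _ (homEval (onSec f W₁ (res _ hW₁ m)) le_rfl (res Q (hW₁.trans hV₁) q)) =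
        resFn (𝒪 := 𝒪) hW₁ (cN.ap _ (homEval (onSec f V₁ m) le_rfl (res Q hV₁ q)))
      rw [← cN.ap_res, res_homEval, onSec_res, homEval_res, res_res])
    (fun V₁ W₁ hV₁ hW₁ m => by
      change cA.ap _ _ * _ = resFn (𝒪 := 𝒪) hW₁ (cA.ap _ _ * _)
      rw [cA.ap_res (hV₁.trans (hW.trans hV)) hW₁, map_mul (resFn (𝒪 := 𝒪) hW₁), resFn_resFn])
    (fun V₁ hV₁ a a' => by
      change cN.ap _ (homEval (onSec f V₁ (tmul a a')) le_rfl (res Q hV₁ q)) = cA.ap _ _ * _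
      rw [h V₁ V₁ (hV₁.trans (hW.trans hV)) le_rfl, resFn_self, cQ.ap_res (hW.trans hV) hV₁])
    W le_rfl (res _ hW m)
  change cN.ap _ (homEval (onSec f W (res _ hW m)) le_rfl (res Q le_rfl q)) =
    cA.ap _ _ * resFn (𝒪 := 𝒪) le_rfl _ at key
  rwa [onSec_res, homEval_res, res_self, cA.ap_res hV hW, resFn_self] at key

end CoordExt

/-! ### The two exact sequences over a ringed space -/

section Sequences
variable {L₁ L₂ E K : ModSheaf 𝒪} {I I' : ∀ U : Opens X, Ideal (Fn 𝒪 U)}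
  {hI : ∀ (U V : Opens X) (h : V ≤ U), I U ≤ (I V).comap (resFn (𝒪 := 𝒪) h)}
  {hI' : ∀ (U V : Opens X) (h : V ≤ U), I' U ≤ (I' V).comap (resFn (𝒪 := 𝒪) h)}

lemma toFn_res {U V : Opens X} (h : V ≤ U) (a : Sec (idealSheaf I hI) U) :
    toFn (res _ h a) = resFn (𝒪 := 𝒪) h (toFn a) := rfl

variable (hI) in
/-- The value of a section of an ideal sheaf, as a linear map. -/
noncomputable def toFnₗ (V : Opens X) : Sec (idealSheaf I hI) V →ₗ[Fn 𝒪 V] Fn 𝒪 V :=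
  (Coord.ofIdeal I hI V).ap le_rfl

/-- Around every point, the invertible sheaves and `E` have frames and the ideal is generated by a
regular pair, over a common neighbourhood. -/
lemma exists_common_frames (hL₁ : IsLocallyFreeOfRank L₁ 1) (hL₂ : IsLocallyFreeOfRank L₂ 1)
    (hE : IsLocallyFreeOfRank E 2)
    (hK : ∀ p : X, ∃ U : Opens X, p ∈ U ∧ Nonempty (Coord K U fun _ => ⊤))
    (hreg : ∀ p : X, ∃ U : Opens X, p ∈ U ∧ ∃ x ∈ localIdeal I hI U, ∃ y ∈ localIdeal I hI U,
      IsRegularPair (localIdeal I hI) x y) (p : X) :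
    ∃ U : Opens X, p ∈ U ∧ Nonempty (Coord L₁ U fun _ => ⊤) ∧ Nonempty (Coord L₂ U fun _ => ⊤) ∧
      Nonempty (Coord K U fun _ => ⊤) ∧ (∃ e : Fin 2 → Sec E U, IsFrame e) ∧
      ∃ x ∈ localIdeal I hI U, ∃ y ∈ localIdeal I hI U, IsRegularPair (localIdeal I hI) x y := by
  obtain ⟨U₁, h₁, ⟨c₁⟩⟩ := Coord.exists_of_rank_one hL₁ p
  obtain ⟨U₂, h₂, ⟨c₂⟩⟩ := Coord.exists_of_rank_one hL₂ p
  obtain ⟨U₃, h₃, ⟨c₃⟩⟩ := hK p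
  obtain ⟨U₄, h₄, e, he⟩ := hE p
  obtain ⟨U₅, h₅, x, hx, y, hy, hxy⟩ := hreg p
  let U := U₁ ⊓ (U₂ ⊓ (U₃ ⊓ (U₄ ⊓ U₅)))
  have l₁ : U ≤ U₁ := inf_le_left
  have l₂ : U ≤ U₂ := inf_le_right.trans inf_le_left
  have l₃ : U ≤ U₃ := inf_le_right.trans (inf_le_right.trans inf_le_left)
  have l₄ : U ≤ U₄ := inf_le_right.trans (inf_le_right.trans (inf_le_right.trans inf_le_left))
  have l₅ : U ≤ U₅ := inf_le_right.trans (inf_le_right.trans (inf_le_right.trans inf_le_right))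
  exact ⟨U, ⟨h₁, h₂, h₃, h₄, h₅⟩, ⟨c₁.restrict l₁⟩, ⟨c₂.restrict l₂⟩, ⟨c₃.restrict l₃⟩,
    ⟨_, IsFrame.restrict he l₄⟩, _, localIdeal_res I hI l₅ x hx, _, localIdeal_res I hI l₅ y hy,
    hxy.restrict l₅⟩

variable (L₁ L₂ K hI) in
/-- The map `L₂⁻¹ ⊗ M ⟶ Hom(L₂ ⊗ I, M)`. -/
lemma exists_dual_tensor_homSheaf_ideal (M : ModSheaf 𝒪) :
    ∃ α : tensor (dual L₂) M ⟶ homSheaf (tensor L₂ (idealSheaf I hI)) M,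
      ∀ (U V : Opens X) (h : V ≤ U) (φ : Sec (dual L₂) U) (t : Sec M U) (l : Sec L₂ V)
        (a : Sec (idealSheaf I hI) V), homEval (onSec α U (tmul φ t)) h (tmul l a) =
          (pairing φ h l * toFn a) • res M h t := by
  obtain ⟨ev, hev⟩ := exists_dual_tensor_homSheaf L₂ (𝟙 M)
  obtain ⟨α, hα⟩ := exists_homSheaf_tensor (A := tensor (dual L₂) M) (Q := L₂)
    (Q' := idealSheaf I hI) (N := M) (fun V => LinearMap.mk₂ (Fn 𝒪 V)
      (fun m l => (toFnₗ hI V).smulRight (homEval (onSec ev V m) le_rfl l))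
      (fun m m' l => by
        ext a
        change toFn a • homEval (onSec ev V (m + m')) le_rfl l =
          toFn a • homEval (onSec ev V m) le_rfl l + toFn a • homEval (onSec ev V m') le_rfl l
        rw [map_add, ← smul_add]
        rfl)
      (fun r m l => by
        ext a
        change toFn a • homEval (onSec ev V (r • m)) le_rfl l =
          r • toFn a • homEval (onSec ev V m) le_rfl l
        rw [map_smul, smul_comm r]
        change toFn a • (resFn (𝒪 := 𝒪) le_rfl r • homEval (onSec ev V m) le_rfl l : Sec M V) = _
        rw [resFn_self])
      (fun m l l' => by ext a; simp)
      (fun r m l => by ext a; rw [map_smul]; exact smul_comm _ _ _))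
    (fun V W hW m l a => by
      change toFn (res _ hW a) • homEval (onSec ev W (res _ hW m)) le_rfl (res L₂ hW l) =
        res M hW (toFn a • homEval (onSec ev V m) le_rfl l)
      rw [res_smul, toFn_res, onSec_res, homEval_res, res_homEval])
  refine ⟨α, fun U V h φ t l a => ?_⟩
  rw [hα, mul_comm, mul_smul]
  change toFn a • homEval (onSec ev V (res _ h (tmul φ t))) le_rfl l = _
  rw [onSec_res, homEval_res, hev, onSec_id]

variable (L₁ K hI) in
/-- The map `K ⊗ I ⟶ Hom(L₁, L₁ ⊗ K)`. -/
lemma exists_tensor_ideal_homSheaf :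
    ∃ β : tensor K (idealSheaf I hI) ⟶ homSheaf L₁ (tensor L₁ K),
      ∀ (U V : Opens X) (h : V ≤ U) (k : Sec K U) (a : Sec (idealSheaf I hI) U) (l : Sec L₁ V),
        homEval (onSec β U (tmul k a)) h l = resFn (𝒪 := 𝒪) h (toFn a) • tmul l (res K h k) := by
  obtain ⟨β, hβ⟩ := exists_tensor_homSheaf (A := K) (B := idealSheaf I hI) (Q := L₁)
    (N := tensor L₁ K) (fun V => LinearMap.flip ((LinearMap.lsmul (Fn 𝒪 V)
      (Sec L₁ V →ₗ[Fn 𝒪 V] Sec (tensor L₁ K) V)).compl₁₂ (toFnₗ hI V) (tmulₗ L₁ K V).flip))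
    (fun V W hW k a l => by
      change toFn (res _ hW a) • tmul (res L₁ hW l) (res K hW k) = res _ hW (toFn a • tmul l k)
      rw [res_smul, res_tmul, toFn_res])
  exact ⟨β, fun U V h k a l => by rw [hβ]; rfl⟩

variable (L₂ K hI) in
/-- The map `K ⟶ Hom(L₂ ⊗ I, L₂ ⊗ K ⊗ I)`. -/
lemma exists_homSheaf_tensor_ideal :
    ∃ α : K ⟶ homSheaf (tensor L₂ (idealSheaf I hI)) (tensor (tensor L₂ K) (idealSheaf I hI)),
      ∀ (U V : Opens X) (h : V ≤ U) (k : Sec K U) (l : Sec L₂ V) (a : Sec (idealSheaf I hI) V),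
        homEval (onSec α U k) h (tmul l a) = tmul (tmul l (res K h k)) a := by
  obtain ⟨α, hα⟩ := exists_homSheaf_tensor (A := K) (Q := L₂) (Q' := idealSheaf I hI)
    (N := tensor (tensor L₂ K) (idealSheaf I hI))
    (fun V => (tmulₗ L₂ K V).flip.compr₂ (tmulₗ (tensor L₂ K) (idealSheaf I hI) V))
    (fun V W hW k l a => by
      change tmul (tmul (res L₂ hW l) (res K hW k)) (res _ hW a) = res _ hW (tmul (tmul l k) a)
      rw [res_tmul, res_tmul])
  exact ⟨α, fun U V h k l a => by rw [hα]; rfl⟩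

/-- For `I' ⊆ I`, the map `P ⊗ I' ⟶ P ⊗ I`. -/
lemma exists_tensor_ideal_le (P : ModSheaf 𝒪) (hle : ∀ V, localIdeal I' hI' V ≤ localIdeal I hI V) :
    ∃ j : tensor P (idealSheaf I' hI') ⟶ tensor P (idealSheaf I hI),
      ∀ (V : Opens X) (t : Sec P V) (b : Sec (idealSheaf I' hI') V) (a : Sec (idealSheaf I hI) V),
        toFn a = toFn b → onSec j V (tmul t b) = tmul t a := by
  let incl (V : Opens X) : Sec (idealSheaf I' hI') V →ₗ[Fn 𝒪 V] Sec (idealSheaf I hI) V :=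
    { toFun := fun b => ⟨toFn b, hle V b.2⟩
      map_add' := fun _ _ => rfl
      map_smul' := fun _ _ => rfl }
  obtain ⟨j, hj⟩ := exists_tensorDesc (fun V => (tmulₗ P (idealSheaf I hI) V).compl₂ (incl V))
    (fun V W hW t b => (res_tmul hW t (incl V b)).symm)
  refine ⟨j, fun V t b a hab => ?_⟩
  rw [hj]
  exact congr_arg (tmul t) (Subtype.ext hab.symm)

/-- The first sequence, with `K_S` replaced by an invertible sheaf and `I_Z` by a sheaf of ideals
that is locally generated by a regular pair. -/
theorem exists_shortExact_tensor (hL₁ : IsLocallyFreeOfRank L₁ 1) (hL₂ : IsLocallyFreeOfRank L₂ 1)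
    (hE : IsLocallyFreeOfRank E 2)
    (hK : ∀ p : X, ∃ U : Opens X, p ∈ U ∧ Nonempty (Coord K U fun _ => ⊤))
    (hreg : ∀ p : X, ∃ U : Opens X, p ∈ U ∧ ∃ x ∈ localIdeal I hI U, ∃ y ∈ localIdeal I hI U,
      IsRegularPair (localIdeal I hI) x y)
    {i : L₁ ⟶ E} {q : E ⟶ tensor L₂ (idealSheaf I hI)} {hiq : i ≫ q = 0}
    (hex : (ShortComplex.mk i q hiq).ShortExact) :
    ∃ (α : tensor (dual L₂) (tensor L₁ K) ≅
          homSheaf (tensor L₂ (idealSheaf I hI)) (tensor L₁ K))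
      (β : tensor K (idealSheaf I hI) ⟶ homSheaf L₁ (tensor L₁ K))
      (g : homSheaf E (tensor L₁ K) ⟶ tensor K (idealSheaf I hI))
      (w : (α.hom ≫ precomp q (tensor L₁ K)) ≫ g = 0),
      (∀ (U V : Opens X) (h : V ≤ U) (φ : Sec (dual L₂) U) (t : Sec (tensor L₁ K) U) (l : Sec L₂ V)
          (a : Sec (idealSheaf I hI) V), homEval (onSec α.hom U (tmul φ t)) h (tmul l a) =
            (pairing φ h l * toFn a) • res (tensor L₁ K) h t) ∧
      (∀ (U V : Opens X) (h : V ≤ U) (k : Sec K U) (a : Sec (idealSheaf I hI) U) (l : Sec L₁ V),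
        homEval (onSec β U (tmul k a)) h l =
          resFn (𝒪 := 𝒪) h (toFn a) • tmul l (res K h k)) ∧
      Mono β ∧ g ≫ β = precomp i (tensor L₁ K) ∧
      (ShortComplex.mk (α.hom ≫ precomp q (tensor L₁ K)) g w).ShortExact := by
  obtain ⟨α, hα⟩ := exists_dual_tensor_homSheaf_ideal L₂ hI (tensor L₁ K)
  obtain ⟨β, hβ⟩ := exists_tensor_ideal_homSheaf L₁ K hI
  obtain ⟨hαi, hβm, g, w, hg, hs⟩ := shortExact_homSheaf (I := localIdeal I hI) (J := fun _ => ⊤)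
    (K := localIdeal I hI) α β hex (fun V a ha b _ => Ideal.mul_mem_right b _ ha)
    (fun V b hb p hp => ⟨V, le_rfl, hp, by rwa [resFn_self, Ideal.mul_top]⟩) fun p => by
      obtain ⟨U, hp, ⟨c₁⟩, ⟨c₂⟩, ⟨cK⟩, ⟨e, he⟩, hxy⟩ := exists_common_frames hL₁ hL₂ hE hK hreg p
      obtain ⟨d, hd⟩ := c₂.exists_dual
      obtain ⟨cN, hN⟩ := c₁.exists_tensor cK
      obtain ⟨cQ, hQ⟩ := c₂.exists_tensor (Coord.ofIdeal I hI U)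
      obtain ⟨cA, hA⟩ := d.exists_tensor cN
      obtain ⟨cB, hB⟩ := cK.exists_tensor (Coord.ofIdeal I hI U)
      refine ⟨U, hp, ⟨
        { cL := c₁
          cQ := cQ
          cN := cN
          cA := cA
          cB := cB
          ap_α := cN.ap_homEval_of_tensor cQ cA α fun V W hV hW φ t w => ?_
          ap_β := cN.ap_homEval_of_tensor c₁ cB β fun V W hV hW k a l => ?_
          frame := e
          isFrame := he }⟩, hxy⟩
      · refine (cN.restrict hV).ap_homEval_tensor (cQ.restrict hV) _ _ (fun W' hW' l a => ?_) W hW w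
        change cN.ap (hW'.trans hV) _ = _ * cQ.ap (hW'.trans hV) _
        rw [hα, map_smul, cN.ap_res hV hW', hd V W' hV hW', hQ, hA, map_mul (resFn (𝒪 := 𝒪) hW'),
          Coord.ofIdeal_ap, smul_eq_mul]
        ring
      · rw [hβ, map_smul, hN, cK.ap_res hV hW, hB, map_mul (resFn (𝒪 := 𝒪) hW), Coord.ofIdeal_ap,
          smul_eq_mul]
        ring
  exact ⟨asIso α, β, g, w, hα, hβ, hβm, hg, hs⟩

/-- The second sequence, with `K_S` replaced by an invertible sheaf, `I_Z` by a sheaf of ideals `I`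
that is locally generated by a regular pair, and `I_Z ^ 2` by the square `I'` of `I`. -/
theorem exists_shortExact_tensor_ideal (hL₁ : IsLocallyFreeOfRank L₁ 1)
    (hL₂ : IsLocallyFreeOfRank L₂ 1) (hE : IsLocallyFreeOfRank E 2)
    (hK : ∀ p : X, ∃ U : Opens X, p ∈ U ∧ Nonempty (Coord K U fun _ => ⊤))
    (hreg : ∀ p : X, ∃ U : Opens X, p ∈ U ∧ ∃ x ∈ localIdeal I hI U, ∃ y ∈ localIdeal I hI U,
      IsRegularPair (localIdeal I hI) x y)
    (hmul : ∀ (V : Opens X), ∀ a ∈ localIdeal I hI V, ∀ b ∈ localIdeal I hI V,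
      a * b ∈ localIdeal I' hI' V)
    (hmul' : ∀ (V : Opens X), ∀ b ∈ localIdeal I' hI' V, ∀ p ∈ V, ∃ (W : Opens X) (hW : W ≤ V),
      p ∈ W ∧ resFn (𝒪 := 𝒪) hW b ∈ localIdeal I hI W * localIdeal I hI W)
    {i : L₁ ⟶ E} {q : E ⟶ tensor L₂ (idealSheaf I hI)} {hiq : i ≫ q = 0}
    (hex : (ShortComplex.mk i q hiq).ShortExact) :
    ∃ (α : K ≅ homSheaf (tensor L₂ (idealSheaf I hI)) (tensor (tensor L₂ K) (idealSheaf I hI)))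
      (β : tensor (dual L₁) (tensor (tensor L₂ K) (idealSheaf I' hI')) ⟶
        homSheaf L₁ (tensor (tensor L₂ K) (idealSheaf I hI)))
      (g : homSheaf E (tensor (tensor L₂ K) (idealSheaf I hI)) ⟶
        tensor (dual L₁) (tensor (tensor L₂ K) (idealSheaf I' hI')))
      (w : (α.hom ≫ precomp q (tensor (tensor L₂ K) (idealSheaf I hI))) ≫ g = 0),
      (∀ (U V : Opens X) (h : V ≤ U) (k : Sec K U) (l : Sec L₂ V) (a : Sec (idealSheaf I hI) V),
        homEval (onSec α.hom U k) h (tmul l a) = tmul (tmul l (res K h k)) a) ∧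
      (∀ (U V : Opens X) (h : V ≤ U) (φ : Sec (dual L₁) U) (t : Sec (tensor L₂ K) U)
          (b : Sec (idealSheaf I' hI') U) (a : Sec (idealSheaf I hI) U) (_ : toFn a = toFn b)
          (l : Sec L₁ V), homEval (onSec β U (tmul φ (tmul t b))) h l =
            pairing φ h l • res (tensor (tensor L₂ K) (idealSheaf I hI)) h (tmul t a)) ∧
      Mono β ∧ g ≫ β = precomp i (tensor (tensor L₂ K) (idealSheaf I hI)) ∧
      (ShortComplex.mk (α.hom ≫ precomp q (tensor (tensor L₂ K) (idealSheaf I hI))) g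
        w).ShortExact := by
  have hle : ∀ V, localIdeal I' hI' V ≤ localIdeal I hI V := fun V b hb =>
    localIdeal_local I hI V b fun p hp => by
      obtain ⟨W, hW, hpW, h⟩ := hmul' V b hb p hp
      exact ⟨W, hW, hpW, Ideal.mul_le_left h⟩
  obtain ⟨α, hα⟩ := exists_homSheaf_tensor_ideal L₂ K hI
  obtain ⟨j, hj⟩ := exists_tensor_ideal_le (tensor L₂ K) hle
  obtain ⟨β, hβ⟩ := exists_dual_tensor_homSheaf L₁ j
  obtain ⟨hαi, hβm, g, w, hg, hs⟩ := shortExact_homSheaf (I := localIdeal I hI)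
    (J := localIdeal I hI) (K := localIdeal I' hI') α β hex hmul hmul' fun p => by
      obtain ⟨U, hp, ⟨c₁⟩, ⟨c₂⟩, ⟨cK⟩, ⟨e, he⟩, hxy⟩ := exists_common_frames hL₁ hL₂ hE hK hreg p
      obtain ⟨d, hd⟩ := c₁.exists_dual
      obtain ⟨cP, hP⟩ := c₂.exists_tensor cK
      obtain ⟨cN, hN⟩ := cP.exists_tensor (Coord.ofIdeal I hI U)
      obtain ⟨cQ, hQ⟩ := c₂.exists_tensor (Coord.ofIdeal I hI U)
      obtain ⟨cN', hN'⟩ := cP.exists_tensor (Coord.ofIdeal I' hI' U)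
      obtain ⟨cB, hB⟩ := d.exists_tensor cN'
      -- In coordinates, the inclusion of `P ⊗ I'` in `P ⊗ I` is the inclusion of `I'` in `I`.
      have hjN : ∀ (V : Opens X) (hV : V ≤ U)
          (s : Sec (tensor (tensor L₂ K) (idealSheaf I' hI')) V),
          cN.ap hV (onSec j V s) = cN'.ap hV s :=
        tensor_fn_ext (f := fun V hV => cN.ap hV ∘ₗ onSec j V) (g := fun V hV => cN'.ap hV)
          (fun V W hV hW m => by
            rw [LinearMap.comp_apply, LinearMap.comp_apply, onSec_res, cN.ap_res hV hW])
          (fun V W hV hW m => cN'.ap_res hV hW m) fun V hV t b => by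
            obtain ⟨a, hab⟩ : ∃ a : Sec (idealSheaf I hI) V, toFn a = toFn b :=
              ⟨⟨toFn b, hle V b.2⟩, rfl⟩
            rw [LinearMap.comp_apply, hj V t b a hab, hN, hN', Coord.ofIdeal_ap, Coord.ofIdeal_ap,
              hab]
      refine ⟨U, hp, ⟨
        { cL := c₁
          cQ := cQ
          cN := cN
          cA := cK
          cB := cB
          ap_α := fun V W hV hW k w => ?_
          ap_β := cN.ap_homEval_of_tensor c₁ cB β fun V W hV hW φ s l => ?_
          frame := e
          isFrame := he }⟩, hxy⟩
      · refine (cN.restrict hV).ap_homEval_tensor (cQ.restrict hV) _ _ (fun W' hW' l a => ?_) W hW w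
        change cN.ap (hW'.trans hV) _ = _ * cQ.ap (hW'.trans hV) _
        rw [hα, hN, hP, hQ, cK.ap_res hV hW']
        ring
      · rw [hβ, map_smul, cN.ap_res hV hW, hjN, hB, hd V W hV hW, map_mul (resFn (𝒪 := 𝒪) hW),
          smul_eq_mul]
        ring
  refine ⟨asIso α, β, g, w, hα, fun U V h φ t b a hab l => ?_, hβm, hg, hs⟩
  rw [hβ, hj U t b a hab]

end Sequences
end SheafMod

namespace CplxSurface

/-! ### The square of the ideal of a finite set of points -/

section Square
variable {S : Type u} [TopologicalSpace S] [ChartedSpace C2 S]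

lemma mul_mem_ptIdeal_two (Z : Set S) (U : Opens (TopCat.of S)) (a b : Fn (holSheaf S) U)
    (ha : a ∈ ptIdeal Z 1 U) (hb : b ∈ ptIdeal Z 1 U) : a * b ∈ ptIdeal Z 2 U := by
  rw [mem_localIdeal_one_iff] at ha hb
  refine fun p hp => ⟨U, le_rfl, hp, ?_⟩
  rw [resFn_self]
  change a * b ∈ vanishingIdeal Z U ^ 2
  rw [pow_two]
  exact Ideal.mul_mem_mul ha hb

lemma exists_mem_ptIdeal_mul (Z : Set S) (U : Opens (TopCat.of S)) (b : Fn (holSheaf S) U)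
    (hb : b ∈ ptIdeal Z 2 U) (p : TopCat.of S) (hp : p ∈ U) :
    ∃ (V : Opens (TopCat.of S)) (hV : V ≤ U), p ∈ V ∧
      resFn (𝒪 := holSheaf S) hV b ∈ ptIdeal Z 1 V * ptIdeal Z 1 V := by
  obtain ⟨V, hV, hpV, h⟩ := hb p hp
  have hle : vanishingIdeal Z V ≤ ptIdeal Z 1 V := fun f hf =>
    (mem_localIdeal_one_iff Z V f).2 hf
  refine ⟨V, hV, hpV, Ideal.mul_mono hle hle ?_⟩
  rw [← pow_two]
  exact h

end Square
end CplxSurface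

theorem propositionA2 (S : Type u) [TopologicalSpace S] [T2Space S]
    [ChartedSpace (EuclideanSpace ℂ (Fin 2)) S]
    [IsManifold 𝓘(ℂ, EuclideanSpace ℂ (Fin 2)) ω S]
    (Z : Set S) (hZ : Z.Finite)
    (L₁ L₂ E : ModSheaf (holSheaf S))
    (hL₁ : IsLocallyFreeOfRank L₁ 1) (hL₂ : IsLocallyFreeOfRank L₂ 1)
    (hE : IsLocallyFreeOfRank E 2)
    (i : L₁ ⟶ E) (q : E ⟶ tensor L₂ (idealPow Z 1)) (hiq : i ≫ q = 0)
    (hex : (ShortComplex.mk i q hiq).ShortExact) :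
    (∃ (α : tensor (dual L₂) (tensor L₁ (canonicalSheaf S)) ≅
          homSheaf (tensor L₂ (idealPow Z 1)) (tensor L₁ (canonicalSheaf S)))
        (β : tensor (canonicalSheaf S) (idealPow Z 1) ⟶
          homSheaf L₁ (tensor L₁ (canonicalSheaf S)))
        (g : homSheaf E (tensor L₁ (canonicalSheaf S)) ⟶
          tensor (canonicalSheaf S) (idealPow Z 1))
        (w : (α.hom ≫ precomp q (tensor L₁ (canonicalSheaf S))) ≫ g = 0),
      (∀ (U V : Opens (TopCat.of S)) (h : V ≤ U) (φ : Sec (dual L₂) U)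
          (t : Sec (tensor L₁ (canonicalSheaf S)) U) (l : Sec L₂ V) (a : Sec (idealPow Z 1) V),
        homEval (onSec α.hom U (tmul φ t)) h (tmul l a) =
          smulSec (pairing φ h l * toFn a) (res (tensor L₁ (canonicalSheaf S)) h t)) ∧
      (∀ (U V : Opens (TopCat.of S)) (h : V ≤ U) (k : Sec (canonicalSheaf S) U) (a : Sec (idealPow Z 1) U)
          (l : Sec L₁ V),
        homEval (onSec β U (tmul k a)) h l =
          smulSec (resFn (𝒪 := holSheaf S) h (toFn a)) (tmul l (res (canonicalSheaf S) h k))) ∧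
      Mono β ∧
      g ≫ β = precomp i (tensor L₁ (canonicalSheaf S)) ∧
      (ShortComplex.mk (α.hom ≫ precomp q (tensor L₁ (canonicalSheaf S))) g w).ShortExact) ∧
    (∃ (α : canonicalSheaf S ≅
          homSheaf (tensor L₂ (idealPow Z 1))
            (tensor (tensor L₂ (canonicalSheaf S)) (idealPow Z 1)))
        (β : tensor (dual L₁) (tensor (tensor L₂ (canonicalSheaf S)) (idealPow Z 2)) ⟶
          homSheaf L₁ (tensor (tensor L₂ (canonicalSheaf S)) (idealPow Z 1)))
        (g : homSheaf E (tensor (tensor L₂ (canonicalSheaf S)) (idealPow Z 1)) ⟶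
          tensor (dual L₁) (tensor (tensor L₂ (canonicalSheaf S)) (idealPow Z 2)))
        (w : (α.hom ≫ precomp q (tensor (tensor L₂ (canonicalSheaf S)) (idealPow Z 1))) ≫ g = 0),
      (∀ (U V : Opens (TopCat.of S)) (h : V ≤ U) (k : Sec (canonicalSheaf S) U) (l : Sec L₂ V)
          (a : Sec (idealPow Z 1) V),
        homEval (onSec α.hom U k) h (tmul l a) =
          tmul (tmul l (res (canonicalSheaf S) h k)) a) ∧
      (∀ (U V : Opens (TopCat.of S)) (h : V ≤ U) (φ : Sec (dual L₁) U)
          (t : Sec (tensor L₂ (canonicalSheaf S)) U) (b : Sec (idealPow Z 2) U)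
          (a : Sec (idealPow Z 1) U) (_ : toFn a = toFn b) (l : Sec L₁ V),
        homEval (onSec β U (tmul φ (tmul t b))) h l =
          smulSec (pairing φ h l)
            (res (tensor (tensor L₂ (canonicalSheaf S)) (idealPow Z 1)) h (tmul t a))) ∧
      Mono β ∧
      g ≫ β = precomp i (tensor (tensor L₂ (canonicalSheaf S)) (idealPow Z 1)) ∧
      (ShortComplex.mk
        (α.hom ≫ precomp q (tensor (tensor L₂ (canonicalSheaf S)) (idealPow Z 1))) g
        w).ShortExact) :=
  ⟨exists_shortExact_tensor hL₁ hL₂ hE exists_coord_canonicalSheaf (exists_isRegularPair hZ) hex,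
    exists_shortExact_tensor_ideal hL₁ hL₂ hE exists_coord_canonicalSheaf
      (exists_isRegularPair hZ) (fun U a ha b hb => mul_mem_ptIdeal_two Z U a b ha hb)
      (exists_mem_ptIdeal_mul Z) hex⟩
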